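/- Let $0<\rho<1$ be a real number and let $N,m,L$ be positive integers with $N,L\ge 2$ such that the sum $$D=\{0,1,\dots,N-1\}\oplus m\{0,1,\dots,L-1\}$$ is direct, i.e. every element of $D$ is $a+mb$ for exactly one pair $(a,b)$ with $0\le a<N$, $0\le b<L$ (equivalently, $m\ge N$). Let $\mu=\mu_{\rho,D}$ be the self-similar measure, i.e. the unique Borel probability measure on $\mathbb{R}$ with $$\mu=\frac1{\#D}\sum_{d\in D}\mu\circ\phi_d^{-1},\qquad \phi_d(x)=\rho(x+d).$$ Then $\mu$ is a spectral measure, i.e. there is a countable set $\Lambda\subset\mathbb{R}$ such that $\{e^{2\pi i\lambda x}:\lambda\in\Lambda\}$ is an orthonormal basis of $L^2(\mu)$, if and only if $p:=\rho^{-1}$ is an integer satisfying $$N\mid p,\qquad L\mid p,\qquad\text{and}\qquad N\,\Big|\,\frac{m}{\gcd(m,p^{d})},$$ where $$d=\max\Big\{i\in\{0,1,2,\dots\}:\ \gcd\Big(\frac{mL}{\gcd(mL,p^{i})},\,L\Big)\neq 1\Big\},$$ a maximum that exists as soon as $L\mid p$. -/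

import Mathlib

namespace ProductFormSpectral

open MeasureTheory

/-- `μ` is the self-similar measure `μ_{ρ,D}` of the iterated function system
`φ_d(x) = ρ (x + d)`, `d ∈ D`: a Borel probability measure on `ℝ` with
`μ = (#D)⁻¹ ∑_{d ∈ D} μ ∘ φ_d⁻¹`. For `0 < ρ < 1` and `D` nonempty there is exactly one such
measure, see `existsUnique_isSelfSimilarMeasure`. -/
structure IsSelfSimilarMeasure (ρ : ℝ) (D : Finset ℝ) (μ : Measure ℝ) : Prop where
  isProbabilityMeasure : IsProbabilityMeasure μ
  eq_sum_map : μ = (D.card : ENNReal)⁻¹ • ∑ d ∈ D, μ.map (fun x => ρ * (x + d))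

/-- `μ` is a spectral measure: for some countable `Λ ⊆ ℝ`, the family
`(e^{2πiλx})_{λ ∈ Λ}` is an orthonormal (Hilbert) basis of `L²(μ)`. -/
def IsSpectral (μ : Measure ℝ) : Prop :=
  ∃ Λ : Set ℝ, Λ.Countable ∧ ∃ b : HilbertBasis Λ ℂ (Lp ℂ 2 μ),
    ∀ l : Λ, (b l : ℝ → ℂ) =ᵐ[μ]
      fun x => Complex.exp (2 * Real.pi * Complex.I * ((l : ℝ) : ℂ) * (x : ℂ))

/-- The sumset `{0, …, N-1} + m {0, …, L-1}`, as a finite set of reals. -/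
noncomputable def digitSet (N m L : ℕ) : Finset ℝ :=
  (Finset.range N ×ˢ Finset.range L).image (fun q => (q.1 : ℝ) + (m : ℝ) * (q.2 : ℝ))

/-- The sum `{0, …, N-1} + m {0, …, L-1}` is direct: each of its elements is `a + m b` for
only one pair `(a, b)`. This is what the symbol `⊕` asserts. -/
def IsDirectSum (N m L : ℕ) : Prop :=
  ∀ a < N, ∀ b < L, ∀ a' < N, ∀ b' < L, a + m * b = a' + m * b' → a = a' ∧ b = b'

theorem existsUnique_isSelfSimilarMeasure {ρ : ℝ} (h0 : 0 < ρ) (h1 : ρ < 1)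
    {D : Finset ℝ} (hD : D.Nonempty) : ∃! μ : Measure ℝ, IsSelfSimilarMeasure ρ D μ := by
  have hcard : (D.card : ENNReal) ≠ 0 := by simpa using hD.ne_empty
  have hcard' : (D.card : ENNReal) ≠ ⊤ := by simp
  apply existsUnique_of_exists_of_unique
  · -- the law of `∑ ρ^(j+1) d_j` for independent uniform digits `d_j`
    let U : Measure D := (D.card : ENNReal)⁻¹ • ∑ d : D, Measure.dirac d
    have hU : IsProbabilityMeasure U := ⟨by
      simp [U, Measure.finsetSum_apply, ENNReal.inv_mul_cancel hcard hcard']⟩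
    let P : Measure (ℕ → D) := Measure.infinitePi (fun _ => U)
    let X : (ℕ → D) → ℝ := fun ω => ∑' j, ρ ^ (j + 1) * (ω j : ℝ)
    let c : D × (ℕ → D) → (ℕ → D) := fun q j => Nat.casesOn j q.1 q.2
    have hc : Measurable c := by
      refine measurable_pi_iff.2 fun j => ?_
      cases j with
      | zero => exact measurable_fst
      | succ k => exact (measurable_pi_apply k).comp measurable_snd
    have hP : (U.prod P).map c = P := by
      refine Measure.eq_infinitePi _ fun s t ht => ?_
      rw [Measure.map_apply hc (MeasurableSet.pi s.countable_toSet fun i _ => ht i)]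
      let s' : Finset ℕ := (s.erase 0).image Nat.pred
      let t0 : Set D := if 0 ∈ s then t 0 else Set.univ
      have hpre : c ⁻¹' (Set.pi s t) = t0 ×ˢ Set.pi s' (fun i => t (i + 1)) := by
        ext q
        simp only [Set.mem_preimage, Set.mem_pi, Set.mem_prod, t0, s', c]
        constructor
        · intro h
          refine ⟨?_, ?_⟩
          · split_ifs with h0
            · exact h 0 h0
            · trivial
          · intro i hi
            simp only [Finset.coe_image, Set.mem_image, Finset.mem_coe, Finset.mem_erase] at hi
            obtain ⟨j, ⟨hj, hjs⟩, rfl⟩ := hi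
            cases j with
            | zero => exact absurd rfl hj
            | succ k => exact h (k + 1) hjs
        · rintro ⟨ha, hb⟩ i hi
          cases i with
          | zero =>
            have : 0 ∈ s := hi
            simpa [this] using ha
          | succ k =>
            refine hb k ?_
            simp only [Finset.coe_image, Set.mem_image, Finset.mem_coe, Finset.mem_erase]
            exact ⟨k + 1, ⟨Nat.succ_ne_zero k, hi⟩, rfl⟩
      rw [hpre, Measure.prod_prod, Measure.infinitePi_pi _ (fun i _ => ht (i + 1))]
      have hprod : ∏ i ∈ s', U (t (i + 1)) = ∏ i ∈ s.erase 0, U (t i) := by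
        rw [Finset.prod_image]
        · refine Finset.prod_congr rfl fun i hi => ?_
          rw [Nat.pred_eq_sub_one, Nat.sub_add_cancel
            (Nat.one_le_iff_ne_zero.2 (Finset.ne_of_mem_erase hi))]
        · intro i hi j hj hij
          have hi' := Finset.ne_of_mem_erase hi
          have hj' := Finset.ne_of_mem_erase hj
          simp only [Nat.pred_eq_sub_one] at hij
          omega
      rw [hprod]
      by_cases h : 0 ∈ s
      · simp only [t0, if_pos h]
        exact Finset.mul_prod_erase s (fun i => U (t i)) h
      · simp only [t0, if_neg h, measure_univ, one_mul, Finset.erase_eq_of_notMem h]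
    obtain ⟨C, hC⟩ : ∃ C : ℝ, ∀ d : D, |(d : ℝ)| ≤ C := by
      obtain ⟨C, hC⟩ := (Set.finite_range (fun d : D => |(d : ℝ)|)).bddAbove
      exact ⟨C, fun d => hC ⟨d, rfl⟩⟩
    have hsum : ∀ ω : ℕ → D, Summable fun j => ρ ^ (j + 1) * (ω j : ℝ) := by
      intro ω
      have hg : Summable fun j : ℕ => ρ ^ (j + 1) * C :=
        ((summable_nat_add_iff 1).2 (summable_geometric_of_lt_one h0.le h1)).mul_right C
      refine Summable.of_norm_bounded hg fun j => ?_
      rw [norm_mul, Real.norm_eq_abs, Real.norm_eq_abs, abs_of_pos (pow_pos h0 _)]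
      exact mul_le_mul_of_nonneg_left (hC _) (pow_pos h0 _).le
    have hX : Measurable X := by
      refine measurable_of_tendsto_metrizable (f := fun n ω =>
        ∑ j ∈ Finset.range n, ρ ^ (j + 1) * (ω j : ℝ)) (fun n => ?_) ?_
      · fun_prop
      · rw [tendsto_pi_nhds]
        exact fun ω => (hsum ω).hasSum.tendsto_sum_nat
    have hXc : ∀ q, X (c q) = ρ * (X q.2 + (q.1 : ℝ)) := by
      intro q
      have := (hsum (c q)).tsum_eq_zero_add
      simp only [X]
      rw [this, mul_add, ← tsum_mul_left]
      simp only [c, zero_add, pow_one]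
      rw [add_comm]
      congr 1
      refine tsum_congr fun j => ?_
      ring
    have hUP : U.prod P = (D.card : ENNReal)⁻¹ • ∑ d : D, P.map (fun ω => (d, ω)) := by
      refine Measure.prod_eq fun A B hA hB => ?_
      simp only [Measure.smul_apply, Measure.finsetSum_apply, U, smul_eq_mul]
      rw [mul_assoc, Finset.sum_mul]
      congr 1
      refine Finset.sum_congr rfl fun d _ => ?_
      rw [Measure.map_apply (by fun_prop) (hA.prod hB), Measure.dirac_apply' _ hA]
      by_cases h : d ∈ A
      · have : (fun ω : ℕ → D => (d, ω)) ⁻¹' A ×ˢ B = B := by ext; simp [h]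
        simp [this, h]
      · have : (fun ω : ℕ → D => (d, ω)) ⁻¹' A ×ˢ B = ∅ := by ext; simp [h]
        simp [this, h]
    refine ⟨P.map X, Measure.isProbabilityMeasure_map hX.aemeasurable, ?_⟩
    have key : P.map X = (D.card : ENNReal)⁻¹ •
        ∑ d : D, (P.map X).map (fun x => ρ * (x + (d : ℝ))) := by
      conv_lhs => rw [← hP, Measure.map_map hX hc, hUP]
      rw [Measure.map_smul]
      congr 1
      rw [← Measure.mapₗ_apply_of_measurable (hX.comp hc), map_sum]
      refine Finset.sum_congr rfl fun d _ => ?_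
      rw [Measure.mapₗ_apply_of_measurable (hX.comp hc), Measure.map_map (hX.comp hc) (by fun_prop),
        Measure.map_map (by fun_prop) hX]
      congr 1
      funext ω
      exact hXc (d, ω)
    rw [← Finset.sum_coe_sort D (fun d => (P.map X).map (fun x => ρ * (x + d)))]
    exact key
  · intro μ ν hμ hν
    have := hμ.isProbabilityMeasure
    have := hν.isProbabilityMeasure
    have hfun : ∀ η : Measure ℝ, IsSelfSimilarMeasure ρ D η → ∀ t : ℝ,
        charFun η t = (D.card : ℂ)⁻¹ *
          (∑ d ∈ D, Complex.exp ((ρ * t * d : ℝ) * Complex.I)) * charFun η (ρ * t) := by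
      intro η hη t
      have := hη.isProbabilityMeasure
      conv_lhs => rw [charFun_apply_real, hη.eq_sum_map, integral_smul_measure,
        integral_finsetSum_measure (fun d _ => by
          have := Measure.isProbabilityMeasure_map (μ := η)
            (f := fun x : ℝ => ρ * (x + d)) (by fun_prop)
          refine Integrable.of_bound (C := 1) (by fun_prop) (ae_of_all _ fun x => ?_)
          rw [← Complex.ofReal_mul, Complex.norm_exp_ofReal_mul_I])]
      rw [mul_assoc, Finset.sum_mul]
      simp only [ENNReal.toReal_inv, ENNReal.toReal_natCast, Complex.real_smul,
        Complex.ofReal_inv, Complex.ofReal_natCast]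
      congr 1
      refine Finset.sum_congr rfl fun d _ => ?_
      rw [integral_map (by fun_prop) (by fun_prop), charFun_apply_real, ← integral_const_mul]
      congr 1
      funext x
      rw [← Complex.exp_add]
      congr 1
      push_cast
      ring
    have hm : ∀ t : ℝ, ‖(D.card : ℂ)⁻¹ *
        (∑ d ∈ D, Complex.exp ((ρ * t * d : ℝ) * Complex.I))‖ ≤ 1 := by
      intro t
      rw [norm_mul, norm_inv, Complex.norm_natCast]
      have : ‖∑ d ∈ D, Complex.exp ((ρ * t * d : ℝ) * Complex.I)‖ ≤ D.card := by
        refine (norm_sum_le _ _).trans ?_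
        simp only [Complex.norm_exp_ofReal_mul_I]
        simp
      exact inv_mul_le_one_of_le₀ this (Nat.cast_nonneg _)
    have hstep : ∀ t : ℝ, ‖charFun μ t - charFun ν t‖ ≤
        ‖charFun μ (ρ * t) - charFun ν (ρ * t)‖ := by
      intro t
      rw [hfun μ hμ t, hfun ν hν t, ← mul_sub, norm_mul]
      exact mul_le_of_le_one_left (norm_nonneg _) (hm t)
    have hiter : ∀ (n : ℕ) (t : ℝ), ‖charFun μ t - charFun ν t‖ ≤
        ‖charFun μ (ρ ^ n * t) - charFun ν (ρ ^ n * t)‖ := by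
      intro n
      induction n with
      | zero => intro t; simp
      | succ k ih =>
        intro t
        refine (ih t).trans ((hstep _).trans_eq ?_)
        rw [pow_succ', mul_assoc]
    apply Measure.ext_of_charFun
    funext t
    have hlim : Filter.Tendsto (fun n : ℕ => ‖charFun μ (ρ ^ n * t) - charFun ν (ρ ^ n * t)‖)
        Filter.atTop (nhds 0) := by
      have h2 : Continuous fun s : ℝ => ‖charFun μ s - charFun ν s‖ := by
        have := continuous_charFun (μ := μ)
        have := continuous_charFun (μ := ν)
        fun_prop
      have h3 : Filter.Tendsto (fun n : ℕ => ρ ^ n * t) Filter.atTop (nhds 0) := by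
        simpa using (tendsto_pow_atTop_nhds_zero_of_lt_one h0.le h1).mul_const t
      have h4 := (h2.tendsto 0).comp h3
      simpa [Function.comp_def] using h4
    have := ge_of_tendsto' hlim fun n => hiter n t
    exact sub_eq_zero.1 (norm_le_zero_iff.1 this)

end ProductFormSpectral

/-! The Fourier transform of `μ` is the product over `k ≥ 1` of `mask N (ρ^k ξ) * mask L (ρ^k m ξ)`
(`fourier_eq_twoIp`), and `Λ` is a spectrum exactly when the sum over `λ ∈ Λ` of `‖f (ξ - λ)‖²` is 1
for every `ξ`, where `f` is that product. The problem thus concerns products of masks, which are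
positive definite and therefore satisfy Bessel's inequality.

Necessity rests on a peeling principle (`fibre_rigidity`, `IsSpec.rigidity`). Let `Λ` be a spectrum
of `η ν`, and let a subgroup `H` separate the zeros: distinct points of `Λ` with difference in `H`
are orthogonal for `η`, and points with difference outside `H` are orthogonal for `ν`. Two Bessel
inequalities then multiply to an equality, so each class modulo `H` is a spectrum of `η`, each set
of representatives is a spectrum of `ν`, and `‖ν (ξ - x)‖` is constant along a class. In particular
no nontrivial factor of a spectral product is superfluous for orthogonality
(`IsSpec.norm_eq_one_of_orth`).

The principle is used as follows. If `ρ⁻¹` were irrational, the levels `k` with `ρ^{-k} ∈ ρ⁻¹ ℚ`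
could be separated from the others and would be superfluous (`IsSpec.exists_rat`). Once `ρ⁻¹ = p` is
an integer, a part of `N` or `L` not dividing `p` is superfluous, since its zeros at the second
level are zeros of the first level (`IsSpec.dvd_base`). For the last condition the first `d` levels
of the second factor are peeled off, and the lowest layers of the two factors are then compared at a
prime power dividing `N` but not `m / gcd (m, p^d)`: either one layer becomes superfluous, or two
layers of the same prime size compete for the same residue classes (`IsSpec.dvd_of_isGreatest`).
This direction needs only that `d` belongs to the set, not that it is maximal.

Rational non-integral ratios `p / q` need analysis instead of peeling (`IsSpec.denominator_eq_one`).
Frequencies at distance less than `c p^(n+1)` from a base point are orthogonal already for the first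
`n` levels, while for `q ≥ 2` the transform decays like a negative power of the logarithm. Distant
frequencies therefore contribute too little to ever close the gap in Parseval's identity.

For sufficiency, write `m / p^d = a / q` in lowest terms. Maximality of `d` makes `a / gcd (a, p /
L)` prime to `L`, and together with `N ∣ a` this gives a finite set of digits that is a spectrum of
one level. A tower of such digit sets, with representatives shifted away from the zeros of the
transform, has an integer spectrum as its limit (`RefinementData.exists_int_spectrum`). The `d`
removed levels are put back one at a time, and the result is rescaled by `q`. -/

namespace ProductFormSpectral

open MeasureTheory Filter Topology ComplexConjugate

/-! ### Masks: normalised geometric sums of exponentials -/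

/-- The character `x ↦ e^{2πix}`. -/
noncomputable def ee (x : ℝ) : ℂ := Complex.exp ((2 * Real.pi * x : ℝ) * Complex.I)

@[simp] lemma norm_ee (x : ℝ) : ‖ee x‖ = 1 := Complex.norm_exp_ofReal_mul_I _

@[simp] lemma ee_zero : ee 0 = 1 := by simp [ee]

lemma ee_add (x y : ℝ) : ee (x + y) = ee x * ee y := by
  rw [ee, ee, ee, ← Complex.exp_add]; congr 1; push_cast; ring

lemma ee_neg (x : ℝ) : ee (-x) = conj (ee x) := by
  rw [ee, ee, ← Complex.exp_conj, map_mul, Complex.conj_ofReal, Complex.conj_I]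
  congr 1; push_cast; ring

lemma ee_sub (x y : ℝ) : ee (x - y) = ee x * conj (ee y) := by
  rw [sub_eq_add_neg, ee_add, ee_neg]

lemma ee_nat_mul (n : ℕ) (x : ℝ) : ee (n * x) = ee x ^ n := by
  rw [ee, ee, ← Complex.exp_nat_mul]; congr 1; push_cast; ring

lemma ee_eq_one_iff {x : ℝ} : ee x = 1 ↔ ∃ a : ℤ, x = a := by
  rw [ee, Complex.exp_eq_one_iff]
  refine exists_congr fun a => ?_
  have h : (2 * (Real.pi : ℂ) * Complex.I) ≠ 0 := Complex.two_pi_I_ne_zero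
  constructor
  · intro h1
    have h2 : (2 * (Real.pi : ℂ) * Complex.I) * x = (2 * (Real.pi : ℂ) * Complex.I) * a := by
      push_cast at h1
      linear_combination h1
    exact_mod_cast mul_left_cancel₀ h h2
  · rintro rfl
    push_cast; ring

lemma ee_intCast (a : ℤ) : ee a = 1 := ee_eq_one_iff.2 ⟨a, rfl⟩

lemma norm_ee_sub_le (x y : ℝ) : ‖ee x - ee y‖ ≤ 2 * Real.pi * |x - y| := by
  have h : ee x - ee y = ee y * (ee (x - y) - 1) := by
    rw [mul_sub, ← ee_add]; simp
  rw [h, norm_mul, norm_ee, one_mul, ee]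
  refine (Real.norm_exp_I_mul_ofReal_sub_one_le (x := 2 * Real.pi * (x - y)) |>.trans_eq' ?_).trans_eq ?_
  · rw [mul_comm]
  · rw [Real.norm_eq_abs, abs_mul, abs_of_pos Real.two_pi_pos]

/-- The normalised exponential sum `n⁻¹ ∑_{j < n} e^{2πijx}`. -/
noncomputable def mask (n : ℕ) (x : ℝ) : ℂ := (n : ℂ)⁻¹ * ∑ j ∈ Finset.range n, ee (j * x)

lemma mask_one (x : ℝ) : mask 1 x = 1 := by simp [mask]

lemma mask_zero_right {n : ℕ} (hn : 1 ≤ n) : mask n 0 = 1 := by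
  have : (n : ℂ) ≠ 0 := by exact_mod_cast (by omega : n ≠ 0)
  simp [mask, this]

lemma norm_mask_le_one (n : ℕ) (x : ℝ) : ‖mask n x‖ ≤ 1 := by
  rw [mask, norm_mul, norm_inv, Complex.norm_natCast]
  have : ‖∑ j ∈ Finset.range n, ee (j * x)‖ ≤ n :=
    (norm_sum_le _ _).trans (by simp)
  exact inv_mul_le_one_of_le₀ this (Nat.cast_nonneg _)

lemma mask_neg (n : ℕ) (x : ℝ) : mask n (-x) = conj (mask n x) := by
  simp only [mask, map_mul, map_inv₀, map_sum, Complex.conj_natCast, ← ee_neg, mul_neg]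

lemma mask_add_int (n : ℕ) (x : ℝ) (k : ℤ) : mask n (x + k) = mask n x := by
  rw [mask, mask]
  congr 1
  refine Finset.sum_congr rfl fun j _ => ?_
  rw [mul_add, ee_add]
  have : ee (j * k) = 1 := ee_eq_one_iff.2 ⟨j * k, by push_cast; ring⟩
  rw [this, mul_one]

lemma mask_int {n : ℕ} (hn : 1 ≤ n) (k : ℤ) : mask n k = 1 := by
  simpa [mask_zero_right hn] using mask_add_int n 0 k

lemma mask_mul_ee_sub_one (n : ℕ) (x : ℝ) :
    mask n x * (ee x - 1) = (n : ℂ)⁻¹ * (ee (n * x) - 1) := by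
  simp only [mask, ee_nat_mul]
  rw [mul_assoc, geom_sum_mul]

lemma mask_eq_zero_iff {n : ℕ} (hn : 1 ≤ n) {x : ℝ} :
    mask n x = 0 ↔ ∃ a : ℤ, ¬ (n : ℤ) ∣ a ∧ n * x = a := by
  have hn0 : (n : ℂ) ≠ 0 := by exact_mod_cast (by omega : n ≠ 0)
  have hn1 : (n : ℝ) ≠ 0 := by exact_mod_cast (by omega : n ≠ 0)
  have key := mask_mul_ee_sub_one n x
  constructor
  · intro h
    rw [h, zero_mul] at key
    have h1 : ee (n * x) = 1 := by
      have := (mul_eq_zero.1 key.symm).resolve_left (inv_ne_zero hn0)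
      exact sub_eq_zero.1 this
    obtain ⟨a, ha⟩ := ee_eq_one_iff.1 h1
    refine ⟨a, ?_, ha⟩
    rintro ⟨b, rfl⟩
    have hx : x = b := by
      push_cast at ha
      exact mul_left_cancel₀ hn1 ha
    rw [hx, mask_int hn] at h
    exact one_ne_zero h
  · rintro ⟨a, ha, hx⟩
    rw [hx, ee_intCast, sub_self, mul_zero] at key
    refine (mul_eq_zero.1 key).resolve_right fun h => ?_
    obtain ⟨b, hb⟩ := ee_eq_one_iff.1 (sub_eq_zero.1 h)
    apply ha
    refine ⟨b, ?_⟩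
    rw [hb] at hx
    exact_mod_cast hx.symm

/-- Equality in the triangle inequality forces the first two terms, 1 and `ee x`, to be aligned.
This is how a unimodular factor yields integrality of a frequency. -/
lemma exists_int_of_norm_mask_eq_one {n : ℕ} (hn : 2 ≤ n) {x : ℝ} (h : ‖mask n x‖ = 1) :
    ∃ a : ℤ, x = a := by
  rw [← ee_eq_one_iff]
  by_contra hne
  have h1 : ‖1 + ee x‖ < 2 := by
    have := norm_add_lt_of_not_sameRay (x := (1 : ℂ)) (y := ee x) (by
      intro hs
      have := (sameRay_iff_norm_smul_eq).1 hs
      simp at this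
      exact hne this)
    simpa [one_add_one_eq_two] using this
  have h2 : ‖∑ j ∈ Finset.range n, ee (j * x)‖ < n := by
    obtain ⟨k, rfl⟩ := Nat.exists_eq_add_of_le hn
    rw [Finset.sum_range_add]
    have e2 : ∑ j ∈ Finset.range 2, ee (j * x) = 1 + ee x := by
      simp [Finset.sum_range_succ]
    rw [e2]
    refine (norm_add_le _ _).trans_lt ?_
    have h3 : ‖∑ j ∈ Finset.range k, ee (((2 + j : ℕ) : ℝ) * x)‖ ≤ k :=
      (norm_sum_le _ _).trans (by simp)
    push_cast at h3 ⊢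
    linarith
  rw [mask, norm_mul, norm_inv, Complex.norm_natCast] at h
  have hn0 : (0 : ℝ) < n := by exact_mod_cast (by omega : 0 < n)
  rw [inv_mul_eq_one₀ hn0.ne'] at h
  linarith

/-- Digits below `a * b` are `i + a j`. The resulting layers, in particular those of prime size, are
the units that the necessity proof removes. -/
lemma mask_mul (a b : ℕ) (x : ℝ) : mask (a * b) x = mask a x * mask b (a * x) := by
  have h : ∑ j ∈ Finset.range (a * b), ee (j * x) =
      (∑ j ∈ Finset.range a, ee (j * x)) * ∑ j ∈ Finset.range b, ee (j * (a * x)) := by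
    induction b with
    | zero => simp
    | succ b ih =>
      rw [Nat.mul_succ, Finset.sum_range_add, ih, Finset.sum_range_succ (n := b), mul_add]
      congr 1
      rw [Finset.sum_mul]
      refine Finset.sum_congr rfl fun j _ => ?_
      rw [← ee_add]; congr 1; push_cast; ring
  rw [mask, mask, mask, h]; push_cast; rw [mul_inv]; ring

/-- The bound `B` in place of `n` gives one Lipschitz constant for all masks of a product whose
sizes vary. -/
lemma norm_mask_sub_le {n B : ℕ} (hn : n ≤ B) (x y : ℝ) :
    ‖mask n x - mask n y‖ ≤ 2 * Real.pi * B * |x - y| := by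
  rw [mask, mask, ← mul_sub, ← Finset.sum_sub_distrib, norm_mul, norm_inv, Complex.norm_natCast]
  have h : ‖∑ j ∈ Finset.range n, (ee (j * x) - ee (j * y))‖ ≤ n * (2 * Real.pi * B * |x - y|) := by
    refine (norm_sum_le _ _).trans ?_
    have : ∀ j ∈ Finset.range n, ‖ee (j * x) - ee (j * y)‖ ≤ 2 * Real.pi * B * |x - y| := by
      intro j hj
      refine (norm_ee_sub_le _ _).trans ?_
      rw [← mul_sub, abs_mul, Nat.abs_cast, ← mul_assoc]
      have : (j : ℝ) ≤ B := by exact_mod_cast (Finset.mem_range.1 hj).le.trans hn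
      gcongr
    simpa using Finset.sum_le_card_nsmul _ _ _ this
  rcases Nat.eq_zero_or_pos n with rfl | hn0
  · simp; positivity
  · have : (0 : ℝ) < n := by exact_mod_cast hn0
    exact (inv_mul_le_iff₀ this).2 h

lemma continuous_mask (n : ℕ) : Continuous (mask n) := by
  unfold mask ee; fun_prop

/-- Parseval on `ℤ / n`: after expanding the squares, summing over the shifts kills the term `(a,
b)` with `a ≠ b`, because `n ∤ (a - b) u`. -/
lemma sum_norm_mask_sq {n : ℕ} (hn : 1 ≤ n) {u : ℤ} (hu : IsCoprime u (n : ℤ)) (x : ℝ) :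
    ∑ j ∈ Finset.range n, ‖mask n (x - u * j / n)‖ ^ 2 = 1 := by
  have hn1 : (n : ℝ) ≠ 0 := by exact_mod_cast (by omega : n ≠ 0)
  have hn0 : (n : ℂ) ≠ 0 := by exact_mod_cast (by omega : n ≠ 0)
  have h1 : ∀ y : ℝ, ((‖mask n y‖ ^ 2 : ℝ) : ℂ) = (n : ℂ)⁻¹ ^ 2 *
      ∑ a ∈ Finset.range n, ∑ b ∈ Finset.range n, ee ((a - b : ℝ) * y) := by
    intro y
    rw [Complex.ofReal_pow, ← Complex.mul_conj', mask, map_mul, map_sum, map_inv₀,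
      Complex.conj_natCast, mul_mul_mul_comm, ← pow_two, Finset.sum_mul_sum]
    simp only [sub_mul, ee_sub]
  have h2 : ∀ a ∈ Finset.range n, ∀ b ∈ Finset.range n,
      ∑ j ∈ Finset.range n, ee ((a - b : ℝ) * (x - u * j / n)) = if a = b then (n : ℂ) else 0 := by
    intro a ha b hb
    split_ifs with hab
    · simp [hab]
    · have h3 : ∀ j ∈ Finset.range n, ee ((a - b : ℝ) * (x - u * j / n)) =
          ee ((a - b : ℝ) * x) * ee (j * (-((a - b : ℝ) * u / n))) := by
        intro j _
        rw [← ee_add]; congr 1; ring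
      rw [Finset.sum_congr rfl h3, ← Finset.mul_sum]
      have h4 : mask n (-((a - b : ℝ) * u / n)) = 0 := by
        rw [mask_eq_zero_iff hn]
        refine ⟨-((a - b) * u), ?_, ?_⟩
        · rw [dvd_neg]
          intro hd
          have h5 := hu.symm.dvd_of_dvd_mul_right hd
          have h6 := Int.eq_zero_of_abs_lt_dvd h5 (by
            rw [abs_lt]
            simp only [Finset.mem_range] at ha hb
            omega)
          omega
        · push_cast; field_simp
      rw [mask, mul_eq_zero] at h4
      rw [h4.resolve_left (inv_ne_zero hn0), mul_zero]
  have : ((∑ j ∈ Finset.range n, ‖mask n (x - u * j / n)‖ ^ 2 : ℝ) : ℂ) = 1 := by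
    rw [Complex.ofReal_sum, Finset.sum_congr rfl fun j _ => h1 _, ← Finset.mul_sum,
      Finset.sum_comm, Finset.sum_congr rfl fun a _ => Finset.sum_comm,
      Finset.sum_congr rfl fun a ha => Finset.sum_congr rfl (h2 a ha)]
    have h3 : ∀ a ∈ Finset.range n, ∑ b ∈ Finset.range n, (if a = b then (n : ℂ) else 0) = n :=
      fun a ha => by rw [Finset.sum_ite_eq, if_pos ha]
    rw [Finset.sum_congr rfl h3, Finset.sum_const, Finset.card_range, nsmul_eq_mul]
    field_simp
  exact_mod_cast this

lemma exists_norm_mask_le {n : ℕ} (hn : 2 ≤ n) {δ : ℝ} (hδ : 0 < δ) :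
    ∃ c : ℝ, 0 < c ∧ c < 1 ∧ ∀ x : ℝ, (∀ a : ℤ, δ ≤ |x - a|) → ‖mask n x‖ ≤ c := by
  have hK : IsCompact (Set.Icc δ (1 - δ)) := isCompact_Icc
  rcases (Set.Icc δ (1 - δ)).eq_empty_or_nonempty with he | hne
  · refine ⟨1 / 2, by norm_num, by norm_num, fun x hx => ?_⟩
    exfalso
    have h1 := hx ⌊x⌋
    have h2 := hx (⌊x⌋ + 1)
    rw [← Int.fract, abs_of_nonneg (Int.fract_nonneg x)] at h1
    push_cast at h2
    rw [← sub_sub, ← Int.fract, abs_of_nonpos (by linarith [Int.fract_lt_one x])] at h2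
    have : Int.fract x ∈ Set.Icc δ (1 - δ) := ⟨h1, by linarith⟩
    rw [he] at this
    exact this
  · obtain ⟨y, hy, hmax⟩ := hK.exists_isMaxOn hne (continuous_mask n).norm.continuousOn
    have hlt : ‖mask n y‖ < 1 := by
      refine lt_of_le_of_ne (norm_mask_le_one n y) fun h => ?_
      obtain ⟨a, rfl⟩ := exists_int_of_norm_mask_eq_one hn h
      have h1 : (0 : ℝ) < a := hδ.trans_le hy.1
      have h2 : (a : ℝ) < 1 := by linarith [hy.2]
      have h1' : 0 < a := by exact_mod_cast h1
      have h2' : a < 1 := by exact_mod_cast h2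
      omega
    -- The value 1/2 only guarantees that the bound is positive.
    refine ⟨max (‖mask n y‖) (1 / 2), by positivity, max_lt hlt (by norm_num), fun x hx => ?_⟩
    have h1 := hx ⌊x⌋
    have h2 := hx (⌊x⌋ + 1)
    rw [← Int.fract, abs_of_nonneg (Int.fract_nonneg x)] at h1
    push_cast at h2
    rw [← sub_sub, ← Int.fract, abs_of_nonpos (by linarith [Int.fract_lt_one x])] at h2
    have h3 := hmax (⟨h1, by linarith⟩ : Int.fract x ∈ Set.Icc δ (1 - δ))
    have h4 : mask n (Int.fract x) = mask n x := by
      rw [← mask_add_int n (Int.fract x) ⌊x⌋, Int.fract_add_floor]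
    have h5 : ‖mask n (Int.fract x)‖ ≤ ‖mask n y‖ := h3
    rw [h4] at h5
    exact h5.trans (le_max_left _ _)

/-- Countability lets a generic point avoid the zeros of countably many translates of all factors at
once. -/
lemma countable_mask_zeros {n : ℕ} (hn : 1 ≤ n) {c : ℝ} (hc : c ≠ 0) :
    {x : ℝ | mask n (c * x) = 0}.Countable := by
  refine (Set.countable_range fun a : ℤ => (a : ℝ) / (n * c)).mono fun x hx => ?_
  obtain ⟨a, -, ha⟩ := (mask_eq_zero_iff hn).1 hx
  have hn1 : (n : ℝ) ≠ 0 := by exact_mod_cast (by omega : n ≠ 0)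
  refine ⟨a, ?_⟩
  simp only
  rw [← ha]; field_simp

/-! ### Positive definite functions and Bessel's inequality -/

/-- Positive definiteness of a function on `ℝ`. -/
def PosDefFn (f : ℝ → ℂ) : Prop :=
  ∀ (ι : Type) [Fintype ι] (x : ι → ℝ) (c : ι → ℂ),
    0 ≤ (∑ i, ∑ j, c i * conj (c j) * f (x i - x j)).re

/-- A mask is an average of characters, and each character is absorbed into the coefficients `c i`.
-/
lemma PosDefFn.mask_mul {f : ℝ → ℂ} (hf : PosDefFn f) (n : ℕ) (a : ℝ) :
    PosDefFn fun x => mask n (a * x) * f x := by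
  intro ι _ x c
  have h : ∑ i, ∑ j, c i * conj (c j) * (mask n (a * (x i - x j)) * f (x i - x j)) =
      ((n : ℝ)⁻¹ : ℝ) * ∑ k ∈ Finset.range n, ∑ i, ∑ j, (c i * ee (k * (a * x i))) *
        conj (c j * ee (k * (a * x j))) * f (x i - x j) := by
    have h1 : ∀ i j, c i * conj (c j) * (mask n (a * (x i - x j)) * f (x i - x j)) =
        ∑ k ∈ Finset.range n, ((n : ℝ)⁻¹ : ℝ) * ((c i * ee (k * (a * x i))) *
          conj (c j * ee (k * (a * x j))) * f (x i - x j)) := by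
      intro i j
      rw [mask, Finset.mul_sum, Finset.sum_mul, Finset.mul_sum]
      refine Finset.sum_congr rfl fun k _ => ?_
      have : ee (k * (a * (x i - x j))) = ee (k * (a * x i)) * conj (ee (k * (a * x j))) := by
        rw [← ee_sub]; congr 1; ring
      rw [this, map_mul]; push_cast; ring
    simp only [h1]
    rw [Finset.sum_congr rfl fun i _ => Finset.sum_comm, Finset.sum_comm]
    simp only [Finset.mul_sum]
  rw [h, Complex.re_ofReal_mul, Complex.re_sum]
  exact mul_nonneg (by positivity) (Finset.sum_nonneg fun k _ => hf ι x _)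

lemma PosDefFn.of_tendsto {F : ℕ → ℝ → ℂ} {f : ℝ → ℂ} (hF : ∀ n, PosDefFn (F n))
    (h : ∀ x, Tendsto (fun n => F n x) atTop (𝓝 (f x))) : PosDefFn f := by
  intro ι _ x c
  have : Tendsto (fun n => (∑ i, ∑ j, c i * conj (c j) * F n (x i - x j)).re) atTop
      (𝓝 (∑ i, ∑ j, c i * conj (c j) * f (x i - x j)).re) :=
    (Complex.continuous_re.tendsto _).comp
      (tendsto_finsetSum _ fun i _ => tendsto_finsetSum _ fun j _ => (h _).const_mul _)
  exact ge_of_tendsto' this fun n => hF n ι x c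

/-- Continuous positive definite functions, normalised at `0`, with countably many zeros. -/
structure PDFun (f : ℝ → ℂ) : Prop where
  cont : Continuous f
  map_zero : f 0 = 1
  map_neg : ∀ x, f (-x) = conj (f x)
  pos : PosDefFn f
  zeros : {x | f x = 0}.Countable

lemma PDFun.one : PDFun fun _ => 1 where
  cont := continuous_const
  map_zero := rfl
  map_neg := by simp
  pos := by
    intro ι _ x c
    simp only [mul_one, ← Finset.mul_sum, ← Finset.sum_mul, ← map_sum, Complex.mul_conj']
    rw [← Complex.ofReal_pow, Complex.ofReal_re]
    exact sq_nonneg _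
  zeros := by simp

lemma PDFun.bessel {f : ℝ → ℂ} (hf : PDFun f) (R : Finset ℝ)
    (horth : ∀ x ∈ R, ∀ y ∈ R, x ≠ y → f (x - y) = 0) (ξ : ℝ) :
    ∑ x ∈ R, ‖f (ξ - x)‖ ^ 2 ≤ 1 := by
  -- Test at `ξ` with weight 1 and at each `x ∈ R` with weight `-f (ξ - x)`. Orthogonality leaves
  -- only the diagonal, and the form collapses to `1 - ∑ ‖f (ξ - x)‖²`.
  have h := hf.pos (Option R) (fun o => o.elim ξ fun x => x)
    (fun o => o.elim 1 fun x => - f (ξ - x))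
  simp only [Fintype.sum_option, Option.elim_none, Option.elim_some] at h
  have h1 : ∀ x : R, ∑ y : R, -f (ξ - x) * conj (-f (ξ - y)) * f (x - y) =
      ((‖f (ξ - x)‖ ^ 2 : ℝ) : ℂ) := by
    intro x
    rw [Finset.sum_eq_single x]
    · rw [sub_self, hf.map_zero, mul_one, _root_.map_neg, neg_mul_neg, Complex.mul_conj']
      push_cast; rfl
    · intro y _ hy
      rw [horth x x.2 y y.2 (fun h => hy (Subtype.ext h.symm)), mul_zero]
    · simp
  have h2 : ∀ x : R, (1 : ℂ) * conj (-f (ξ - x)) * f (ξ - x) = -((‖f (ξ - x)‖ ^ 2 : ℝ) : ℂ) := by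
    intro x
    rw [_root_.map_neg, one_mul, neg_mul, Complex.conj_mul']; push_cast; rfl
  have h3 : ∀ x : R, -f (ξ - x) * 1 * f (x - ξ) = -((‖f (ξ - x)‖ ^ 2 : ℝ) : ℂ) := by
    intro x
    rw [← neg_sub ξ (x : ℝ), hf.map_neg, mul_one, neg_mul, Complex.mul_conj']
    push_cast; rfl
  simp only [h1, h2, map_one, h3, Finset.sum_add_distrib, sub_self, hf.map_zero,
    Finset.sum_neg_distrib] at h
  rw [mul_one, mul_one] at h
  have h4 : ∑ x ∈ R, ‖f (ξ - x)‖ ^ 2 = ∑ x : R, ‖f (ξ - x)‖ ^ 2 :=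
    (Finset.sum_coe_sort R fun x => ‖f (ξ - x)‖ ^ 2).symm
  rw [h4]
  simp only [← Complex.ofReal_sum, Complex.add_re, Complex.neg_re, Complex.ofReal_re,
    Complex.one_re] at h
  linarith

lemma PDFun.norm_le_one {f : ℝ → ℂ} (hf : PDFun f) (x : ℝ) : ‖f x‖ ≤ 1 := by
  have := hf.bessel {0} (by simp) x
  rw [Finset.sum_singleton, sub_zero] at this
  nlinarith [norm_nonneg (f x)]

lemma PDFun.mul_mask {f : ℝ → ℂ} (hf : PDFun f) {n : ℕ} (hn : 1 ≤ n) {a : ℝ} (ha : a ≠ 0) :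
    PDFun fun x => mask n (a * x) * f x where
  cont := ((continuous_mask n).comp (by fun_prop)).mul hf.cont
  map_zero := by rw [mul_zero, mask_zero_right hn, hf.map_zero, one_mul]
  map_neg x := by rw [mul_neg, mask_neg, hf.map_neg, map_mul]
  pos := hf.pos.mask_mul n a
  zeros := ((countable_mask_zeros hn ha).union hf.zeros).mono fun x hx => by
    rcases mul_eq_zero.1 hx with h | h
    · exact Or.inl h
    · exact Or.inr h

lemma pdFun_mask {n : ℕ} (hn : 1 ≤ n) {a : ℝ} (ha : a ≠ 0) : PDFun fun x => mask n (a * x) := by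
  simpa using PDFun.one.mul_mask hn ha

/-! ### Infinite products of masks -/

lemma norm_prod_sub_prod_le {ι : Type*} (s : Finset ι) (f g : ι → ℂ)
    (hf : ∀ i ∈ s, ‖f i‖ ≤ 1) (hg : ∀ i ∈ s, ‖g i‖ ≤ 1) :
    ‖∏ i ∈ s, f i - ∏ i ∈ s, g i‖ ≤ ∑ i ∈ s, ‖f i - g i‖ := by
  classical
  induction s using Finset.induction_on with
  | empty => simp
  | insert a s ha ih =>
    rw [Finset.prod_insert ha, Finset.prod_insert ha, Finset.sum_insert ha]
    have h1 := ih (fun i hi => hf i (Finset.mem_insert_of_mem hi))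
      (fun i hi => hg i (Finset.mem_insert_of_mem hi))
    have h2 : ‖∏ i ∈ s, f i‖ ≤ 1 := by
      rw [norm_prod]
      exact Finset.prod_le_one (fun _ _ => norm_nonneg _)
        (fun i hi => hf i (Finset.mem_insert_of_mem hi))
    have h3 := hg a (Finset.mem_insert_self a s)
    have h4 : f a * ∏ i ∈ s, f i - g a * ∏ i ∈ s, g i =
        (f a - g a) * ∏ i ∈ s, f i + g a * (∏ i ∈ s, f i - ∏ i ∈ s, g i) := by ring
    rw [h4]
    refine (norm_add_le _ _).trans (add_le_add ?_ ?_)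
    · rw [norm_mul]; exact mul_le_of_le_one_right (norm_nonneg _) h2
    · rw [norm_mul]; exact (mul_le_of_le_one_left (norm_nonneg _) h3).trans h1

/-- The infinite product `∏_{k ≥ 1} mask n_k (ρ^k ξ)`. -/
noncomputable def ip (n : ℕ → ℕ) (ρ ξ : ℝ) : ℂ := ∏' k, mask (n k) (ρ ^ (k + 1) * ξ)

/-- `1 ≤ n k ≤ B` for all `k`. -/
def SizeSeq (n : ℕ → ℕ) (B : ℕ) : Prop := ∀ k, 1 ≤ n k ∧ n k ≤ B

lemma SizeSeq.const {n : ℕ} (hn : 1 ≤ n) : SizeSeq (fun _ => n) n := fun _ => ⟨hn, le_rfl⟩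

section
variable {n : ℕ → ℕ} {B : ℕ} {ρ : ℝ}

lemma summable_pow_succ_mul (h0 : 0 < ρ) (h1 : ρ < 1) (C : ℝ) :
    Summable fun k : ℕ => C * ρ ^ (k + 1) :=
  ((summable_nat_add_iff 1).2 (summable_geometric_of_lt_one h0.le h1)).mul_left C

lemma summable_norm_mask_sub_one (h0 : 0 < ρ) (h1 : ρ < 1) (hn : SizeSeq n B) (ξ : ℝ) :
    Summable fun k => ‖mask (n k) (ρ ^ (k + 1) * ξ) - 1‖ := by
  refine Summable.of_nonneg_of_le (fun _ => norm_nonneg _) (fun k => ?_)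
    (summable_pow_succ_mul h0 h1 (2 * Real.pi * B * |ξ|))
  rw [← mask_zero_right (hn k).1]
  refine (norm_mask_sub_le (hn k).2 _ _).trans_eq ?_
  rw [sub_zero, abs_mul, abs_of_pos (pow_pos h0 _)]; ring

lemma multipliable_ip (h0 : 0 < ρ) (h1 : ρ < 1) (hn : SizeSeq n B) (ξ : ℝ) :
    Multipliable fun k => mask (n k) (ρ ^ (k + 1) * ξ) := by
  have := multipliable_one_add_of_summable (summable_norm_mask_sub_one h0 h1 hn ξ)
  simpa using this

lemma tendsto_ip (h0 : 0 < ρ) (h1 : ρ < 1) (hn : SizeSeq n B) (ξ : ℝ) :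
    Tendsto (fun K => ∏ k ∈ Finset.range K, mask (n k) (ρ ^ (k + 1) * ξ)) atTop
      (𝓝 (ip n ρ ξ)) :=
  (multipliable_ip h0 h1 hn ξ).hasProd.tendsto_prod_nat

lemma ip_eq_zero_iff (h0 : 0 < ρ) (h1 : ρ < 1) (hn : SizeSeq n B) (ξ : ℝ) :
    ip n ρ ξ = 0 ↔ ∃ k, mask (n k) (ρ ^ (k + 1) * ξ) = 0 := by
  constructor
  · intro h
    by_contra! hne
    refine tprod_one_add_ne_zero_of_summable (f := fun k => mask (n k) (ρ ^ (k + 1) * ξ) - 1)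
      (by simpa using hne) (summable_norm_mask_sub_one h0 h1 hn ξ) ?_
    simpa [ip] using h
  · exact tprod_of_exists_eq_zero

lemma norm_ip_sub_le (h0 : 0 < ρ) (h1 : ρ < 1) (hn : SizeSeq n B) (ξ ξ' : ℝ) :
    ‖ip n ρ ξ - ip n ρ ξ'‖ ≤ (∑' k : ℕ, 2 * Real.pi * B * ρ ^ (k + 1)) * |ξ - ξ'| := by
  refine le_of_tendsto' ((tendsto_ip h0 h1 hn ξ).sub (tendsto_ip h0 h1 hn ξ')).norm fun K => ?_
  refine (norm_prod_sub_prod_le _ _ _ (fun _ _ => norm_mask_le_one _ _)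
    (fun _ _ => norm_mask_le_one _ _)).trans ?_
  have hs := summable_pow_succ_mul h0 h1 (2 * Real.pi * B)
  refine le_trans ?_ (mul_le_mul_of_nonneg_right
    (hs.sum_le_tsum (Finset.range K) fun k _ => by positivity) (abs_nonneg _))
  rw [Finset.sum_mul]
  refine Finset.sum_le_sum fun k _ => (norm_mask_sub_le (hn k).2 _ _).trans_eq ?_
  rw [← mul_sub, abs_mul, abs_of_pos (pow_pos h0 _)]; ring

lemma continuous_ip (h0 : 0 < ρ) (h1 : ρ < 1) (hn : SizeSeq n B) : Continuous (ip n ρ) := by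
  refine continuous_iff_continuousAt.2 fun x => tendsto_iff_norm_sub_tendsto_zero.2 ?_
  refine squeeze_zero (fun _ => norm_nonneg _) (fun y => norm_ip_sub_le h0 h1 hn y x) ?_
  have : Continuous fun y => (∑' k : ℕ, 2 * Real.pi * B * ρ ^ (k + 1)) * |y - x| := by fun_prop
  simpa using this.tendsto x

lemma PDFun.mul_ip (h0 : 0 < ρ) (h1 : ρ < 1) (hn : SizeSeq n B) {f : ℝ → ℂ} (hf : PDFun f)
    {a : ℝ} (ha : a ≠ 0) : PDFun fun x => ip n ρ (a * x) * f x where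
  cont := ((continuous_ip h0 h1 hn).comp (by fun_prop)).mul hf.cont
  map_zero := by
    simp only [ip, mul_zero, mask_zero_right (hn _).1, tprod_one, hf.map_zero, one_mul]
  map_neg x := by
    have h := tendsto_ip h0 h1 hn (a * -x)
    have h' := (Complex.continuous_conj.tendsto _).comp (tendsto_ip h0 h1 hn (a * x))
    have : ip n ρ (a * -x) = conj (ip n ρ (a * x)) := by
      refine tendsto_nhds_unique h (h'.congr fun K => ?_)
      simp only [Function.comp, map_prod, ← mask_neg, mul_neg]
    rw [this, hf.map_neg, map_mul]
  pos := by
    refine PosDefFn.of_tendsto (F := fun K x =>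
      (∏ k ∈ Finset.range K, mask (n k) (ρ ^ (k + 1) * (a * x))) * f x) (fun K => ?_)
      (fun x => (tendsto_ip h0 h1 hn (a * x)).mul_const _)
    induction K with
    | zero => simpa using hf.pos
    | succ K ih =>
      have := ih.mask_mul (n K) (ρ ^ (K + 1) * a)
      convert this using 2 with x
      rw [Finset.prod_range_succ]; ring_nf
  zeros := by
    have h : (⋃ k, {x : ℝ | mask (n k) ((ρ ^ (k + 1) * a) * x) = 0}).Countable :=
      Set.countable_iUnion fun k =>
        countable_mask_zeros (hn k).1 (mul_ne_zero (pow_pos h0 _).ne' ha)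
    refine (h.union hf.zeros).mono fun x hx => ?_
    rcases mul_eq_zero.1 hx with h | h
    · obtain ⟨k, hk⟩ := (ip_eq_zero_iff h0 h1 hn _).1 h
      exact Or.inl (Set.mem_iUnion.2 ⟨k, by rw [← mul_assoc] at hk; exact hk⟩)
    · exact Or.inr h

lemma ip_eq_mask_mul (h0 : 0 < ρ) (h1 : ρ < 1) (hn : SizeSeq n B) (ξ : ℝ) :
    ip n ρ ξ = mask (n 0) (ρ * ξ) * ip (fun k => n (k + 1)) ρ (ρ * ξ) := by
  have h : (fun k : ℕ => mask (n (k + 1)) (ρ ^ (k + 1 + 1) * ξ)) =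
      fun k : ℕ => mask (n (k + 1)) (ρ ^ (k + 1) * (ρ * ξ)) := by
    funext k
    rw [pow_succ ρ (k + 1), mul_assoc]
  have hm := multipliable_ip h0 h1 (n := fun k => n (k + 1)) (fun k => hn (k + 1)) (ρ * ξ)
  rw [ip, tprod_eq_zero_mul' (by rw [h]; exact hm), h, zero_add, pow_one, ip]

-- A level of size 1 is trivial, so sorting the levels by `J` yields two products of the same shape;
-- sizes depending on `k` serve this purpose.
open Classical in
lemma ip_eq_mul_ip (h0 : 0 < ρ) (h1 : ρ < 1) (hn : SizeSeq n B) (J : ℕ → Prop) (ξ : ℝ) :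
    ip n ρ ξ = ip (fun k => if J k then n k else 1) ρ ξ *
      ip (fun k => if J k then 1 else n k) ρ ξ := by
  have hB : 1 ≤ B := (hn 0).1.trans (hn 0).2
  rw [ip, ip, ip, ← Multipliable.tprod_mul]
  · refine tprod_congr fun k => ?_
    split_ifs <;> simp [mask_one]
  · exact multipliable_ip h0 h1 (B := B) (fun k => by split_ifs; exacts [hn k, ⟨le_rfl, hB⟩]) ξ
  · exact multipliable_ip h0 h1 (B := B) (fun k => by split_ifs; exacts [⟨le_rfl, hB⟩, hn k]) ξ

lemma norm_ip_le_one (h0 : 0 < ρ) (h1 : ρ < 1) (hn : SizeSeq n B) (ξ : ℝ) : ‖ip n ρ ξ‖ ≤ 1 := by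
  refine le_of_tendsto' (tendsto_ip h0 h1 hn ξ).norm fun K => ?_
  rw [norm_prod]
  exact Finset.prod_le_one (fun _ _ => norm_nonneg _) fun _ _ => norm_mask_le_one _ _

lemma norm_ip_le_norm_mask (h0 : 0 < ρ) (h1 : ρ < 1) (hn : SizeSeq n B) (ξ : ℝ) (j : ℕ) :
    ‖ip n ρ ξ‖ ≤ ‖mask (n j) (ρ ^ (j + 1) * ξ)‖ := by
  refine le_of_tendsto (tendsto_ip h0 h1 hn ξ).norm ?_
  filter_upwards [eventually_gt_atTop j] with K hK
  rw [← Finset.mul_prod_erase _ _ (Finset.mem_range.2 hK), norm_mul, norm_prod]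
  exact mul_le_of_le_one_right (norm_nonneg _)
    (Finset.prod_le_one (fun _ _ => norm_nonneg _) fun _ _ => norm_mask_le_one _ _)

end

/-! ### Spectra of positive definite functions -/

/-- `‖f x‖²` as an extended nonnegative real. -/
noncomputable def esq (f : ℝ → ℂ) (x : ℝ) : ENNReal := ENNReal.ofReal (‖f x‖ ^ 2)

lemma esq_mul (f g : ℝ → ℂ) (x : ℝ) : esq (fun y => f y * g y) x = esq f x * esq g x := by
  rw [esq, esq, esq, norm_mul, mul_pow, ENNReal.ofReal_mul (by positivity)]

lemma esq_ne_top (f : ℝ → ℂ) (x : ℝ) : esq f x ≠ ⊤ := ENNReal.ofReal_ne_top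

lemma esq_ne_zero {f : ℝ → ℂ} {x : ℝ} (h : f x ≠ 0) : esq f x ≠ 0 := by
  have := norm_pos_iff.2 h
  rw [esq, Ne, ENNReal.ofReal_eq_zero, not_le]; positivity

lemma norm_eq_of_esq_eq {f : ℝ → ℂ} {x y : ℝ} (h : esq f x = esq f y) : ‖f x‖ = ‖f y‖ := by
  rw [esq, esq, ENNReal.ofReal_eq_ofReal_iff (by positivity) (by positivity)] at h
  exact (pow_left_inj₀ (norm_nonneg _) (norm_nonneg _) two_ne_zero).1 h

/-- The exponentials with frequencies in `Λ` are orthogonal with respect to the positive definite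
function `f`, and Parseval's identity holds for all exponentials but countably many. -/
structure IsSpec (Λ : Set ℝ) (f : ℝ → ℂ) : Prop where
  countable : Λ.Countable
  orth : ∀ x ∈ Λ, ∀ y ∈ Λ, x ≠ y → f (x - y) = 0
  complete : ∃ S : Set ℝ, S.Countable ∧ ∀ ξ ∉ S, ∑' x : Λ, esq f (ξ - x) = 1

lemma PDFun.tsum_esq_le_one {f : ℝ → ℂ} (hf : PDFun f) {ι : Type*} (x : ι → ℝ)
    (h : ∀ i j, i ≠ j → f (x i - x j) = 0) (ξ : ℝ) : ∑' i, esq f (ξ - x i) ≤ 1 := by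
  classical
  have hinj : Function.Injective x := by
    intro i j hij
    by_contra hne
    have := h i j hne
    rw [hij, sub_self, hf.map_zero] at this
    exact one_ne_zero this
  rw [ENNReal.tsum_eq_iSup_sum]
  refine iSup_le fun s => ?_
  have hb := hf.bessel (s.image x) (by
    simp only [Finset.mem_image, forall_exists_index, and_imp]
    rintro _ i - rfl _ j - rfl hne
    exact h i j fun hij => hne (by rw [hij])) ξ
  rw [Finset.sum_image hinj.injOn] at hb
  simp only [esq]
  rw [← ENNReal.ofReal_sum_of_nonneg fun _ _ => by positivity]
  exact ENNReal.ofReal_le_one.2 hb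

lemma IsSpec.nonempty {Λ : Set ℝ} {f : ℝ → ℂ} (h : IsSpec Λ f) : Λ.Nonempty := by
  obtain ⟨S, hS, hc⟩ := h.complete
  obtain ⟨ξ, hξ⟩ := (hS.dense_compl ℝ).nonempty
  by_contra hne
  rw [Set.not_nonempty_iff_eq_empty] at hne
  subst hne
  simpa using hc ξ hξ

/-! ### The peeling principle -/

section fibres

variable {X Q : Type*} {π : X → Q} {w g : X → ENNReal}

/-- Fibrewise comparison behind the peeling theorem: if every fibre has total `w`-mass at most
one and every section has total `g`-mass at most one, then `∑ w g = 1` forces equality. -/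
lemma fibre_rigidity (hπ : Function.Surjective π)
    (hw0 : ∀ x, w x ≠ 0) (hwt : ∀ x, w x ≠ ⊤) (hg0 : ∀ x, g x ≠ 0)
    (hsum : ∑' x, w x * g x = 1)
    (hW : ∀ q, ∑' x : {x // π x = q}, w x ≤ 1)
    (hG : ∀ σ : Q → X, (∀ q, π (σ q) = q) → ∑' q, g (σ q) ≤ 1) :
    (∀ q, ∑' x : {x // π x = q}, w x = 1) ∧ (∀ x y, π x = π y → g x = g y) ∧
      ∀ σ : Q → X, (∀ q, π (σ q) = q) → ∑' q, g (σ q) = 1 := by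
  classical
  let A : Q → ENNReal := fun q => ∑' x : {x // π x = q}, w x * g x
  have hA : ∑' q, A q = 1 := by
    rw [← hsum, ← (Equiv.sigmaFiberEquiv π).tsum_eq, ENNReal.tsum_sigma']
    rfl
  have hAt : ∀ q, A q ≠ ⊤ := fun q =>
    ne_top_of_le_ne_top ENNReal.one_ne_top ((ENNReal.le_tsum q).trans_eq hA)
  -- The weights `w` on a fibre have total at most 1, so `A q` cannot exceed every value of `g` on
  -- the fibre.
  have hex : ∀ q, ∃ x, π x = q ∧ A q ≤ g x := by
    intro q
    by_contra! hlt
    obtain ⟨x0, hx0⟩ := hπ q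
    have : A q < ∑' x : {x // π x = q}, w x * A q := by
      refine ENNReal.tsum_lt_tsum (hAt q) (fun x => mul_le_mul_right (hlt x x.2).le _)
        (i := ⟨x0, hx0⟩) ?_
      exact (ENNReal.mul_lt_mul_iff_right (hw0 _) (hwt _)).2 (hlt x0 hx0)
    rw [ENNReal.tsum_mul_right] at this
    exact absurd (this.trans_le (mul_le_of_le_one_left (zero_le) (hW q))) (lt_irrefl _)
  choose σ hσ hσA using hex
  have hle : ∀ x, g x ≤ A (π x) := by
    intro x
    by_contra! hlt
    -- Exchanging a single value: if `g x` exceeded `A (π x)`, the section through `x` would have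
    -- `g`-mass larger than the sum of the `A q`, which is 1.
    let σ' : Q → X := fun q => if q = π x then x else σ q
    have h1 : ∑' q, A q < ∑' q, g (σ' q) := by
      refine ENNReal.tsum_lt_tsum (by rw [hA]; exact ENNReal.one_ne_top) (fun q => ?_)
        (i := π x) (by simpa [σ'] using hlt)
      by_cases hq : q = π x
      · simpa [σ', hq] using hlt.le
      · simpa [σ', hq] using hσA q
    rw [hA] at h1
    refine absurd (hG σ' fun q => ?_) (not_le.2 h1)
    by_cases hq : q = π x
    · simp [σ', hq]
    · simp [σ', hq, hσ]
  -- With `g ≤ A` on each fibre, `A q ≤ W q * A q`; since `0 < A q < ∞`, the fibre mass `W q` must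
  -- be 1.
  have hWA : ∀ q, A q ≤ (∑' x : {x // π x = q}, w x) * A q := by
    intro q
    rw [← ENNReal.tsum_mul_right]
    refine ENNReal.tsum_le_tsum fun x => mul_le_mul_right ?_ _
    have := hle x
    rwa [x.2] at this
  have hA0 : ∀ q, A q ≠ 0 := by
    intro q h
    obtain ⟨x0, hx0⟩ := hπ q
    have := ENNReal.tsum_eq_zero.1 h ⟨x0, hx0⟩
    exact (mul_ne_zero (hw0 x0) (hg0 x0)) this
  have hW1 : ∀ q, ∑' x : {x // π x = q}, w x = 1 := by
    intro q
    refine le_antisymm (hW q) ?_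
    have := hWA q
    nth_rw 1 [← one_mul (A q)] at this
    exact (ENNReal.mul_le_mul_iff_left (hA0 q) (hAt q)).1 this
  have hgA : ∀ x, g x = A (π x) := by
    intro x
    refine le_antisymm (hle x) ?_
    by_contra! hlt
    have : A (π x) < ∑' y : {y // π y = π x}, w y * A (π x) := by
      refine ENNReal.tsum_lt_tsum (hAt _) (fun y => mul_le_mul_right ?_ _) (i := ⟨x, rfl⟩) ?_
      · have := hle y
        rwa [y.2] at this
      · exact (ENNReal.mul_lt_mul_iff_right (hw0 _) (hwt _)).2 hlt
    rw [ENNReal.tsum_mul_right, hW1, one_mul] at this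
    exact lt_irrefl _ this
  refine ⟨hW1, fun x y hxy => by rw [hgA, hgA, hxy], fun σ hσ => ?_⟩
  rw [← hA]
  exact tsum_congr fun q => by rw [hgA, hσ]

end fibres

section peeling

variable {Λ : Set ℝ} {η ν : ℝ → ℂ} {H : AddSubgroup ℝ}

/-- Apply `fibre_rigidity` to the classes modulo `H` with weights `‖η (ξ - x)‖²` and `‖ν (ξ - x)‖²`.
Bessel for `η` bounds each class and Bessel for `ν` bounds each system of representatives. -/
lemma IsSpec.rigidity (hη : PDFun η) (hν : PDFun ν) (hs : IsSpec Λ fun x => η x * ν x)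
    (h1 : ∀ x ∈ Λ, ∀ y ∈ Λ, x ≠ y → x - y ∈ H → η (x - y) = 0)
    (h2 : ∀ x ∈ Λ, ∀ y ∈ Λ, x - y ∉ H → ν (x - y) = 0) :
    ∃ S : Set ℝ, S.Countable ∧ ∀ ξ ∉ S,
      (∀ x0 ∈ Λ, ∑' x : {x ∈ Λ | x - x0 ∈ H}, esq η (ξ - x) = 1) ∧
      (∀ x ∈ Λ, ∀ y ∈ Λ, x - y ∈ H → ‖ν (ξ - x)‖ = ‖ν (ξ - y)‖) ∧
      ∀ R ⊆ Λ, (∀ x ∈ R, ∀ y ∈ R, x - y ∈ H → x = y) → (∀ x ∈ Λ, ∃ y ∈ R, x - y ∈ H) →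
        ∑' x : R, esq ν (ξ - x) = 1 := by
  obtain ⟨S, hS, hc⟩ := hs.complete
  -- Besides `S`, exclude the points at which some weight vanishes; the exchange argument needs
  -- nonzero weights.
  refine ⟨S ∪ ⋃ x ∈ Λ, ((fun z => x + z) '' ({z | η z = 0} ∪ {z | ν z = 0})),
    hS.union (hs.countable.biUnion fun x _ => (hη.zeros.union hν.zeros).image _), ?_⟩
  intro ξ hξ
  rw [Set.mem_union, not_or] at hξ
  obtain ⟨hξS, hξ0⟩ := hξ
  have hne : ∀ x ∈ Λ, η (ξ - x) ≠ 0 ∧ ν (ξ - x) ≠ 0 := by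
    intro x hx
    constructor
    · intro h0
      exact hξ0 (Set.mem_biUnion hx ⟨ξ - x, Or.inl h0, by simp⟩)
    · intro h0
      exact hξ0 (Set.mem_biUnion hx ⟨ξ - x, Or.inr h0, by simp⟩)
  let π0 : Λ → ℝ ⧸ H := fun x => QuotientAddGroup.mk (x : ℝ)
  have hπ0 : ∀ x y : Λ, π0 x = π0 y ↔ (x : ℝ) - y ∈ H := by
    intro x y
    rw [eq_comm]
    simp only [π0, QuotientAddGroup.eq, neg_add_eq_sub]
  obtain ⟨r1, r2, r3⟩ := fibre_rigidity (X := Λ) (Q := Set.range π0)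
    (π := Set.rangeFactorization π0) (w := fun x => esq η (ξ - x)) (g := fun x => esq ν (ξ - x))
    Set.rangeFactorization_surjective (fun x => esq_ne_zero (hne x x.2).1)
    (fun x => esq_ne_top _ _) (fun x => esq_ne_zero (hne x x.2).2)
    (by simp only [← esq_mul]; exact hc ξ hξS)
    (fun q => hη.tsum_esq_le_one
      (fun x : {x : Λ // Set.rangeFactorization π0 x = q} => ((x : Λ) : ℝ)) (by
        intro x y hxy
        refine h1 _ x.1.2 _ y.1.2 (fun h => hxy (Subtype.ext (Subtype.ext h))) ?_
        rw [← hπ0]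
        exact congrArg Subtype.val (x.2.trans y.2.symm)) ξ)
    (fun σ hσ => hν.tsum_esq_le_one (fun q => ((σ q : Λ) : ℝ)) (by
        intro q q' hq
        refine h2 _ (σ q).2 _ (σ q').2 fun h => hq ?_
        rw [← hπ0] at h
        rw [← hσ q, ← hσ q']
        exact Subtype.ext h) ξ)
  refine ⟨fun x0 hx0 => ?_, fun x hx y hy hxy => ?_, fun R hR hinj hsurj => ?_⟩
  · rw [← r1 (Set.rangeFactorization π0 ⟨x0, hx0⟩)]
    let e : {x : Λ // Set.rangeFactorization π0 x = Set.rangeFactorization π0 ⟨x0, hx0⟩} ≃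
        {x ∈ Λ | x - x0 ∈ H} :=
      { toFun := fun x => ⟨x.1, x.1.2, (hπ0 _ _).1 (congrArg Subtype.val x.2)⟩
        invFun := fun x => ⟨⟨x.1, x.2.1⟩, Subtype.ext ((hπ0 _ ⟨x0, hx0⟩).2 x.2.2)⟩
        left_inv := fun _ => rfl
        right_inv := fun _ => rfl }
    rw [← e.tsum_eq]
    rfl
  · exact norm_eq_of_esq_eq (r2 ⟨x, hx⟩ ⟨y, hy⟩ (Subtype.ext ((hπ0 _ _).2 hxy)))
  · have hex : ∀ q : Set.range π0, ∃ y : R, π0 ⟨y, hR y.2⟩ = q := by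
      rintro ⟨_, x, rfl⟩
      obtain ⟨y, hy, hxy⟩ := hsurj x x.2
      exact ⟨⟨y, hy⟩, ((hπ0 x ⟨y, hR hy⟩).2 hxy).symm⟩
    choose σ hσ using hex
    rw [← r3 (fun q => ⟨σ q, hR (σ q).2⟩) (fun q => Subtype.ext (hσ q))]
    have hb : Function.Bijective σ := by
      constructor
      · intro q q' h
        apply Subtype.ext
        rw [← hσ q, ← hσ q', h]
      · intro y
        refine ⟨⟨π0 ⟨y, hR y.2⟩, Set.mem_range_self _⟩, ?_⟩
        apply Subtype.ext
        refine hinj _ (σ _).2 _ y.2 ?_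
        exact (hπ0 ⟨_, hR (σ _).2⟩ ⟨y, hR y.2⟩).1 (hσ _)
    exact ((Equiv.ofBijective σ hb).tsum_eq fun y : R => esq ν (ξ - y)).symm

/-- The points excluded in the rigidity statement are the reason why `IsSpec` tolerates a countable
exceptional set. -/
lemma IsSpec.of_class (hη : PDFun η) (hν : PDFun ν) (hs : IsSpec Λ fun x => η x * ν x)
    (h1 : ∀ x ∈ Λ, ∀ y ∈ Λ, x ≠ y → x - y ∈ H → η (x - y) = 0)
    (h2 : ∀ x ∈ Λ, ∀ y ∈ Λ, x - y ∉ H → ν (x - y) = 0) {x0 : ℝ} (hx0 : x0 ∈ Λ) :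
    IsSpec {x ∈ Λ | x - x0 ∈ H} η := by
  obtain ⟨S, hS, h⟩ := hs.rigidity hη hν h1 h2
  refine ⟨hs.countable.mono fun x hx => hx.1, fun x hx y hy hxy => ?_, S, hS,
    fun ξ hξ => (h ξ hξ).1 x0 hx0⟩
  refine h1 x hx.1 y hy.1 hxy ?_
  have := H.sub_mem hx.2 hy.2
  simpa using this

/-- By continuity the equality of norms along a class extends from generic `ξ` to all `ξ`; take `ξ =
x` and use `ν 0 = 1`. -/
lemma IsSpec.norm_eq_one_of_mem (hη : PDFun η) (hν : PDFun ν) (hs : IsSpec Λ fun x => η x * ν x)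
    (h1 : ∀ x ∈ Λ, ∀ y ∈ Λ, x ≠ y → x - y ∈ H → η (x - y) = 0)
    (h2 : ∀ x ∈ Λ, ∀ y ∈ Λ, x - y ∉ H → ν (x - y) = 0) {x y : ℝ} (hx : x ∈ Λ) (hy : y ∈ Λ)
    (hxy : x - y ∈ H) : ‖ν (x - y)‖ = 1 := by
  obtain ⟨S, hS, h⟩ := hs.rigidity hη hν h1 h2
  have key : (fun ξ => ‖ν (ξ - x)‖) = fun ξ => ‖ν (ξ - y)‖ :=
    Continuous.ext_on (hS.dense_compl ℝ) (hν.cont.comp (by fun_prop)).norm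
      (hν.cont.comp (by fun_prop)).norm fun ξ hξ => (h ξ hξ).2.1 x hx y hy hxy
  have := congrFun key x
  simp only [sub_self, hν.map_zero, norm_one] at this
  exact this.symm

/-- A spectrum of a product `η ν` is not orthogonal for `ν` unless `η` is unimodular. -/
lemma IsSpec.norm_eq_one_of_orth (hη : PDFun η) (hν : PDFun ν)
    (hs : IsSpec Λ fun x => η x * ν x)
    (h : ∀ x ∈ Λ, ∀ y ∈ Λ, x ≠ y → ν (x - y) = 0) (ξ : ℝ) : ‖η ξ‖ = 1 := by
  obtain ⟨x0, hx0⟩ := hs.nonempty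
  -- For the trivial subgroup every class is one point, and a one-point spectrum makes `η`
  -- unimodular.
  have hc := hs.of_class (H := ⊥) hη hν
    (fun x _ y _ hxy hz => absurd (sub_eq_zero.1 hz) hxy)
    (fun x hx y hy hz => h x hx y hy fun e => hz (by simp [e])) hx0
  have hset : {x ∈ Λ | x - x0 ∈ (⊥ : AddSubgroup ℝ)} = {x0} := by
    ext x
    simp only [AddSubgroup.mem_bot, Set.mem_singleton_iff, sub_eq_zero]
    exact ⟨fun h => h.2, fun h => ⟨h ▸ hx0, h⟩⟩
  rw [hset] at hc
  obtain ⟨S, hS, hcS⟩ := hc.complete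
  have key : (fun ξ => ‖η (ξ - x0)‖) = fun _ => 1 := by
    refine Continuous.ext_on (hS.dense_compl ℝ) (hη.cont.comp (by fun_prop)).norm
      continuous_const fun ξ hξ => ?_
    have h2 := hcS ξ hξ
    rw [tsum_singleton (f := fun x => esq η (ξ - x)) x0] at h2
    rw [← norm_one (α := ℂ), ← hη.map_zero]
    refine norm_eq_of_esq_eq ?_
    rw [h2, esq, hη.map_zero]; simp
  simpa using congrFun key (ξ + x0)

end peeling

/-! ### Two-factor products and divisibility of the base -/

lemma not_forall_norm_mask_eq_one {n : ℕ} (hn : 2 ≤ n) {a : ℝ} (ha : a ≠ 0) :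
    ¬ ∀ x, ‖mask n (a * x)‖ = 1 := by
  intro h
  obtain ⟨b, hb⟩ := exists_int_of_norm_mask_eq_one hn (h (1 / (2 * a)))
  rw [show a * (1 / (2 * a)) = 1 / 2 by field_simp] at hb
  have : (1 : ℝ) = 2 * b := by linarith
  have : (1 : ℤ) = 2 * b := by exact_mod_cast this
  omega

/-- The function `∏_{k ≥ 1} mask n₁ (ρ^k c₁ ξ) mask n₂ (ρ^k c₂ ξ)`. -/
noncomputable def twoIp (ρ : ℝ) (n₁ : ℕ) (c₁ : ℝ) (n₂ : ℕ) (c₂ : ℝ) (ξ : ℝ) : ℂ :=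
  ip (fun _ => n₁) ρ (c₁ * ξ) * ip (fun _ => n₂) ρ (c₂ * ξ)

lemma twoIp_comm (ρ : ℝ) (n₁ : ℕ) (c₁ : ℝ) (n₂ : ℕ) (c₂ : ℝ) :
    twoIp ρ n₁ c₁ n₂ c₂ = twoIp ρ n₂ c₂ n₁ c₁ := by
  funext ξ; rw [twoIp, twoIp, mul_comm]

lemma PDFun.ip {ρ : ℝ} (h0 : 0 < ρ) (h1 : ρ < 1) {n : ℕ → ℕ} {B : ℕ} (hn : SizeSeq n B) {c : ℝ}
    (hc : c ≠ 0) : PDFun fun x => ip n ρ (c * x) := by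
  simpa using PDFun.one.mul_ip h0 h1 hn hc

lemma pdFun_twoIp {ρ : ℝ} (h0 : 0 < ρ) (h1 : ρ < 1) {n₁ n₂ : ℕ} (hn₁ : 1 ≤ n₁) (hn₂ : 1 ≤ n₂)
    {c₁ c₂ : ℝ} (hc₁ : c₁ ≠ 0) (hc₂ : c₂ ≠ 0) : PDFun (twoIp ρ n₁ c₁ n₂ c₂) :=
  (PDFun.ip h0 h1 (SizeSeq.const hn₂) hc₂).mul_ip h0 h1 (SizeSeq.const hn₁) hc₁

/-- The reals `x` with `b x ∈ s g ℤ` for some integer `b` prime to `s`. -/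
def locSubgroup (s : ℕ) (hs : s.Prime) (g : ℝ) : AddSubgroup ℝ where
  carrier := {x | ∃ b a : ℤ, ¬ (s : ℤ) ∣ b ∧ b * x = s * g * a}
  zero_mem' := ⟨1, 0, fun h => hs.one_lt.ne' (by exact_mod_cast Int.eq_one_of_dvd_one (by simp) h),
    by simp⟩
  add_mem' := by
    rintro x y ⟨b, a, hb, h⟩ ⟨b', a', hb', h'⟩
    refine ⟨b * b', a * b' + a' * b, fun hd => ?_, ?_⟩
    · exact ((Nat.prime_iff_prime_int.1 hs).dvd_or_dvd hd).elim hb hb'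
    · push_cast; linear_combination (b' : ℝ) * h + b * h'
  neg_mem' := by
    rintro x ⟨b, a, hb, h⟩
    exact ⟨b, -a, hb, by push_cast; linear_combination -h⟩

section
variable {s : ℕ} {hs : s.Prime} {g : ℝ}

lemma locSubgroup_mul_int {x : ℝ} (hx : x ∈ locSubgroup s hs g) (a : ℤ) :
    x * a ∈ locSubgroup s hs g := by
  have := (locSubgroup s hs g).zsmul_mem hx a
  rwa [zsmul_eq_mul, mul_comm] at this

lemma mul_int_mem_locSubgroup {a : ℤ} (ha : (s : ℤ) ∣ a) : g * a ∈ locSubgroup s hs g := by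
  obtain ⟨b, rfl⟩ := ha
  refine ⟨1, b, fun h => hs.one_lt.ne' (by exact_mod_cast Int.eq_one_of_dvd_one (by simp) h), ?_⟩
  push_cast; ring

lemma dvd_of_mul_int_mem_locSubgroup (hg : g ≠ 0) {a : ℤ} (h : g * a ∈ locSubgroup s hs g) :
    (s : ℤ) ∣ a := by
  obtain ⟨b, a', hb, h⟩ := h
  have h1 : (b * a : ℝ) = s * a' := mul_left_cancel₀ hg (by linear_combination h)
  have h2 : b * a = s * a' := by exact_mod_cast h1
  exact ((Nat.prime_iff_prime_int.1 hs).dvd_or_dvd ⟨a', h2⟩).resolve_left hb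

end

section
variable {p : ℕ} {n n₁ n₂ : ℕ} {c c₁ c₂ : ℝ} {Λ : Set ℝ}

lemma inv_natCast_pos (hp : 2 ≤ p) : 0 < (p : ℝ)⁻¹ :=
  inv_pos.2 (by exact_mod_cast (by omega : 0 < p))

lemma inv_natCast_lt_one (hp : 2 ≤ p) : (p : ℝ)⁻¹ < 1 :=
  inv_lt_one_of_one_lt₀ (by exact_mod_cast (by omega : 1 < p))

lemma exists_of_mask_eq_zero (hn : 1 ≤ n) (hc : c ≠ 0) {x : ℝ} (h : mask n (c * x) = 0) :
    ∃ a : ℤ, ¬ (n : ℤ) ∣ a ∧ x = 1 / (c * n) * a := by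
  obtain ⟨a, ha, hx⟩ := (mask_eq_zero_iff hn).1 h
  have hn1 : (n : ℝ) ≠ 0 := by exact_mod_cast (by omega : n ≠ 0)
  exact ⟨a, ha, by rw [← hx]; field_simp⟩

lemma mask_eq_zero_of_eq (hn : 1 ≤ n) (hc : c ≠ 0) {a : ℤ} (ha : ¬ (n : ℤ) ∣ a) :
    mask n (c * (1 / (c * n) * a)) = 0 := by
  have hn1 : (n : ℝ) ≠ 0 := by exact_mod_cast (by omega : n ≠ 0)
  exact (mask_eq_zero_iff hn).2 ⟨a, ha, by field_simp⟩

/-- Because the base is an integer, the zeros of all levels are integer multiples of one lowest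
spacing `p / (c n)`. -/
lemma exists_of_ip_eq_zero (hp : 2 ≤ p) (hn : 1 ≤ n) (hc : c ≠ 0) {x : ℝ}
    (h : ip (fun _ => n) (p : ℝ)⁻¹ (c * x) = 0) :
    ∃ (k : ℕ) (a : ℤ), ¬ (n : ℤ) ∣ a ∧ x = p / (c * n) * ((p ^ k * a : ℤ) : ℝ) := by
  obtain ⟨k, hk⟩ := (ip_eq_zero_iff (inv_natCast_pos hp) (inv_natCast_lt_one hp)
    (SizeSeq.const hn) _).1 h
  obtain ⟨a, ha, hx⟩ := (mask_eq_zero_iff hn).1 hk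
  have hn1 : (n : ℝ) ≠ 0 := by exact_mod_cast (by omega : n ≠ 0)
  have hp1 : (p : ℝ) ≠ 0 := by exact_mod_cast (by omega : p ≠ 0)
  refine ⟨k, a, ha, ?_⟩
  push_cast
  rw [← hx, inv_pow, pow_succ]; field_simp

lemma ip_const_step (hp : 2 ≤ p) (hn : 1 ≤ n) (c x : ℝ) :
    ip (fun _ => n) (p : ℝ)⁻¹ (c * x) =
      mask n (c / p * x) * ip (fun _ => n) (p : ℝ)⁻¹ (c / p * x) := by
  rw [ip_eq_mask_mul (inv_natCast_pos hp) (inv_natCast_lt_one hp) (SizeSeq.const hn)]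
  have : (p : ℝ)⁻¹ * (c * x) = c / p * x := by ring
  rw [this]

/-- In a spectral two-factor product, the digit numbers divide the base. -/
lemma IsSpec.dvd_base (hp : 2 ≤ p) (hn₁ : 2 ≤ n₁) (hn₂ : 1 ≤ n₂) (hc₁ : 0 < c₁) (hc₂ : 0 < c₂)
    (h : IsSpec Λ (twoIp (p : ℝ)⁻¹ n₁ c₁ n₂ c₂)) : n₁ ∣ p := by
  have h0 := inv_natCast_pos hp
  have h1 := inv_natCast_lt_one hp
  have hp0 : (0 : ℝ) < p := by exact_mod_cast (by omega : 0 < p)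
  obtain ⟨g, n', p', hg, hcop, hn', hp'⟩ := Nat.exists_coprime' (m := n₁) (n := p)
    (Nat.gcd_pos_of_pos_left _ (by omega))
  by_contra hnd
  have hn'2 : 2 ≤ n' := by
    rcases Nat.lt_or_ge n' 2 with hlt | hge
    · interval_cases n'
      · simp at hn'; omega
      · exact absurd ⟨p', by rw [hp', hn']; ring⟩ hnd
    · exact hge
  have hg0 : (0 : ℝ) < g := by exact_mod_cast hg
  have hn'0 : (0 : ℝ) < n' := by exact_mod_cast (by omega : 0 < n')
  -- `η` is the part of the second level of the first factor whose size `n'` is prime to `p'`.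
  set η : ℝ → ℂ := fun x => mask n' (g * (c₁ / p / p) * x) with hη
  set ν : ℝ → ℂ := fun x => mask n₁ (c₁ / p * x) * (mask g (c₁ / p / p * x) *
    twoIp (p : ℝ)⁻¹ n₁ (c₁ / p / p) n₂ c₂ x) with hν
  have hηp : PDFun η := pdFun_mask (by omega) (by positivity)
  have hνp : PDFun ν := ((pdFun_twoIp h0 h1 (by omega) hn₂ (by positivity)
    hc₂.ne').mul_mask hg (by positivity)).mul_mask (by omega) (by positivity)
  have hfac : twoIp (p : ℝ)⁻¹ n₁ c₁ n₂ c₂ = fun x => η x * ν x := by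
    funext x
    simp only [hη, hν, twoIp]
    rw [ip_const_step hp (by omega) c₁, ip_const_step hp (by omega) (c₁ / p)]
    have : mask n₁ (c₁ / p / p * x) = mask g (c₁ / p / p * x) * mask n' (g * (c₁ / p / p) * x) := by
      rw [hn', mul_comm n' g, mask_mul, mul_assoc (g : ℝ)]
    rw [this]; ring
  -- A zero of `η` is `p * a` lowest spacings with `n' ∤ a`. As `n₁ = n' g`, `p = p' g` and `n'` is
  -- prime to `p'`, also `n₁ ∤ p * a`, so the first level vanishes there as well and `η` is
  -- superfluous.
  have hzero : ∀ z, η z = 0 → ν z = 0 := by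
    intro z hz
    obtain ⟨a, ha, rfl⟩ := exists_of_mask_eq_zero (by omega) (by positivity) hz
    have hd : ¬ (n₁ : ℤ) ∣ p * a := by
      rw [hn', hp']
      push_cast
      rintro ⟨b, hb⟩
      have hgz : (g : ℤ) ≠ 0 := by exact_mod_cast hg.ne'
      have h3 : (n' : ℤ) ∣ p' * a := ⟨b, mul_left_cancel₀ hgz (by linear_combination hb)⟩
      exact ha ((Nat.isCoprime_iff_coprime.2 hcop).dvd_of_dvd_mul_left h3)
    have h3 := mask_eq_zero_of_eq (n := n₁) (by omega) (c := c₁ / p) (by positivity) hd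
    have h4 : 1 / (g * (c₁ / p / p) * n') * (a : ℝ) =
        1 / (c₁ / p * n₁) * ((p * a : ℤ) : ℝ) := by
      rw [hn']; push_cast; field_simp
    simp only [hν]
    rw [h4, h3, zero_mul]
  rw [hfac] at h
  refine not_forall_norm_mask_eq_one hn'2 (a := g * (c₁ / p / p)) (by positivity)
    (h.norm_eq_one_of_orth hηp hνp fun x hx y hy hxy => ?_)
  rcases mul_eq_zero.1 (h.orth x hx y hy hxy) with hz | hz
  · exact hzero _ hz
  · exact hz

/-! ### Peeling off the first level of a factor -/

variable {s r : ℕ}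

/-- Removing the lowest layer of size `s` of the first factor: all differences lie in `g₁ ℤ`. -/
lemma IsSpec.sub_mem_bottom (hp : 2 ≤ p) (hn₁ : 1 ≤ n₁) (hn₂ : 1 ≤ n₂) (hc₁ : 0 < c₁)
    (hc₂ : 0 < c₂) (hs : s.Prime) (hsn : s ∣ n₁) (hsp : s ∣ p)
    (hg : (p : ℝ) / (c₂ * n₂) ∈ locSubgroup s hs (p / (c₁ * n₁)))
    (h : IsSpec Λ (twoIp (p : ℝ)⁻¹ n₁ c₁ n₂ c₂)) {x y : ℝ} (hx : x ∈ Λ) (hy : y ∈ Λ) :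
    ∃ a : ℤ, x - y = p / (c₁ * n₁) * a := by
  have h0 := inv_natCast_pos hp
  have h1 := inv_natCast_lt_one hp
  have hp0 : (0 : ℝ) < p := by exact_mod_cast (by omega : 0 < p)
  have hn0 : (0 : ℝ) < n₁ := by exact_mod_cast hn₁
  have hs0 : (0 : ℝ) < s := by exact_mod_cast hs.pos
  obtain ⟨n', rfl⟩ := hsn
  have hn' : 1 ≤ n' := Nat.pos_of_mul_pos_left hn₁
  have hn'0 : (0 : ℝ) < n' := by exact_mod_cast hn'
  set g : ℝ := p / (c₁ * (s * n' : ℕ)) with hgdef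
  have hg0 : 0 < g := by positivity
  set η : ℝ → ℂ := fun x => mask n' (c₁ / p * x) * twoIp (p : ℝ)⁻¹ (s * n') (c₁ / p) n₂ c₂ x
    with hη
  set ν : ℝ → ℂ := fun x => mask s (n' * (c₁ / p) * x) with hν
  have hηp : PDFun η := (pdFun_twoIp h0 h1 hn₁ hn₂ (by positivity) hc₂.ne').mul_mask hn'
    (by positivity)
  have hνp : PDFun ν := pdFun_mask hs.one_le (by positivity)
  have hfac : twoIp (p : ℝ)⁻¹ (s * n') c₁ n₂ c₂ = fun x => η x * ν x := by
    funext x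
    simp only [hη, hν, twoIp]
    rw [ip_const_step hp hn₁ c₁, mul_comm s n', mask_mul, ← mul_assoc (n' : ℝ)]
    ring
  have hνz : ∀ z, ν z = 0 → ∃ a : ℤ, ¬ (s : ℤ) ∣ a ∧ z = g * a := by
    intro z hz
    obtain ⟨a, ha, rfl⟩ := exists_of_mask_eq_zero hs.one_le (by positivity) hz
    exact ⟨a, ha, by rw [hgdef]; push_cast; field_simp⟩
  -- Every zero outside the lowest `s`-layer is `s`-adically a multiple of `s g`: through the layer
  -- itself, through `s ∣ p`, or through `hg`.
  have hηz : ∀ z, η z = 0 → z ∈ locSubgroup s hs g := by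
    intro z hz
    rcases mul_eq_zero.1 hz with hz | hz
    · obtain ⟨a, -, rfl⟩ := exists_of_mask_eq_zero hn' (by positivity) hz
      have := mul_int_mem_locSubgroup (s := s) (hs := hs) (g := g) (a := s * a) (dvd_mul_right _ _)
      convert this using 1
      rw [hgdef]; push_cast; field_simp
    · rcases mul_eq_zero.1 hz with hz | hz
      · obtain ⟨k, a, -, rfl⟩ := exists_of_ip_eq_zero hp hn₁ (by positivity) hz
        have := mul_int_mem_locSubgroup (s := s) (hs := hs) (g := g) (a := p * (p ^ k * a))
          (((Int.natCast_dvd_natCast.2 hsp)).mul_right _)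
        convert this using 1
        rw [hgdef]; push_cast; field_simp
      · obtain ⟨k, a, -, rfl⟩ := exists_of_ip_eq_zero hp hn₂ hc₂.ne' hz
        exact locSubgroup_mul_int hg _
  rw [hfac] at h
  have hA : ∀ x ∈ Λ, ∀ y ∈ Λ, x ≠ y → x - y ∈ locSubgroup s hs g → η (x - y) = 0 := by
    intro x hx y hy hxy hz
    refine (mul_eq_zero.1 (h.orth x hx y hy hxy)).resolve_right fun hz' => ?_
    obtain ⟨a, ha, hz'⟩ := hνz _ hz'
    rw [hz'] at hz
    exact ha (dvd_of_mul_int_mem_locSubgroup hg0.ne' hz)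
  have hB : ∀ x ∈ Λ, ∀ y ∈ Λ, x - y ∉ locSubgroup s hs g → ν (x - y) = 0 := by
    intro x hx y hy hz
    have hxy : x ≠ y := by
      rintro rfl
      exact hz (by simp [(locSubgroup s hs g).zero_mem])
    exact (mul_eq_zero.1 (h.orth x hx y hy hxy)).resolve_left fun hz' => hz (hηz _ hz')
  -- Inside the subgroup, rigidity makes the bottom layer unimodular, which puts `x - y` in `s g ℤ`;
  -- outside it, the difference is a zero of that layer and lies in `g ℤ`.
  by_cases hz : x - y ∈ locSubgroup s hs g
  · have := h.norm_eq_one_of_mem hηp hνp hA hB hx hy hz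
    obtain ⟨a, ha⟩ := exists_int_of_norm_mask_eq_one hs.two_le this
    refine ⟨s * a, ?_⟩
    push_cast
    rw [← ha, hgdef]; push_cast; field_simp
  · obtain ⟨a, -, ha⟩ := hνz _ (hB x hx y hy hz)
    exact ⟨a, ha⟩

/-- Removing the first level of the first factor. -/
lemma IsSpec.peel (hp : 2 ≤ p) (hn₁ : 1 ≤ n₁) (hn₂ : 1 ≤ n₂) (hc₁ : 0 < c₁)
    (hc₂ : 0 < c₂) (hs : s.Prime) (hsn : s ∣ n₁) (hsp : s ∣ p)
    (hg : (p : ℝ) / (c₂ * n₂) ∈ locSubgroup s hs (p / (c₁ * n₁)))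
    (h : IsSpec Λ (twoIp (p : ℝ)⁻¹ n₁ c₁ n₂ c₂)) {x₀ : ℝ} (hx₀ : x₀ ∈ Λ) :
    IsSpec {x ∈ Λ | x - x₀ ∈ AddSubgroup.zmultiples (p / c₁)}
      (twoIp (p : ℝ)⁻¹ n₁ (c₁ / p) n₂ c₂) := by
  have h0 := inv_natCast_pos hp
  have h1 := inv_natCast_lt_one hp
  have hp0 : (0 : ℝ) < p := by exact_mod_cast (by omega : 0 < p)
  have hn0 : (0 : ℝ) < n₁ := by exact_mod_cast hn₁
  have hbot := fun x (hx : x ∈ Λ) y (hy : y ∈ Λ) =>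
    h.sub_mem_bottom hp hn₁ hn₂ hc₁ hc₂ hs hsn hsp hg hx hy
  have hfac : twoIp (p : ℝ)⁻¹ n₁ c₁ n₂ c₂ =
      fun x => twoIp (p : ℝ)⁻¹ n₁ (c₁ / p) n₂ c₂ x * mask n₁ (c₁ / p * x) := by
    funext x
    simp only [twoIp]
    rw [ip_const_step hp hn₁ c₁]; ring
  rw [hfac] at h
  -- All differences are multiples of the lowest spacing, and `p / c₁` is `n₁` of these: the
  -- first-level mask is 1 on its multiples and vanishes at the other differences.
  refine h.of_class (pdFun_twoIp h0 h1 hn₁ hn₂ (by positivity) hc₂.ne')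
    (pdFun_mask hn₁ (by positivity)) (fun x hx y hy hxy hz => ?_) (fun x hx y hy hz => ?_) hx₀
  · refine (mul_eq_zero.1 (h.orth x hx y hy hxy)).resolve_right ?_
    obtain ⟨a, ha⟩ := AddSubgroup.mem_zmultiples_iff.1 hz
    rw [← ha, zsmul_eq_mul, show c₁ / p * ((a : ℝ) * (p / c₁)) = a by field_simp, mask_int hn₁]
    exact one_ne_zero
  · obtain ⟨a, ha⟩ := hbot x hx y hy
    have hd : ¬ (n₁ : ℤ) ∣ a := by
      rintro ⟨b, rfl⟩
      refine hz (AddSubgroup.mem_zmultiples_iff.2 ⟨b, ?_⟩)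
      rw [ha, zsmul_eq_mul]; push_cast; field_simp
    have := mask_eq_zero_of_eq (n := n₁) hn₁ (c := c₁ / p) (by positivity) hd
    rw [ha]
    convert this using 3
    field_simp

/-- A spectral two-factor product cannot lose the lowest layer of its second factor when the
first level of the first factor is removed. -/
lemma IsSpec.false_of_peel (hp : 2 ≤ p) (hn₁ : 1 ≤ n₁) (hn₂ : 1 ≤ n₂) (hc₁ : 0 < c₁)
    (hc₂ : 0 < c₂) (hs : s.Prime) (hsn : s ∣ n₁) (hsp : s ∣ p)
    (hg : (p : ℝ) / (c₂ * n₂) ∈ locSubgroup s hs (p / (c₁ * n₁)))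
    (hr : r.Prime) (hrn : r ∣ n₂)
    (hdisj : ∀ a b : ℤ, (p : ℝ) / c₁ * b = p / (c₂ * n₂) * a → (r : ℤ) ∣ a)
    (h : IsSpec Λ (twoIp (p : ℝ)⁻¹ n₁ c₁ n₂ c₂)) : False := by
  have h0 := inv_natCast_pos hp
  have h1 := inv_natCast_lt_one hp
  have hp0 : (0 : ℝ) < p := by exact_mod_cast (by omega : 0 < p)
  obtain ⟨x₀, hx₀⟩ := h.nonempty
  have h' := h.peel hp hn₁ hn₂ hc₁ hc₂ hs hsn hsp hg hx₀
  obtain ⟨n', rfl⟩ := hrn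
  have hn' : 1 ≤ n' := Nat.pos_of_mul_pos_left hn₂
  have hn'0 : (0 : ℝ) < n' := by exact_mod_cast hn'
  have hr0 : (0 : ℝ) < r := by exact_mod_cast hr.pos
  set η : ℝ → ℂ := fun x => mask r (n' * (c₂ / p) * x) with hη
  set ν : ℝ → ℂ := fun x => mask n' (c₂ / p * x) *
    twoIp (p : ℝ)⁻¹ n₁ (c₁ / p) (r * n') (c₂ / p) x with hν
  have hηp : PDFun η := pdFun_mask hr.one_le (by positivity)
  have hνp : PDFun ν := (pdFun_twoIp h0 h1 hn₁ hn₂ (by positivity) (by positivity)).mul_mask hn'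
    (by positivity)
  have hfac : twoIp (p : ℝ)⁻¹ n₁ (c₁ / p) (r * n') c₂ = fun x => η x * ν x := by
    funext x
    simp only [hη, hν, twoIp]
    rw [ip_const_step hp hn₂ c₂, mul_comm r n', mask_mul, ← mul_assoc (n' : ℝ)]
    ring
  rw [hfac] at h'
  -- After peeling, differences lie in `(p / c₁) ℤ`, and `hdisj` keeps this group away from the
  -- zeros of the lowest `r`-layer, which is therefore superfluous.
  refine not_forall_norm_mask_eq_one hr.two_le (a := n' * (c₂ / p)) (by positivity)
    (h'.norm_eq_one_of_orth hηp hνp fun x hx y hy hxy => ?_)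
  refine (mul_eq_zero.1 (h'.orth x hx y hy hxy)).resolve_left fun hz => ?_
  obtain ⟨a, ha, hz⟩ := exists_of_mask_eq_zero hr.one_le (by positivity) hz
  have hmem : x - y ∈ AddSubgroup.zmultiples ((p : ℝ) / c₁) := by
    have := AddSubgroup.sub_mem _ hx.2 hy.2
    simpa using this
  obtain ⟨b, hb⟩ := AddSubgroup.mem_zmultiples_iff.1 hmem
  rw [zsmul_eq_mul] at hb
  refine ha (hdisj a b ?_)
  rw [mul_comm, hb, hz]; push_cast; field_simp

end

/-! ### Two lowest layers of the same prime size cannot coincide -/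

lemma exists_class_representatives (Λ : Set ℝ) (H : AddSubgroup ℝ) :
    ∃ R ⊆ Λ, (∀ x ∈ R, ∀ y ∈ R, x - y ∈ H → x = y) ∧ ∀ x ∈ Λ, ∃ y ∈ R, x - y ∈ H := by
  let f : Λ → ℝ ⧸ H := fun x => QuotientAddGroup.mk (x : ℝ)
  have hf : ∀ x y : Λ, f x = f y ↔ (x : ℝ) - y ∈ H := by
    intro x y
    rw [eq_comm]
    simp only [f, QuotientAddGroup.eq, neg_add_eq_sub]
  refine ⟨Set.range fun q : Set.range f => ((q.2.choose : Λ) : ℝ), ?_, ?_, ?_⟩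
  · rintro _ ⟨q, rfl⟩
    exact q.2.choose.2
  · rintro _ ⟨q, rfl⟩ _ ⟨q', rfl⟩ h
    have h1 := (hf _ _).2 h
    rw [q.2.choose_spec, q'.2.choose_spec] at h1
    rw [Subtype.ext h1]
  · intro x hx
    refine ⟨_, ⟨⟨f ⟨x, hx⟩, Set.mem_range_self _⟩, rfl⟩, ?_⟩
    rw [← hf ⟨x, hx⟩]
    exact (Set.mem_range_self (f := f) ⟨x, hx⟩).choose_spec.symm

section
variable {p : ℕ} {n₁ n₂ : ℕ} {c₁ c₂ : ℝ} {Λ : Set ℝ} {r : ℕ}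

lemma sum_esq_mask_shift {n : ℕ} (hn : 1 ≤ n) {c : ℝ} (hc : c ≠ 0) (x : ℝ) :
    ∑ j ∈ Finset.range n, esq (fun y => mask n (c * y)) (x + 1 / (c * n) * j) = 1 := by
  have hn1 : (n : ℝ) ≠ 0 := by exact_mod_cast (by omega : n ≠ 0)
  simp only [esq]
  rw [← ENNReal.ofReal_sum_of_nonneg fun _ _ => by positivity, ← ENNReal.ofReal_one]
  congr 1
  refine (Finset.sum_congr rfl fun j _ => ?_).trans
    (sum_norm_mask_sq hn (u := -1) isCoprime_one_left.neg_left (c * x))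
  congr 3
  push_cast; field_simp; ring

lemma exists_dvd_sub_mul {r : ℕ} (hr : r.Prime) {u : ℤ} (hu : ¬ (r : ℤ) ∣ u) (v : ℤ) :
    ∃ j : ℕ, j < r ∧ (r : ℤ) ∣ v - u * j := by
  have hr0 : (r : ℤ) ≠ 0 := by exact_mod_cast hr.ne_zero
  have hc : IsCoprime (r : ℤ) u := (Nat.prime_iff_prime_int.1 hr).coprime_iff_not_dvd.2 hu
  obtain ⟨a, b, hab⟩ := hc
  refine ⟨((b * v) % r).toNat, ?_, ?_⟩
  · have := Int.emod_lt_of_pos (b * v) (by exact_mod_cast hr.pos : (0 : ℤ) < r)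
    have := Int.emod_nonneg (b * v) hr0
    omega
  · rw [Int.toNat_of_nonneg (Int.emod_nonneg _ hr0), Int.emod_def]
    exact ⟨a * v + u * (b * v / r), by linear_combination (-v) * hab⟩

/-- The lowest layers of the two factors cannot sit at the same place for a prime `r`. -/
lemma IsSpec.false_of_same_bottom (hp : 2 ≤ p) (hn₁ : 1 ≤ n₁) (hn₂ : 1 ≤ n₂) (hc₁ : 0 < c₁)
    (hc₂ : 0 < c₂) (hr : r.Prime) (hrn₁ : r ∣ n₁) (hrn₂ : r ∣ n₂) (hrp : r ∣ p)
    {u v : ℤ} (hu : ¬ (r : ℤ) ∣ u) (hv : ¬ (r : ℤ) ∣ v)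
    (huv : u * ((p : ℝ) / (c₂ * n₂)) = v * (p / (c₁ * n₁)))
    (h : IsSpec Λ (twoIp (p : ℝ)⁻¹ n₁ c₁ n₂ c₂)) : False := by
  have h0 := inv_natCast_pos hp
  have h1 := inv_natCast_lt_one hp
  have hp0 : (0 : ℝ) < p := by exact_mod_cast (by omega : 0 < p)
  have hr0 : (0 : ℝ) < r := by exact_mod_cast hr.pos
  have hrz := Nat.prime_iff_prime_int.1 hr
  obtain ⟨m₁, rfl⟩ := hrn₁
  obtain ⟨m₂, rfl⟩ := hrn₂
  have hm₁ : 1 ≤ m₁ := Nat.pos_of_mul_pos_left hn₁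
  have hm₂ : 1 ≤ m₂ := Nat.pos_of_mul_pos_left hn₂
  have hm₁0 : (0 : ℝ) < m₁ := by exact_mod_cast hm₁
  have hm₂0 : (0 : ℝ) < m₂ := by exact_mod_cast hm₂
  set g : ℝ := p / (c₁ * (r * m₁ : ℕ)) with hgdef
  set g' : ℝ := p / (c₂ * (r * m₂ : ℕ)) with hg'def
  have hg0 : 0 < g := by positivity
  have hg'0 : 0 < g' := by positivity
  set ν₁ : ℝ → ℂ := fun x => mask r (m₁ * (c₁ / p) * x) with hν₁
  set ν₂ : ℝ → ℂ := fun x => mask r (m₂ * (c₂ / p) * x) with hν₂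
  set ν : ℝ → ℂ := fun x => ν₁ x * ν₂ x with hν
  set η : ℝ → ℂ := fun x => mask m₁ (c₁ / p * x) * (mask m₂ (c₂ / p * x) *
    twoIp (p : ℝ)⁻¹ (r * m₁) (c₁ / p) (r * m₂) (c₂ / p) x) with hη
  have hηp : PDFun η := ((pdFun_twoIp h0 h1 hn₁ hn₂ (by positivity) (by positivity)).mul_mask hm₂
    (by positivity)).mul_mask hm₁ (by positivity)
  have hν₂p : PDFun ν₂ := pdFun_mask hr.one_le (by positivity)
  have hν₁p : PDFun ν₁ := pdFun_mask hr.one_le (by positivity)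
  have hνp : PDFun ν := hν₂p.mul_mask hr.one_le (by positivity)
  have hfac : twoIp (p : ℝ)⁻¹ (r * m₁) c₁ (r * m₂) c₂ = fun x => η x * ν x := by
    funext x
    simp only [hη, hν, hν₁, hν₂, twoIp]
    rw [ip_const_step hp hn₁ c₁, ip_const_step hp hn₂ c₂, mul_comm r m₁, mul_comm r m₂,
      mask_mul, mask_mul m₂, ← mul_assoc (m₁ : ℝ), ← mul_assoc (m₂ : ℝ)]
    ring
  -- The spacings `g` and `g'` differ by an `r`-adic unit, so one subgroup serves both bottom
  -- layers.
  set H := locSubgroup r hr g with hH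
  have hg'mem : ∀ a : ℤ, (r : ℤ) ∣ a → g' * a ∈ H := by
    rintro _ ⟨a, rfl⟩
    refine ⟨u, v * a, hu, ?_⟩
    push_cast
    linear_combination (r : ℝ) * a * huv
  have hν₁z : ∀ z, ν₁ z = 0 → ∃ a : ℤ, ¬ (r : ℤ) ∣ a ∧ z = g * a := by
    intro z hz
    obtain ⟨a, ha, rfl⟩ := exists_of_mask_eq_zero hr.one_le (by positivity) hz
    exact ⟨a, ha, by rw [hgdef]; push_cast; field_simp⟩
  have hν₂z : ∀ z, ν₂ z = 0 → ∃ a : ℤ, ¬ (r : ℤ) ∣ a ∧ z = g' * a := by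
    intro z hz
    obtain ⟨a, ha, rfl⟩ := exists_of_mask_eq_zero hr.one_le (by positivity) hz
    exact ⟨a, ha, by rw [hg'def]; push_cast; field_simp⟩
  have hrpz : (r : ℤ) ∣ p := Int.natCast_dvd_natCast.2 hrp
  have hηz : ∀ z, η z = 0 → z ∈ H := by
    intro z hz
    rcases mul_eq_zero.1 hz with hz | hz
    · obtain ⟨a, -, rfl⟩ := exists_of_mask_eq_zero hm₁ (by positivity) hz
      have := mul_int_mem_locSubgroup (s := r) (hs := hr) (g := g) (a := r * a) (dvd_mul_right _ _)
      convert this using 1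
      rw [hgdef]; push_cast; field_simp
    rcases mul_eq_zero.1 hz with hz | hz
    · obtain ⟨a, -, rfl⟩ := exists_of_mask_eq_zero hm₂ (by positivity) hz
      have := hg'mem (r * a) (dvd_mul_right _ _)
      convert this using 1
      rw [hg'def]; push_cast; field_simp
    rcases mul_eq_zero.1 hz with hz | hz
    · obtain ⟨k, a, -, rfl⟩ := exists_of_ip_eq_zero hp hn₁ (by positivity) hz
      have := mul_int_mem_locSubgroup (s := r) (hs := hr) (g := g) (a := p * (p ^ k * a))
        (hrpz.mul_right _)
      convert this using 1
      rw [hgdef]; push_cast; field_simp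
    · obtain ⟨k, a, -, rfl⟩ := exists_of_ip_eq_zero hp hn₂ (by positivity) hz
      have := hg'mem (p * (p ^ k * a)) (hrpz.mul_right _)
      convert this using 1
      rw [hg'def]; push_cast; field_simp
  rw [hfac] at h
  have hA : ∀ x ∈ Λ, ∀ y ∈ Λ, x ≠ y → x - y ∈ H → η (x - y) = 0 := by
    intro x hx y hy hxy hz
    refine (mul_eq_zero.1 (h.orth x hx y hy hxy)).resolve_right fun hz' => ?_
    rcases mul_eq_zero.1 hz' with hz' | hz'
    · obtain ⟨a, ha, hz'⟩ := hν₁z _ hz'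
      rw [hz'] at hz
      exact ha (dvd_of_mul_int_mem_locSubgroup hg0.ne' hz)
    · obtain ⟨a, ha, hz'⟩ := hν₂z _ hz'
      rw [hz'] at hz
      obtain ⟨b, a', hb, hz⟩ := hz
      have h2 : (b * a * v : ℝ) = r * (a' * u) :=
        mul_left_cancel₀ hg0.ne' (by linear_combination (u : ℝ) * hz - b * a * huv)
      have h3 : b * a * v = r * (a' * u) := by exact_mod_cast h2
      rcases hrz.dvd_or_dvd ⟨_, h3⟩ with h4 | h4
      · exact (hrz.dvd_or_dvd h4).elim hb ha
      · exact hv h4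
  have hB : ∀ x ∈ Λ, ∀ y ∈ Λ, x - y ∉ H → ν (x - y) = 0 := by
    intro x hx y hy hz
    have hxy : x ≠ y := by
      rintro rfl
      exact hz (by simp [H.zero_mem])
    exact (mul_eq_zero.1 (h.orth x hx y hy hxy)).resolve_left fun hz' => hz (hηz _ hz')
  obtain ⟨S, hS, hrig⟩ := h.rigidity hηp hνp hA hB
  obtain ⟨R, hRΛ, hRinj, hRsurj⟩ := exists_class_representatives Λ H
  obtain ⟨x₀, hx₀⟩ : R.Nonempty := by
    obtain ⟨x, hx⟩ := h.nonempty
    obtain ⟨y, hy, -⟩ := hRsurj x hx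
    exact ⟨y, hy⟩
  -- Modulo `H`, every class is a translate of that of `x₀` by `g * j` with `j < r`, so there are at
  -- most `r` classes.
  have hclass : ∀ x : R, ∃ j : ℕ, j < r ∧ (x : ℝ) - x₀ - g * j ∈ H := by
    intro x
    by_cases hz : (x : ℝ) - x₀ ∈ H
    · exact ⟨0, hr.pos, by simpa using hz⟩
    · rcases mul_eq_zero.1 (hB _ (hRΛ x.2) _ (hRΛ hx₀) hz) with hz' | hz'
      · obtain ⟨a, -, hz'⟩ := hν₁z _ hz'
        obtain ⟨j, hj, hd⟩ := exists_dvd_sub_mul hr (u := 1) (fun hd => hr.one_lt.ne' (by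
          exact_mod_cast Int.eq_one_of_dvd_one (by simp) hd)) a
        refine ⟨j, hj, ?_⟩
        have := mul_int_mem_locSubgroup (s := r) (hs := hr) (g := g) hd
        convert this using 1
        rw [hz']; push_cast; ring
      · obtain ⟨a, -, hz'⟩ := hν₂z _ hz'
        obtain ⟨j, hj, b, hd⟩ := exists_dvd_sub_mul hr hu (v * a)
        refine ⟨j, hj, u, b, hu, ?_⟩
        have hd' : (v * a - u * j : ℝ) = r * b := by exact_mod_cast hd
        rw [hz']
        linear_combination (a : ℝ) * huv + g * hd'
  choose j hj hjH using hclass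
  have hjinj : Function.Injective fun x : R => (⟨j x, hj x⟩ : Fin r) := by
    intro x y hxy
    have hxy' : j x = j y := congrArg Fin.val hxy
    apply Subtype.ext
    apply hRinj _ x.2 _ y.2
    have := H.sub_mem (hjH x) (hjH y)
    rw [hxy'] at this
    convert this using 1; ring
  -- Apart from `S`, exclude the points where `ν₁ (ξ - x₀) = 0` or `‖ν₂ (ξ - x₀)‖ = 1`, so that the
  -- comparison of `ν` with `ν₁` is strict at `x₀`.
  have hbad : (S ∪ (fun z => x₀ + z) '' ({z | ν₁ z = 0} ∪
      Set.range fun a : ℤ => (a : ℝ) / (m₂ * (c₂ / p)))).Countable :=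
    hS.union ((hν₁p.zeros.union (Set.countable_range _)).image _)
  have hbad' : (⋃ i : ℕ, (fun z => z - g * i) '' (S ∪ (fun z => x₀ + z) '' ({z | ν₁ z = 0} ∪
      Set.range fun a : ℤ => (a : ℝ) / (m₂ * (c₂ / p))))).Countable :=
    Set.countable_iUnion fun i => hbad.image _
  obtain ⟨ξ, hξ⟩ := (hbad'.dense_compl ℝ).nonempty
  have hξi : ∀ i : ℕ, ξ + g * i ∉ (S ∪ (fun z => x₀ + z) '' ({z | ν₁ z = 0} ∪
      Set.range fun a : ℤ => (a : ℝ) / (m₂ * (c₂ / p)))) := fun i hi =>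
    hξ (Set.mem_iUnion.2 ⟨i, ξ + g * i, hi, by ring⟩)
  -- Double counting over the shifts `g * i`, `i < r`: representatives form a spectrum of `ν`, which
  -- gives `r` in total, while each single `x` contributes at most 1 through `ν₁`, and less than 1
  -- for `x₀`.
  have hsum1 : ∑ i ∈ Finset.range r, ∑' x : R, esq ν (ξ + g * i - x) = r := by
    rw [Finset.sum_congr rfl fun i _ => (hrig _ fun hi => hξi i (Or.inl hi)).2.2 R hRΛ hRinj hRsurj]
    simp
  have hsum2 : ∀ x : ℝ, ∑ i ∈ Finset.range r, esq ν₁ (ξ + g * i - x) = 1 := by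
    intro x
    rw [← sum_esq_mask_shift hr.one_le (c := m₁ * (c₁ / p)) (by positivity) (ξ - x)]
    refine Finset.sum_congr rfl fun i _ => ?_
    congr 1
    rw [hgdef]; push_cast; field_simp; ring
  have hle : ∀ x i, esq ν (ξ + g * i - x) ≤ esq ν₁ (ξ + g * i - x) := by
    intro x i
    rw [hν, esq_mul]
    refine mul_le_of_le_one_right zero_le ?_
    rw [esq, ENNReal.ofReal_le_one]
    exact pow_le_one₀ (norm_nonneg _) (hν₂p.norm_le_one _)
  have hlt : ∑' x : R, ∑ i ∈ Finset.range r, esq ν (ξ + g * i - x) < ∑' x : R, 1 := by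
    refine ENNReal.tsum_lt_tsum ?_ (fun x => ?_) (i := ⟨x₀, hx₀⟩) ?_
    · rw [Summable.tsum_finsetSum fun _ _ => ENNReal.summable, hsum1]
      exact ENNReal.natCast_ne_top _
    · rw [← hsum2 x]
      exact Finset.sum_le_sum fun i _ => hle x i
    · rw [← hsum2 x₀]
      have hr1 : 0 ∈ Finset.range r := Finset.mem_range.2 hr.pos
      rw [← Finset.add_sum_erase _ _ hr1, ← Finset.add_sum_erase _ _ hr1]
      refine ENNReal.add_lt_add_of_lt_of_le ?_ ?_ (Finset.sum_le_sum fun i _ => hle x₀ i)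
      · refine ENNReal.sum_ne_top.2 fun i _ => esq_ne_top _ _
      · have hξ0 := hξi 0
        simp only [Nat.cast_zero, mul_zero, add_zero] at hξ0 ⊢
        rw [hν, esq_mul]
        have hne : ν₁ (ξ - x₀) ≠ 0 := fun hz =>
          hξ0 (Or.inr ⟨ξ - x₀, Or.inl hz, by ring⟩)
        refine ENNReal.mul_lt_of_lt_div' ?_
        rw [ENNReal.div_self (esq_ne_zero hne) (esq_ne_top _ _), esq]
        rw [ENNReal.ofReal_lt_one]
        refine pow_lt_one₀ (norm_nonneg _) (lt_of_le_of_ne (hν₂p.norm_le_one _) fun h1 => ?_)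
          two_ne_zero
        obtain ⟨a, ha⟩ := exists_int_of_norm_mask_eq_one hr.two_le h1
        refine hξ0 (Or.inr ⟨ξ - x₀, Or.inr ⟨a, ?_⟩, by ring⟩)
        simp only
        rw [← ha]; field_simp
  rw [Summable.tsum_finsetSum fun _ _ => ENNReal.summable, hsum1] at hlt
  have hcard : ∑' x : R, (1 : ENNReal) ≤ r := by
    refine (ENNReal.tsum_comp_le_tsum_of_injective hjinj fun _ => 1).trans_eq ?_
    rw [tsum_fintype]; simp
  exact absurd hlt (not_lt.2 hcard)

end

/-! ### Necessity of the arithmetic conditions -/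

/-- The index 0 belongs to the set because `L ≥ 2`. A prime dividing `L` divides `p`, so its
exponent in `m * L` is exhausted by `p ^ i` once `i > m * L`, and the set is bounded. -/
lemma exists_isGreatest_gcd {p m L : ℕ} (hm : 0 < m) (hL : 2 ≤ L) (hLp : L ∣ p) :
    ∃ d, IsGreatest {i : ℕ | Nat.gcd (m * L / Nat.gcd (m * L) (p ^ i)) L ≠ 1} d := by
  have hmL : 0 < m * L := Nat.mul_pos hm (by omega)
  have hbdd : BddAbove {i : ℕ | Nat.gcd (m * L / Nat.gcd (m * L) (p ^ i)) L ≠ 1} := by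
    refine ⟨m * L, fun i hi => ?_⟩
    by_contra! hlt
    obtain ⟨s, hs, hsd⟩ := Nat.exists_prime_and_dvd hi
    have h1 := hsd.trans (Nat.gcd_dvd_left _ _)
    have h2 := (hsd.trans (Nat.gcd_dvd_right _ _)).trans hLp
    obtain ⟨e, n', hn', he⟩ := Nat.exists_eq_pow_mul_and_not_dvd hmL.ne' s hs.one_lt.ne'
    have hel : e < i := by
      refine lt_of_lt_of_le (Nat.lt_pow_self hs.one_lt) ?_ |>.trans hlt
      exact Nat.le_of_dvd hmL ⟨n', he⟩
    have h3 : s ^ e ∣ Nat.gcd (m * L) (p ^ i) :=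
      Nat.dvd_gcd ⟨n', he⟩ ((pow_dvd_pow_of_dvd h2 e).trans (pow_dvd_pow p hel.le))
    have h4 := Nat.mul_dvd_mul h1 h3
    rw [Nat.div_mul_cancel (Nat.gcd_dvd_left _ _), he, mul_comm s] at h4
    exact hn' ((Nat.mul_dvd_mul_iff_left (pow_pos hs.pos e)).1 h4)
  refine ⟨_, Nat.sSup_mem ⟨0, ?_⟩ hbdd, fun i hi => le_csSup hbdd hi⟩
  simp
  omega

section
variable {p N m L : ℕ} {Λ : Set ℝ}

/-- After `b < d` peelings, the spacing `p / N` is `(u / w) p^(d-b-1) (p / N)` lowest spacings of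
the second factor. It is thus `s`-adically divisible by `s`, which is what the next peeling needs.
-/
lemma IsSpec.exists_peel_second (hp : 2 ≤ p) (hN : 2 ≤ N) (hm : 0 < m) (hL : 2 ≤ L)
    (hNp : N ∣ p) (hLp : L ∣ p) {d u w s : ℕ} (hs : s.Prime) (hsL : s ∣ L) (hsu : s ∣ u)
    (hsw : ¬ s ∣ w) (huw : m * L * w = u * p ^ d)
    (h : IsSpec Λ (twoIp (p : ℝ)⁻¹ N 1 L m)) :
    ∀ b ≤ d, ∃ Λ', IsSpec Λ' (twoIp (p : ℝ)⁻¹ N 1 L (m / p ^ b)) := by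
  have hp0 : (0 : ℝ) < p := by exact_mod_cast (by omega : 0 < p)
  have hm0 : (0 : ℝ) < m := by exact_mod_cast hm
  have hL0 : (0 : ℝ) < L := by exact_mod_cast (by omega : 0 < L)
  have hN0 : (0 : ℝ) < N := by exact_mod_cast (by omega : 0 < N)
  intro b
  induction b with
  | zero => exact fun _ => ⟨Λ, by simpa using h⟩
  | succ b ih =>
    intro hb
    obtain ⟨Λ', h'⟩ := ih (by omega)
    obtain ⟨x₀, hx₀⟩ := h'.nonempty
    rw [twoIp_comm] at h'
    have hmem : (p : ℝ) / (1 * N) ∈ locSubgroup s hs (p / (m / p ^ b * L)) := by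
      obtain ⟨P, hP⟩ := hNp
      obtain ⟨v, rfl⟩ := hsu
      obtain ⟨k, rfl⟩ := Nat.exists_eq_add_of_le hb
      refine ⟨w, v * (p ^ k * P), fun hd => hsw (by exact_mod_cast hd), ?_⟩
      have h1 : (m * L * w : ℝ) = s * v * p ^ (b + 1 + k) := by exact_mod_cast huw
      have h2 : (p : ℝ) = N * P := by exact_mod_cast hP
      have h3 : (w : ℝ) = s * v * p ^ (b + 1 + k) / (m * L) := by
        rw [← h1]; field_simp
      push_cast
      rw [h3, pow_add, pow_add, pow_one]
      field_simp
      rw [h2]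
      ring
    have h2 := h'.peel hp (by omega) (by omega) (by positivity) one_pos hs hsL (hsL.trans hLp)
      hmem hx₀
    rw [twoIp_comm, div_div, ← pow_succ] at h2
    exact ⟨_, h2⟩

/-- With the second factor at scale `m / p ^ d`, take a prime power `r ^ k` dividing `N` but not
`m'`. The lowest spacings of the two factors have ratio `x / y`, and each of the three possible
`r`-adic positions is contradictory. -/
lemma IsSpec.dvd_of_isGreatest (hp : 2 ≤ p) (hN : 2 ≤ N) (hm : 0 < m) (hL : 2 ≤ L)
    (hNp : N ∣ p) (hLp : L ∣ p) {d : ℕ}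
    (hd : Nat.gcd (m * L / Nat.gcd (m * L) (p ^ d)) L ≠ 1)
    (h : IsSpec Λ (twoIp (p : ℝ)⁻¹ N 1 L m)) : N ∣ m / Nat.gcd m (p ^ d) := by
  have hp0 : (0 : ℝ) < p := by exact_mod_cast (by omega : 0 < p)
  have hm0 : (0 : ℝ) < m := by exact_mod_cast hm
  have hL0 : (0 : ℝ) < L := by exact_mod_cast (by omega : 0 < L)
  have hN0 : (0 : ℝ) < N := by exact_mod_cast (by omega : 0 < N)
  have hpd : 0 < p ^ d := pow_pos (by omega) d
  have hmL : 0 < m * L := Nat.mul_pos hm (by omega)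
  -- write `m L / p ^ d = u / w` in lowest terms
  obtain ⟨s, hs, hsd⟩ := Nat.exists_prime_and_dvd hd
  have hsL := hsd.trans (Nat.gcd_dvd_right _ _)
  have hsu := hsd.trans (Nat.gcd_dvd_left _ _)
  have hg0 : 0 < Nat.gcd (m * L) (p ^ d) := Nat.gcd_pos_of_pos_left _ hmL
  set u := m * L / Nat.gcd (m * L) (p ^ d) with hu
  set w := p ^ d / Nat.gcd (m * L) (p ^ d) with hw
  have hcop : Nat.Coprime u w := Nat.coprime_div_gcd_div_gcd hg0
  have hu' : u * Nat.gcd (m * L) (p ^ d) = m * L := Nat.div_mul_cancel (Nat.gcd_dvd_left _ _)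
  have hw' : w * Nat.gcd (m * L) (p ^ d) = p ^ d := Nat.div_mul_cancel (Nat.gcd_dvd_right _ _)
  have huw : m * L * w = u * p ^ d := by
    calc m * L * w = u * (w * Nat.gcd (m * L) (p ^ d)) := by nth_rw 1 [← hu']; ring
      _ = u * p ^ d := by rw [hw']
  have hu0 : 0 < u := Nat.pos_of_mul_pos_right (hu'.symm ▸ hmL)
  have hw0 : 0 < w := Nat.pos_of_mul_pos_right (hw'.symm ▸ hpd)
  have hu0r : (0 : ℝ) < u := by exact_mod_cast hu0
  have hw0r : (0 : ℝ) < w := by exact_mod_cast hw0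
  have hsw : ¬ s ∣ w := fun h1 => hs.one_lt.ne' (Nat.dvd_one.1 (hcop ▸ Nat.dvd_gcd hsu h1))
  -- write `m / p ^ d = m' / q` in lowest terms
  have hg1 : 0 < Nat.gcd m (p ^ d) := Nat.gcd_pos_of_pos_left _ hm
  set m' := m / Nat.gcd m (p ^ d) with hm'
  set q := p ^ d / Nat.gcd m (p ^ d) with hq
  have hm'' : m' * Nat.gcd m (p ^ d) = m := Nat.div_mul_cancel (Nat.gcd_dvd_left _ _)
  have hq' : q * Nat.gcd m (p ^ d) = p ^ d := Nat.div_mul_cancel (Nat.gcd_dvd_right _ _)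
  have hmq : m * q = m' * p ^ d := by
    calc m * q = m' * (q * Nat.gcd m (p ^ d)) := by nth_rw 1 [← hm'']; ring
      _ = m' * p ^ d := by rw [hq']
  by_contra hndvd
  rw [Nat.dvd_iff_prime_pow_dvd_dvd] at hndvd
  push Not at hndvd
  obtain ⟨r, k, hr, hrN, hrm⟩ := hndvd
  have hk : k ≠ 0 := by rintro rfl; simp at hrm
  have hrN1 : r ∣ N := (dvd_pow_self r hk).trans hrN
  have hrp : r ∣ p := hrN1.trans hNp
  have hrz := Nat.prime_iff_prime_int.1 hr
  -- write `u / (w N) = x / y` in lowest terms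
  obtain ⟨t, x, y, ht, hxy, hx, hy⟩ := Nat.exists_coprime' (m := u) (n := w * N)
    (Nat.gcd_pos_of_pos_left _ hu0)
  have ht0 : (0 : ℝ) < t := by exact_mod_cast ht
  have hrel : m' * L * y = x * q * N := by
    have : m' * L * y * (p ^ d * t) = x * q * N * (p ^ d * t) := by
      calc m' * L * y * (p ^ d * t) = (m' * p ^ d) * L * (y * t) := by ring
        _ = m * L * w * (q * N) := by rw [← hmq, ← hy]; ring
        _ = x * q * N * (p ^ d * t) := by rw [huw, hx]; ring
    exact Nat.eq_of_mul_eq_mul_right (Nat.mul_pos hpd ht) this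
  obtain ⟨Λ', h'⟩ := h.exists_peel_second hp hN hm hL hNp hLp hs hsL hsu hsw huw d le_rfl
  have hc : (0 : ℝ) < m / p ^ d := by positivity
  have huwr : (m * L * w : ℝ) = u * p ^ d := by exact_mod_cast huw
  have hcL : (m / p ^ d * L : ℝ) = u / w := by
    field_simp; linarith
  have hxr : (u : ℝ) = x * t := by exact_mod_cast hx
  have hyr : (w * N : ℝ) = y * t := by exact_mod_cast hy
  have hyx : (y : ℝ) * (p / (1 * N)) = x * (p / (m / p ^ d * L)) := by
    rw [hcL, hxr]
    have hx0 : (x : ℝ) ≠ 0 := by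
      rintro h0; rw [h0, zero_mul] at hxr; exact hu0r.ne' hxr
    field_simp
    linear_combination -hyr
  have hrL : ¬ r ∣ y → r ∣ L := by
    intro hry
    by_contra hrL
    apply hrm
    have h1 : r ^ k ∣ m' * L * y := hrel ▸ hrN.mul_left _
    have c1 : Nat.Coprime (r ^ k) y := ((Nat.Prime.coprime_iff_not_dvd hr).2 hry).pow_left k
    have c2 : Nat.Coprime (r ^ k) L := ((Nat.Prime.coprime_iff_not_dvd hr).2 hrL).pow_left k
    exact c2.dvd_of_dvd_mul_right (c1.dvd_of_dvd_mul_right h1)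
  -- If `r ∣ y`, peel the first factor, which strands the `s`-layer of the second. If `r ∣ x`, peel
  -- the second factor, which strands the `r`-layer of the first. If neither, the two `r`-layers sit
  -- at the same place.
  by_cases hry : r ∣ y
  · have hrx : ¬ r ∣ x := fun hrx =>
      hr.one_lt.ne' (Nat.dvd_one.1 (hxy ▸ Nat.dvd_gcd hrx hry))
    refine h'.false_of_peel hp (by omega) (by omega) one_pos hc hr hrN1 hrp ?_ hs hsL ?_
    · obtain ⟨y', rfl⟩ := hry
      refine ⟨x, y', fun hd => hrx (by exact_mod_cast hd), ?_⟩
      push_cast at hyx ⊢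
      rw [← hyx]; ring
    · intro a b hab
      rw [hcL] at hab
      have h1 : (b * u : ℝ) = a * w := by
        field_simp at hab
        linarith
      have h2 : b * u = a * w := by exact_mod_cast h1
      have h3 : (s : ℤ) ∣ a * w := h2 ▸ (Int.natCast_dvd_natCast.2 hsu).mul_left b
      exact ((Nat.prime_iff_prime_int.1 hs).dvd_or_dvd h3).resolve_right
        fun h4 => hsw (by exact_mod_cast h4)
  · by_cases hrx : r ∣ x
    · rw [twoIp_comm] at h'
      refine h'.false_of_peel hp (by omega) (by omega) hc one_pos hr (hrL hry) hrp ?_ hr hrN1 ?_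
      · obtain ⟨x', rfl⟩ := hrx
        refine ⟨y, x', fun hd => hry (by exact_mod_cast hd), ?_⟩
        push_cast at hyx ⊢
        rw [hyx]; ring
      · intro a b hab
        have hmqr : (m * q : ℝ) = m' * p ^ d := by exact_mod_cast hmq
        have h1 : (N * (b * q) : ℝ) = m' * a := by
          have h2 : (b * N * p ^ d : ℝ) = m * a := by
            field_simp at hab
            linarith
          have hpd' : (p : ℝ) ^ d ≠ 0 := by positivity
          apply mul_left_cancel₀ hpd'
          linear_combination (q : ℝ) * h2 + a * hmqr
        have h2 : (N : ℤ) * (b * q) = m' * a := by exact_mod_cast h1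
        by_contra hra
        apply hrm
        have h3 : ((r ^ k : ℕ) : ℤ) ∣ m' * a :=
          h2 ▸ (Int.natCast_dvd_natCast.2 hrN).mul_right _
        have c1 : IsCoprime ((r ^ k : ℕ) : ℤ) a := by
          push_cast
          exact (hrz.coprime_iff_not_dvd.2 hra).pow_left
        exact Int.natCast_dvd_natCast.1 (c1.dvd_of_dvd_mul_right h3)
    · refine h'.false_of_same_bottom hp (by omega) (by omega) one_pos hc hr hrN1 (hrL hry) hrp
        (u := x) (v := y) (fun hd => hrx (by exact_mod_cast hd))
        (fun hd => hry (by exact_mod_cast hd)) ?_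
      push_cast
      exact hyx.symm

lemma IsSpec.arithmetic (hp : 2 ≤ p) (hN : 2 ≤ N) (hm : 0 < m) (hL : 2 ≤ L)
    (h : IsSpec Λ (twoIp (p : ℝ)⁻¹ N 1 L m)) :
    N ∣ p ∧ L ∣ p ∧
      ∃ d : ℕ, IsGreatest {i : ℕ | Nat.gcd (m * L / Nat.gcd (m * L) (p ^ i)) L ≠ 1} d ∧
        N ∣ m / Nat.gcd m (p ^ d) := by
  have hm0 : (0 : ℝ) < m := by exact_mod_cast hm
  have hNp := h.dvd_base hp hN (by omega) one_pos hm0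
  have hLp : L ∣ p := by
    have h' := h
    rw [twoIp_comm] at h'
    exact h'.dvd_base hp hL (by omega) hm0 one_pos
  obtain ⟨d, hd⟩ := exists_isGreatest_gcd hm hL hLp
  exact ⟨hNp, hLp, d, hd, h.dvd_of_isGreatest hp hN hm hL hNp hLp hd.1⟩

end

/-! ### Rationality of the inverse ratio -/

/-- The subgroup `β ℚ` of `ℝ`. -/
def ratLine (β : ℝ) : AddSubgroup ℝ where
  carrier := {x | ∃ a : ℚ, x = β * a}
  zero_mem' := ⟨0, by simp⟩
  add_mem' := by
    rintro x y ⟨a, rfl⟩ ⟨b, rfl⟩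
    exact ⟨a + b, by push_cast; ring⟩
  neg_mem' := by
    rintro x ⟨a, rfl⟩
    exact ⟨-a, by push_cast; ring⟩

lemma exists_rat_of_mask_eq_zero {ρ c : ℝ} (h0 : 0 < ρ) {n k q : ℕ} (hn : 1 ≤ n) (hq : 1 ≤ q)
    (hc : c = q) {x : ℝ} (h : mask n (ρ ^ (k + 1) * (c * x)) = 0) :
    ∃ a : ℚ, a ≠ 0 ∧ x = ρ⁻¹ ^ (k + 1) * a := by
  obtain ⟨a, ha, hx⟩ := (mask_eq_zero_iff hn).1 h
  have hn1 : (n : ℝ) ≠ 0 := by exact_mod_cast (by omega : n ≠ 0)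
  have hq1 : (q : ℝ) ≠ 0 := by exact_mod_cast (by omega : q ≠ 0)
  have ha0 : a ≠ 0 := by rintro rfl; simp at ha
  refine ⟨a / (n * q), ?_, ?_⟩
  · have : (n : ℚ) ≠ 0 := by exact_mod_cast (by omega : n ≠ 0)
    have : (q : ℚ) ≠ 0 := by exact_mod_cast (by omega : q ≠ 0)
    have : (a : ℚ) ≠ 0 := by exact_mod_cast ha0
    positivity
  · push_cast
    rw [← hx, hc, inv_pow]
    field_simp

open Classical in
/-- The inverse contraction ratio of a spectral two-factor product is rational. -/
lemma IsSpec.exists_rat {ρ : ℝ} (h0 : 0 < ρ) (h1 : ρ < 1) {N m L : ℕ} (hN : 2 ≤ N) (hm : 0 < m)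
    (hL : 2 ≤ L) {Λ : Set ℝ} (h : IsSpec Λ (twoIp ρ N 1 L m)) : ∃ a : ℚ, ρ⁻¹ = a := by
  by_contra! hirr
  have hβ : ρ⁻¹ ≠ 0 := inv_ne_zero h0.ne'
  have hm0 : (m : ℝ) ≠ 0 := by exact_mod_cast hm.ne'
  -- The index `k` stands for level `k + 1`. Its zeros are nonzero rational multiples of `ρ⁻¹ ^ (k +
  -- 1)` and lie in `ρ⁻¹ ℚ` exactly when `J k`; irrationality of `ρ⁻¹` gives `¬ J 1`.
  let J : ℕ → Prop := fun k => ∃ b : ℚ, ρ⁻¹ ^ (k + 1) = ρ⁻¹ * b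
  have hJ0 : J 0 := ⟨1, by simp⟩
  have hJ1 : ¬ J 1 := by
    rintro ⟨b, hb⟩
    refine hirr b (mul_left_cancel₀ hβ ?_)
    rw [← hb]; ring
  have sz1 : ∀ n, 1 ≤ n → SizeSeq (fun k => if J k then n else 1) n := fun n hn k => by
    dsimp only; split_ifs <;> omega
  have sz2 : ∀ n, 1 ≤ n → SizeSeq (fun k => if J k then 1 else n) n := fun n hn k => by
    dsimp only; split_ifs <;> omega
  set η : ℝ → ℂ := fun x => ip (fun k => if J k then N else 1) ρ (1 * x) *
    ip (fun k => if J k then L else 1) ρ (m * x) with hη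
  set ν : ℝ → ℂ := fun x => ip (fun k => if J k then 1 else N) ρ (1 * x) *
    ip (fun k => if J k then 1 else L) ρ (m * x) with hν
  have hηp : PDFun η := (PDFun.ip h0 h1 (sz1 L (by omega)) hm0).mul_ip h0 h1 (sz1 N (by omega))
    one_ne_zero
  have hνp : PDFun ν := (PDFun.ip h0 h1 (sz2 L (by omega)) hm0).mul_ip h0 h1 (sz2 N (by omega))
    one_ne_zero
  have hfac : twoIp ρ N 1 L m = fun x => η x * ν x := by
    funext x
    rw [twoIp, ip_eq_mul_ip h0 h1 (SizeSeq.const (by omega)) J (1 * x),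
      ip_eq_mul_ip h0 h1 (SizeSeq.const (by omega)) J (m * x)]
    simp only [hη, hν]; ring
  rw [hfac] at h
  -- The two equivalences encode `J k → η z = 0` and `¬ J k → ν z = 0`, in a form suited to
  -- rewriting.
  have hsmall : ∀ z, η z = 0 ∨ ν z = 0 → ∃ (k : ℕ) (a : ℚ), a ≠ 0 ∧ z = ρ⁻¹ ^ (k + 1) * a ∧
      (η z = 0 ↔ J k ∨ η z = 0) ∧ (ν z = 0 ↔ ¬ J k ∨ ν z = 0) := by
    intro z hz
    have hone : ∀ y, mask 1 y ≠ 0 := fun y => by rw [mask_one]; exact one_ne_zero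
    rcases hz with hz | hz
    · have hJ : ∃ k, J k ∧ (mask N (ρ ^ (k + 1) * (1 * z)) = 0 ∨
          mask L (ρ ^ (k + 1) * (m * z)) = 0) := by
        rcases mul_eq_zero.1 hz with hz | hz
        · obtain ⟨k, hk⟩ := (ip_eq_zero_iff h0 h1 (sz1 N (by omega)) _).1 hz
          split_ifs at hk with hJ
          · exact ⟨k, hJ, Or.inl hk⟩
          · exact absurd hk (hone _)
        · obtain ⟨k, hk⟩ := (ip_eq_zero_iff h0 h1 (sz1 L (by omega)) _).1 hz
          split_ifs at hk with hJ
          · exact ⟨k, hJ, Or.inr hk⟩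
          · exact absurd hk (hone _)
      obtain ⟨k, hJ, hk⟩ := hJ
      obtain ⟨a, ha, hza⟩ : ∃ a : ℚ, a ≠ 0 ∧ z = ρ⁻¹ ^ (k + 1) * a := by
        rcases hk with hk | hk
        · exact exists_rat_of_mask_eq_zero h0 (q := 1) (by omega) le_rfl (by simp) hk
        · exact exists_rat_of_mask_eq_zero h0 (by omega) hm rfl hk
      exact ⟨k, a, ha, hza, by simp [hz], by simp [hJ]⟩
    · have hJ : ∃ k, ¬ J k ∧ (mask N (ρ ^ (k + 1) * (1 * z)) = 0 ∨
          mask L (ρ ^ (k + 1) * (m * z)) = 0) := by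
        rcases mul_eq_zero.1 hz with hz | hz
        · obtain ⟨k, hk⟩ := (ip_eq_zero_iff h0 h1 (sz2 N (by omega)) _).1 hz
          split_ifs at hk with hJ
          · exact absurd hk (hone _)
          · exact ⟨k, hJ, Or.inl hk⟩
        · obtain ⟨k, hk⟩ := (ip_eq_zero_iff h0 h1 (sz2 L (by omega)) _).1 hz
          split_ifs at hk with hJ
          · exact absurd hk (hone _)
          · exact ⟨k, hJ, Or.inr hk⟩
      obtain ⟨k, hJ, hk⟩ := hJ
      obtain ⟨a, ha, hza⟩ : ∃ a : ℚ, a ≠ 0 ∧ z = ρ⁻¹ ^ (k + 1) * a := by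
        rcases hk with hk | hk
        · exact exists_rat_of_mask_eq_zero h0 (q := 1) (by omega) le_rfl (by simp) hk
        · exact exists_rat_of_mask_eq_zero h0 (by omega) hm rfl hk
      exact ⟨k, a, ha, hza, by simp [hJ], by simp [hz]⟩
  have hmem : ∀ (k : ℕ) (a : ℚ), a ≠ 0 → (ρ⁻¹ ^ (k + 1) * (a : ℝ) ∈ ratLine ρ⁻¹ ↔ J k) := by
    intro k a ha
    have ha' : (a : ℝ) ≠ 0 := by exact_mod_cast ha
    constructor
    · rintro ⟨b, hb⟩
      refine ⟨b / a, ?_⟩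
      push_cast
      rw [mul_div_assoc', eq_div_iff ha', hb]
    · rintro ⟨b, hb⟩
      exact ⟨b * a, by rw [hb]; push_cast; ring⟩
  have hA : ∀ x ∈ Λ, ∀ y ∈ Λ, x ≠ y → x - y ∈ ratLine ρ⁻¹ → η (x - y) = 0 := by
    intro x hx y hy hxy hz
    obtain ⟨k, a, ha, hza, e1, -⟩ := hsmall _ (mul_eq_zero.1 (h.orth x hx y hy hxy))
    rw [e1]
    rw [hza, hmem k a ha] at hz
    exact Or.inl hz
  have hB : ∀ x ∈ Λ, ∀ y ∈ Λ, x - y ∉ ratLine ρ⁻¹ → ν (x - y) = 0 := by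
    intro x hx y hy hz
    have hxy : x ≠ y := by
      rintro rfl
      exact hz (by simp [(ratLine ρ⁻¹).zero_mem])
    obtain ⟨k, a, ha, hza, -, e2⟩ := hsmall _ (mul_eq_zero.1 (h.orth x hx y hy hxy))
    rw [e2]
    rw [hza, hmem k a ha] at hz
    exact Or.inl hz
  -- In a class `ν` is unimodular, so its level-two mask makes `ρ² (x - y)` an integer. As `x - y ∈
  -- ρ⁻¹ ℚ`, a nonzero difference would make `ρ` rational. Classes are therefore single points, and
  -- `η` is superfluous.
  have hsep : ∀ x ∈ Λ, ∀ y ∈ Λ, x - y ∈ ratLine ρ⁻¹ → x = y := by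
    intro x hx y hy hz
    have h2 := h.norm_eq_one_of_mem hηp hνp hA hB hx hy hz
    have h3 : ‖ν (x - y)‖ ≤ ‖mask N (ρ ^ 2 * (1 * (x - y)))‖ := by
      simp only [hν, norm_mul]
      refine (mul_le_of_le_one_right (norm_nonneg _) (norm_ip_le_one h0 h1 (sz2 L (by omega)) _)).trans
        ((norm_ip_le_norm_mask h0 h1 (sz2 N (by omega)) _ 1).trans_eq ?_)
      simp only [if_neg hJ1]
    rw [h2] at h3
    obtain ⟨a, ha⟩ := exists_int_of_norm_mask_eq_one hN (le_antisymm (norm_mask_le_one _ _) h3)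
    obtain ⟨b, hb⟩ := hz
    rw [hb, one_mul] at ha
    have h4 : ρ * b = a := by rw [← ha]; field_simp
    by_contra hne
    have ha0 : (a : ℝ) ≠ 0 := by
      intro h5
      rw [h5] at h4
      have hb0 := (mul_eq_zero.1 h4).resolve_left h0.ne'
      rw [hb0, mul_zero, sub_eq_zero] at hb
      exact hne hb
    refine hirr (b / a) ?_
    push_cast
    rw [eq_div_iff ha0, ← h4]
    field_simp
  have hone := h.norm_eq_one_of_orth hηp hνp fun x hx y hy hxy =>
    hB x hx y hy fun hz => hxy (hsep x hx y hy hz)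
  refine not_forall_norm_mask_eq_one hN h0.ne' fun x => le_antisymm (norm_mask_le_one _ _) ?_
  rw [← hone x]
  simp only [hη, norm_mul]
  refine (mul_le_of_le_one_right (norm_nonneg _) (norm_ip_le_one h0 h1 (sz1 L (by omega)) _)).trans
    ((norm_ip_le_norm_mask h0 h1 (sz1 N (by omega)) _ 0).trans_eq ?_)
  simp only [if_pos hJ0, zero_add, pow_one, one_mul]

/-! ### Integrality of a rational inverse ratio: slow decay -/

/-- The product of the first `n` levels of a two-factor product. -/
noncomputable def finIp (ρ : ℝ) (N : ℕ) (L : ℕ) (m : ℝ) (n : ℕ) (x : ℝ) : ℂ :=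
  ∏ k ∈ Finset.range n, (mask N (ρ ^ (k + 1) * x) * mask L (ρ ^ (k + 1) * (m * x)))

section
variable {ρ : ℝ} {N L m : ℕ}

lemma twoIp_eq_finIp_mul (h0 : 0 < ρ) (h1 : ρ < 1) (hN : 1 ≤ N) (hL : 1 ≤ L) (m : ℝ) (n : ℕ)
    (x : ℝ) : twoIp ρ N 1 L m x = finIp ρ N L m n x * twoIp ρ N 1 L m (ρ ^ n * x) := by
  induction n with
  | zero => simp [finIp]
  | succ n ih =>
    rw [ih, finIp, finIp, Finset.prod_range_succ]
    have : twoIp ρ N 1 L m (ρ ^ n * x) = mask N (ρ ^ (n + 1) * x) * mask L (ρ ^ (n + 1) * (m * x)) *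
        twoIp ρ N 1 L m (ρ ^ (n + 1) * x) := by
      simp only [twoIp]
      rw [ip_eq_mask_mul h0 h1 (SizeSeq.const hN), ip_eq_mask_mul h0 h1 (SizeSeq.const hL)]
      have e1 : ρ * (1 * (ρ ^ n * x)) = ρ ^ (n + 1) * x := by ring
      have e2 : ρ * (m * (ρ ^ n * x)) = ρ ^ (n + 1) * (m * x) := by ring
      have e3 : 1 * (ρ ^ (n + 1) * x) = ρ ^ (n + 1) * x := by ring
      have e4 : m * (ρ ^ (n + 1) * x) = ρ ^ (n + 1) * (m * x) := by ring
      rw [e1, e2, e3, e4]; ring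
    rw [this]; ring

lemma pdFun_finIp (h0 : 0 < ρ) (hN : 1 ≤ N) (hL : 1 ≤ L) {m : ℝ} (hm : m ≠ 0) (n : ℕ) :
    PDFun (finIp ρ N L m n) := by
  induction n with
  | zero =>
    have : finIp ρ N L m 0 = fun _ => 1 := by funext x; simp [finIp]
    rw [this]; exact PDFun.one
  | succ n ih =>
    have hρ : ρ ^ (n + 1) ≠ 0 := (pow_pos h0 _).ne'
    have := (ih.mul_mask hL (a := ρ ^ (n + 1) * m) (mul_ne_zero hρ hm)).mul_mask hN hρ
    convert this using 1
    funext x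
    rw [finIp, finIp, Finset.prod_range_succ, mul_assoc (ρ ^ (n + 1))]
    ring

lemma norm_finIp_le (j n : ℕ) (hj : j < n) (m x : ℝ) :
    ‖finIp ρ N L m n x‖ ≤ ‖mask N (ρ ^ (j + 1) * x)‖ := by
  rw [finIp, ← Finset.mul_prod_erase _ _ (Finset.mem_range.2 hj), norm_mul, norm_prod, norm_mul,
    mul_assoc]
  refine mul_le_of_le_one_right (norm_nonneg _) (mul_le_one₀ (norm_mask_le_one _ _)
    (Finset.prod_nonneg fun _ _ => norm_nonneg _)
    (Finset.prod_le_one (fun _ _ => norm_nonneg _) fun k _ => ?_))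
  rw [norm_mul]
  exact mul_le_one₀ (norm_mask_le_one _ _) (norm_nonneg _) (norm_mask_le_one _ _)

variable {p q : ℕ}

/-- One step of the decay of `twoIp` for a rational, non-integral inverse ratio `p / q`. -/
lemma norm_twoIp_le_step (hpq : Nat.Coprime p q) (hp : 2 ≤ p) (hq : 2 ≤ q) (hqp : q < p)
    (hN : 2 ≤ N) (hL : 1 ≤ L) (m : ℝ) {T : ℕ} (hT : 1 ≤ T) (hpT : p ≤ q ^ T) {c₀ : ℝ}
    (hc₀ : 0 ≤ c₀)
    (hmask : ∀ x : ℝ, (∀ a : ℤ, (1 : ℝ) / (p + q) ≤ |x - a|) → ‖mask N x‖ ≤ c₀)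
    {X c : ℝ} (hX : 1 ≤ X) (hdec : ∀ y, X ≤ |y| → ‖twoIp (q / p : ℝ) N 1 L m y‖ ≤ c) {y : ℝ}
    (hy : (2 * p ^ 2 * X) ^ T ≤ |y|) : ‖twoIp (q / p : ℝ) N 1 L m y‖ ≤ c₀ * c := by
  have hp0 : (2 : ℝ) ≤ p := by exact_mod_cast hp
  have hq0 : (2 : ℝ) ≤ q := by exact_mod_cast hq
  have hqp' : (q : ℝ) < p := by exact_mod_cast hqp
  have h0 : (0 : ℝ) < q / p := by positivity
  have h1 : (q / p : ℝ) < 1 := by rw [div_lt_one (by positivity)]; exact hqp'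
  have hbase : (1 : ℝ) ≤ 2 * p ^ 2 * X := by nlinarith
  have hy1 : 2 * p ^ 2 * X ≤ |y| := (le_self_pow₀ hbase (by omega)).trans hy
  have hy2 : 2 * (p : ℝ) ^ 2 ≤ |y| := by nlinarith
  obtain ⟨n, hn1, hn2⟩ := exists_nat_pow_near (x := 2 * |y|) (y := (p : ℝ)) (by nlinarith)
    (by linarith)
  -- If the first `n + 2` scaled points were all within `1 / (p + q)` of integers `a i`, then `p * a
  -- (i + 1) - q * a i` would be an integer of size below 1. The relations `p * a (i + 1) = q * a i`
  -- give `p ^ (n + 1) ∣ a 0`, too large since `2 |y| < p ^ (n + 1)`.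
  have key : ∃ i, i < n + 2 ∧ ∀ a : ℤ, (1 : ℝ) / (p + q) ≤ |(q / p : ℝ) ^ (i + 1) * y - a| := by
    by_contra! hno
    have hno' : ∀ i, ∃ a : ℤ, i < n + 2 → |(q / p : ℝ) ^ (i + 1) * y - a| < 1 / (p + q) := by
      intro i
      by_cases hi : i < n + 2
      · obtain ⟨a, ha⟩ := hno i hi
        exact ⟨a, fun _ => ha⟩
      · exact ⟨0, fun h => absurd h hi⟩
    choose a ha using hno'
    have hrec : ∀ i, i + 1 < n + 2 → p * a (i + 1) = q * a i := by
      intro i hi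
      have e1 := ha i (by omega)
      have e2 := ha (i + 1) hi
      have e3 : (p : ℝ) * a (i + 1) - q * a i = q * ((q / p : ℝ) ^ (i + 1) * y - a i) -
          p * ((q / p : ℝ) ^ (i + 1 + 1) * y - a (i + 1)) := by
        rw [pow_succ _ (i + 1)]; field_simp; ring
      have e4 : |(p : ℝ) * a (i + 1) - q * a i| < 1 := by
        rw [e3]
        refine (abs_sub _ _).trans_lt ?_
        rw [abs_mul, abs_mul, Nat.abs_cast, Nat.abs_cast]
        calc _ < (q : ℝ) * (1 / (p + q)) + p * (1 / (p + q)) := by gcongr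
          _ = 1 := by field_simp; ring
      have e5 : |(p : ℤ) * a (i + 1) - q * a i| < 1 := by exact_mod_cast e4
      rw [Int.abs_lt_one_iff] at e5
      linarith
    have hrec' : ∀ i, i < n + 2 → (p : ℤ) ^ i * a i = q ^ i * a 0 := by
      intro i
      induction i with
      | zero => simp
      | succ i ih =>
        intro hi
        have e1 := ih (by omega)
        have e2 := hrec i hi
        rw [pow_succ, pow_succ, mul_assoc, e2]
        linear_combination (q : ℤ) * e1
    have hdvd : (p : ℤ) ^ (n + 1) ∣ a 0 := by
      have e1 : (p : ℤ) ^ (n + 1) ∣ q ^ (n + 1) * a 0 :=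
        ⟨_, (hrec' (n + 1) (by omega)).symm⟩
      exact ((Nat.isCoprime_iff_coprime.2 hpq).pow).dvd_of_dvd_mul_left e1
    have e0 := ha 0 (by omega)
    rw [zero_add, pow_one] at e0
    have hδ : (1 : ℝ) / (p + q) ≤ 1 := by
      rw [div_le_one (by positivity)]; linarith
    have hyy : 1 ≤ |(q / p : ℝ) * y| := by
      rw [abs_mul, abs_of_pos h0, div_mul_eq_mul_div, le_div_iff₀ (by positivity)]
      nlinarith
    have hyy' : |(q / p : ℝ) * y| ≤ |y| := by
      rw [abs_mul, abs_of_pos h0]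
      exact mul_le_of_le_one_left (abs_nonneg _) h1.le
    have ha0 : a 0 ≠ 0 := by
      intro h
      rw [h] at e0
      simp only [Int.cast_zero, sub_zero] at e0
      linarith
    have e2 : (p : ℝ) ^ (n + 1) ≤ |(a 0 : ℝ)| := by
      have := Int.le_of_dvd (abs_pos.2 ha0) ((dvd_abs _ _).2 hdvd)
      exact_mod_cast this
    have e3 : |(a 0 : ℝ)| ≤ |(q / p : ℝ) * y| + 1 := by
      have := abs_sub_abs_le_abs_sub ((a 0 : ℝ)) ((q / p : ℝ) * y)
      rw [abs_sub_comm] at this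
      linarith
    have : (1 : ℝ) ≤ |y| := by linarith
    linarith
  obtain ⟨i, hi, hbad⟩ := key
  rw [twoIp_eq_finIp_mul h0 h1 (by omega) hL m (i + 1), norm_mul]
  have hle1 := (norm_finIp_le (ρ := (q / p : ℝ)) (N := N) (L := L) i (i + 1) (by omega) m y).trans
    (hmask _ hbad)
  refine mul_le_mul hle1 (hdec _ ?_) (norm_nonneg _) hc₀
  -- lower bound for the argument
  have hqI : 2 * p ^ 2 * X ≤ (q : ℝ) ^ (n + 2) := by
    refine le_of_lt (lt_of_pow_lt_pow_left₀ T (by positivity) ?_)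
    calc (2 * p ^ 2 * X) ^ T ≤ |y| := hy
      _ ≤ 2 * |y| := by linarith [abs_nonneg y]
      _ < (p : ℝ) ^ (n + 1) := hn2
      _ ≤ (p : ℝ) ^ (n + 2) := pow_le_pow_right₀ (by linarith) (by omega)
      _ ≤ ((q : ℝ) ^ T) ^ (n + 2) := by
          have : (p : ℝ) ≤ (q : ℝ) ^ T := by exact_mod_cast hpT
          gcongr
      _ = ((q : ℝ) ^ (n + 2)) ^ T := by rw [← pow_mul, ← pow_mul, mul_comm]
  have hpos : (0 : ℝ) < p ^ (n + 2) := by positivity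
  calc X ≤ (q : ℝ) ^ (n + 2) / (2 * p ^ 2) := by
        rw [le_div_iff₀ (by positivity)]; linarith
    _ ≤ (q / p : ℝ) ^ (n + 2) * |y| := by
        rw [div_pow, div_mul_eq_mul_div, div_le_div_iff₀ (by positivity) hpos]
        have : (p : ℝ) ^ (n + 2) ≤ 2 * |y| * p ^ 2 := by
          rw [pow_add]; gcongr
        have hq' : (0 : ℝ) ≤ (q : ℝ) ^ (n + 2) := by positivity
        nlinarith [mul_le_mul_of_nonneg_left this hq']
    _ ≤ (q / p : ℝ) ^ (i + 1) * |y| := by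
        gcongr ?_ * _
        exact pow_le_pow_of_le_one h0.le h1.le (by omega)
    _ = |(q / p : ℝ) ^ (i + 1) * y| := by rw [abs_mul, abs_of_pos (pow_pos h0 _)]

/-- Decay of `twoIp` for a rational, non-integral inverse ratio `p / q`. -/
lemma exists_decay (hpq : Nat.Coprime p q) (hp : 2 ≤ p) (hq : 2 ≤ q) (hqp : q < p)
    (hN : 2 ≤ N) (hL : 1 ≤ L) (m : ℝ) {T : ℕ} (hT : 1 ≤ T) (hpT : p ≤ q ^ T) :
    ∃ (c₀ : ℝ) (W : ℕ), 0 < c₀ ∧ c₀ < 1 ∧ ∀ (j : ℕ) (y : ℝ), (q : ℝ) ^ (W * (T + 1) ^ j) ≤ |y| →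
      ‖twoIp (q / p : ℝ) N 1 L m y‖ ≤ c₀ ^ j := by
  have hp0 : (2 : ℝ) ≤ p := by exact_mod_cast hp
  have hq0 : (2 : ℝ) ≤ q := by exact_mod_cast hq
  have hqp' : (q : ℝ) < p := by exact_mod_cast hqp
  have h0 : (0 : ℝ) < q / p := by positivity
  have h1 : (q / p : ℝ) < 1 := by rw [div_lt_one (by positivity)]; exact hqp'
  obtain ⟨c₀, hc0, hc1, hmask⟩ := exists_norm_mask_le hN (δ := (1 : ℝ) / (p + q)) (by positivity)
  obtain ⟨W, hW⟩ := pow_unbounded_of_one_lt (2 * (p : ℝ) ^ 2) (by linarith : (1 : ℝ) < q)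
  have hle1 : ∀ y, ‖twoIp (q / p : ℝ) N 1 L m y‖ ≤ 1 := by
    intro y
    rw [twoIp, norm_mul]
    exact mul_le_one₀ (norm_ip_le_one h0 h1 (SizeSeq.const (by omega)) _) (norm_nonneg _)
      (norm_ip_le_one h0 h1 (SizeSeq.const hL) _)
  refine ⟨c₀, W, hc0, hc1, ?_⟩
  -- The radius grows by `X ↦ (2 p² X)^T`; the stronger invariant on `2 p² X` closes the induction,
  -- as `2 p² ≤ q ^ W` is absorbed by passing from exponent factor `T` to `T + 1`.
  have main : ∀ j : ℕ, ∃ X : ℝ, 1 ≤ X ∧ 2 * p ^ 2 * X ≤ (q : ℝ) ^ (W * (T + 1) ^ j) ∧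
      ∀ y, X ≤ |y| → ‖twoIp (q / p : ℝ) N 1 L m y‖ ≤ c₀ ^ j := by
    intro j
    induction j with
    | zero => exact ⟨1, le_rfl, by simpa using hW.le, fun y _ => by simpa using hle1 y⟩
    | succ j ih =>
      obtain ⟨X, hX1, hX2, hX3⟩ := ih
      have hb : (1 : ℝ) ≤ 2 * p ^ 2 * X := by nlinarith
      refine ⟨(2 * p ^ 2 * X) ^ T, one_le_pow₀ hb, ?_, fun y hy => ?_⟩
      · calc 2 * (p : ℝ) ^ 2 * (2 * p ^ 2 * X) ^ T
            ≤ (q : ℝ) ^ W * ((q : ℝ) ^ (W * (T + 1) ^ j)) ^ T := by gcongr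
          _ = (q : ℝ) ^ (W + W * (T + 1) ^ j * T) := by rw [← pow_mul, ← pow_add]
          _ ≤ (q : ℝ) ^ (W * (T + 1) ^ (j + 1)) := by
              refine pow_le_pow_right₀ (by linarith) ?_
              have : 1 ≤ (T + 1) ^ j := Nat.one_le_pow _ _ (by omega)
              rw [pow_succ]
              nlinarith [Nat.mul_le_mul_left W this]
      · rw [pow_succ']
        exact norm_twoIp_le_step hpq hp hq hqp hN hL m hT hpT hc0.le hmask hX1 hX3 hy
  intro j y hy
  obtain ⟨X, hX1, hX2, hX3⟩ := main j
  have hb : (1 : ℝ) ≤ 2 * p ^ 2 := by nlinarith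
  exact hX3 y (((le_mul_of_one_le_left (by linarith) hb).trans hX2).trans hy)

end

section
variable {N L m : ℕ} {p q : ℕ} {Λ : Set ℝ}

/-- A zero of `twoIp` is a zero of one of its levels. -/
lemma exists_level_of_twoIp_eq_zero (hp : 2 ≤ p) (hq : 1 ≤ q) (hqp : q < p)
    (hN : 1 ≤ N) (hL : 1 ≤ L) (hm : 0 < m) {z : ℝ} (hz : twoIp (q / p : ℝ) N 1 L m z = 0) :
    ∃ (k : ℕ) (a : ℤ), a ≠ 0 ∧ ((N * m * L : ℕ) : ℝ) * q ^ (k + 1) * z = p ^ (k + 1) * a ∧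
      ∀ n, k < n → finIp (q / p : ℝ) N L m n z = 0 := by
  have hp0 : (0 : ℝ) < p := by exact_mod_cast (by omega : 0 < p)
  have hq0 : (0 : ℝ) < q := by exact_mod_cast hq
  have h0 : (0 : ℝ) < q / p := by positivity
  have h1 : (q / p : ℝ) < 1 := by
    rw [div_lt_one hp0]; exact_mod_cast hqp
  have hpow : ∀ k : ℕ, (q / p : ℝ) ^ (k + 1) * p ^ (k + 1) = q ^ (k + 1) := by
    intro k; rw [div_pow]; field_simp
  rcases mul_eq_zero.1 hz with hz | hz
  · obtain ⟨k, hk⟩ := (ip_eq_zero_iff h0 h1 (SizeSeq.const hN) _).1 hz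
    rw [one_mul] at hk
    obtain ⟨a, ha, hx⟩ := (mask_eq_zero_iff hN).1 hk
    have ha0 : a ≠ 0 := by rintro rfl; simp at ha
    refine ⟨k, a * (m * L), ?_, ?_, fun n hn => ?_⟩
    · have : (m * L : ℤ) ≠ 0 := by exact_mod_cast (Nat.mul_pos hm hL).ne'
      exact mul_ne_zero ha0 this
    · push_cast
      rw [← hpow, ← hx]; ring
    · exact Finset.prod_eq_zero (Finset.mem_range.2 hn) (by rw [hk, zero_mul])
  · obtain ⟨k, hk⟩ := (ip_eq_zero_iff h0 h1 (SizeSeq.const hL) _).1 hz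
    obtain ⟨a, ha, hx⟩ := (mask_eq_zero_iff hL).1 hk
    have ha0 : a ≠ 0 := by rintro rfl; simp at ha
    refine ⟨k, a * N, ?_, ?_, fun n hn => ?_⟩
    · have : (N : ℤ) ≠ 0 := by exact_mod_cast (by omega : N ≠ 0)
      exact mul_ne_zero ha0 this
    · push_cast
      rw [← hpow, ← hx]; ring
    · exact Finset.prod_eq_zero (Finset.mem_range.2 hn) (by rw [hk, mul_zero])

/-- Bounded denominators of an orthogonal set. -/
lemma exists_common_denominator (hpq : Nat.Coprime p q) (hp : 2 ≤ p) (hq : 1 ≤ q) (hqp : q < p)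
    (hN : 1 ≤ N) (hL : 1 ≤ L) (hm : 0 < m)
    (horth : ∀ x ∈ Λ, ∀ y ∈ Λ, x ≠ y → twoIp (q / p : ℝ) N 1 L m (x - y) = 0)
    {x₀ : ℝ} (hx₀ : x₀ ∈ Λ) :
    ∃ K : ℕ, 0 < K ∧ ∀ x ∈ Λ, ∃ a : ℤ, (K : ℝ) * (x - x₀) = a := by
  by_cases hall : ∀ x ∈ Λ, x = x₀
  · exact ⟨1, one_pos, fun x hx => ⟨0, by simp [hall x hx]⟩⟩
  push Not at hall
  obtain ⟨x₁, hx₁, hne⟩ := hall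
  set D : ℕ := N * m * L with hD
  have hD0 : 0 < D := Nat.mul_pos (Nat.mul_pos hN hm) hL
  obtain ⟨k₁, a₁, ha₁, e₁, -⟩ := exists_level_of_twoIp_eq_zero hp hq hqp hN hL hm
    (horth x₁ hx₁ x₀ hx₀ hne)
  rw [← hD] at e₁
  set A : ℤ := p ^ (k₁ + 1) * a₁ with hA
  have hA0 : A ≠ 0 := mul_ne_zero (pow_ne_zero _ (by exact_mod_cast (by omega : p ≠ 0))) ha₁
  have hqz : (q : ℤ) ≠ 0 := by exact_mod_cast (by omega : q ≠ 0)
  set C := A.natAbs with hC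
  refine ⟨D * q ^ (C + (k₁ + 1)), Nat.mul_pos hD0 (pow_pos hq _), fun x hx => ?_⟩
  -- multiplying by further powers of `q` keeps integrality
  have lift : ∀ (k : ℕ) (a : ℤ) (z : ℝ), (D : ℝ) * q ^ k * z = a → k ≤ C + (k₁ + 1) →
      ∃ b : ℤ, ((D * q ^ (C + (k₁ + 1)) : ℕ) : ℝ) * z = b := by
    intro k a z hz hk
    obtain ⟨t, ht⟩ := Nat.exists_eq_add_of_le hk
    refine ⟨q ^ t * a, ?_⟩
    rw [ht, pow_add]; push_cast
    rw [← hz]; ring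
  by_cases hx0 : x = x₀
  · exact ⟨0, by simp [hx0]⟩
  by_cases hx1 : x = x₁
  · subst hx1
    exact lift (k₁ + 1) A _ (by rw [e₁, hA]; push_cast; ring) (by omega)
  obtain ⟨k, a, ha, e, -⟩ := exists_level_of_twoIp_eq_zero hp hq hqp hN hL hm
    (horth x hx x₀ hx₀ hx0)
  obtain ⟨k', a', ha', e', -⟩ := exists_level_of_twoIp_eq_zero hp hq hqp hN hL hm
    (horth x hx x₁ hx₁ hx1)
  rw [← hD] at e e'
  -- Subtracting the two level equations shows that `p ^ (min k k' + 1)` divides the fixed nonzero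
  -- integer `A`, as `p` is prime to `q`. So `x` has bounded level relative to `x₀` or to `x₁`, and
  -- the powers of `q` in denominators are bounded.
  have hmin : min k k' + 1 ≤ C := by
    have hid : (q : ℤ) ^ (k + 1) * q ^ (k' + 1) * A =
        q ^ (k₁ + 1) * (p ^ (k + 1) * (a * q ^ (k' + 1)) - p ^ (k' + 1) * (a' * q ^ (k + 1))) := by
      have : (q : ℝ) ^ (k + 1) * q ^ (k' + 1) * (p ^ (k₁ + 1) * a₁) =
        q ^ (k₁ + 1) * (p ^ (k + 1) * (a * q ^ (k' + 1)) -
          p ^ (k' + 1) * (a' * q ^ (k + 1))) := by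
        rw [← e₁]
        linear_combination (q : ℝ) ^ (k₁ + 1) * q ^ (k' + 1) * e -
          (q : ℝ) ^ (k₁ + 1) * q ^ (k + 1) * e'
      rw [hA]
      exact_mod_cast this
    have hdvd : (p : ℤ) ^ (min k k' + 1) ∣ (q : ℤ) ^ (k + 1) * q ^ (k' + 1) * A := by
      rw [hid]
      refine Dvd.dvd.mul_left (dvd_sub (Dvd.dvd.mul_right (pow_dvd_pow _ (by omega)) _)
        (Dvd.dvd.mul_right (pow_dvd_pow _ (by omega)) _)) _
    have hcop : IsCoprime ((p : ℤ) ^ (min k k' + 1)) ((q : ℤ) ^ (k + 1) * q ^ (k' + 1)) := by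
      rw [← pow_add]
      exact (Nat.isCoprime_iff_coprime.2 hpq).pow
    have h1 := Int.natAbs_dvd_natAbs.2 (hcop.dvd_of_dvd_mul_left hdvd)
    rw [Int.natAbs_pow, Int.natAbs_natCast] at h1
    have h2 := Nat.le_of_dvd (Int.natAbs_pos.2 hA0) h1
    exact ((Nat.lt_pow_self (by omega : 1 < p)).le).trans h2
  rcases le_total k k' with hkk | hkk
  · rw [min_eq_left hkk] at hmin
    exact lift (k + 1) (p ^ (k + 1) * a) _ (by rw [e]; push_cast; ring) (by omega)
  · rw [min_eq_right hkk] at hmin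
    obtain ⟨b, hb⟩ := lift (k' + 1) (p ^ (k' + 1) * a') _ (by rw [e']; push_cast; ring) (by omega)
    obtain ⟨b', hb'⟩ := lift (k₁ + 1) A _ (by rw [e₁, hA]; push_cast; ring) (by omega)
    refine ⟨b + b', ?_⟩
    push_cast at hb hb' ⊢
    rw [← hb, ← hb']; ring

/-- In an orthogonal set, differences of level `k` are of size at least a multiple of `p ^ k`. -/
lemma exists_level_bound (hpq : Nat.Coprime p q) (hp : 2 ≤ p) (hq : 1 ≤ q) (hqp : q < p)
    (hN : 1 ≤ N) (hL : 1 ≤ L) (hm : 0 < m)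
    (horth : ∀ x ∈ Λ, ∀ y ∈ Λ, x ≠ y → twoIp (q / p : ℝ) N 1 L m (x - y) = 0)
    {x₀ : ℝ} (hx₀ : x₀ ∈ Λ) :
    ∃ c : ℝ, 0 < c ∧ ∀ n : ℕ, ∀ x ∈ Λ, ∀ y ∈ Λ, x ≠ y → |x - x₀| < c * p ^ (n + 1) →
      |y - x₀| < c * p ^ (n + 1) → finIp (q / p : ℝ) N L m n (x - y) = 0 := by
  obtain ⟨K, hK, hint⟩ := exists_common_denominator hpq hp hq hqp hN hL hm horth hx₀
  set D : ℕ := N * m * L with hD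
  have hD0 : 0 < D := Nat.mul_pos (Nat.mul_pos hN hm) hL
  have hD0r : (0 : ℝ) < D := by exact_mod_cast hD0
  have hK0r : (0 : ℝ) < K := by exact_mod_cast hK
  -- A difference of level `k + 1` satisfies `p ^ (k + 1) ≤ D K |x - y|`; the factor 2 pays for the
  -- triangle inequality through `x₀`.
  refine ⟨1 / (2 * (D * K)), by positivity, fun n x hx y hy hxy hxn hyn => ?_⟩
  obtain ⟨k, a, ha, e, hlev⟩ := exists_level_of_twoIp_eq_zero hp hq hqp hN hL hm
    (horth x hx y hy hxy)
  rw [← hD] at e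
  refine hlev n ?_
  obtain ⟨b, hb⟩ := hint x hx
  obtain ⟨b', hb'⟩ := hint y hy
  have hz : (K : ℝ) * (x - y) = (b - b' : ℤ) := by
    push_cast; rw [← hb, ← hb']; ring
  have hb0 : b - b' ≠ 0 := by
    intro h
    rw [h, Int.cast_zero] at hz
    exact hxy (sub_eq_zero.1 ((mul_eq_zero.1 hz).resolve_left hK0r.ne'))
  have hid : (q : ℤ) ^ (k + 1) * (D * (b - b')) = p ^ (k + 1) * (K * a) := by
    have : (q : ℝ) ^ (k + 1) * (D * ((b - b' : ℤ) : ℝ)) = p ^ (k + 1) * (K * a) := by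
      rw [← hz]; linear_combination (K : ℝ) * e
    exact_mod_cast this
  have hdvd : (p : ℤ) ^ (k + 1) ∣ D * (b - b') :=
    ((Nat.isCoprime_iff_coprime.2 hpq).pow).dvd_of_dvd_mul_left ⟨_, hid⟩
  have hDb : (D : ℤ) * (b - b') ≠ 0 := mul_ne_zero (by exact_mod_cast hD0.ne') hb0
  have hle := Int.le_of_dvd (abs_pos.2 hDb) ((dvd_abs _ _).2 hdvd)
  have hle' : (p : ℝ) ^ (k + 1) ≤ |D * (K * (x - y))| := by
    rw [hz]; exact_mod_cast hle
  rw [abs_mul, abs_mul, Nat.abs_cast, Nat.abs_cast] at hle'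
  have htri : |x - y| < 2 * (1 / (2 * (D * K)) * p ^ (n + 1)) := by
    have : |x - y| ≤ |x - x₀| + |y - x₀| := by
      rw [show x - y = (x - x₀) - (y - x₀) by ring]
      exact abs_sub _ _
    linarith
  have hlt : (p : ℝ) ^ (k + 1) < p ^ (n + 1) := by
    refine hle'.trans_lt ?_
    calc (D : ℝ) * (K * |x - y|) < D * (K * (2 * (1 / (2 * (D * K)) * p ^ (n + 1)))) := by gcongr
      _ = p ^ (n + 1) := by field_simp
  have := (pow_lt_pow_iff_right₀ (by exact_mod_cast (by omega : 1 < p) : (1 : ℝ) < p)).1 hlt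
  omega

end

/-- If the frequencies in `B \ A` are damped by `g`, the defect in Parseval's identity decreases
slowly when passing from `A` to `B`. -/
lemma parseval_defect_step {f F g : ℝ → ℂ} (hF : PDFun F) {A B : Set ℝ} (hAB : A ⊆ B)
    (horth : ∀ x ∈ B, ∀ y ∈ B, x ≠ y → F (x - y) = 0) {ξ e : ℝ} (he0 : 0 ≤ e)
    (hfac : ∀ x, f x = F x * g x) (hg : ∀ x, ‖g x‖ ≤ 1)
    (hsmall : ∀ x ∈ B, x ∉ A → ‖g (ξ - x)‖ ^ 2 ≤ e) :
    (1 - e) * (1 - (∑' x : A, esq f (ξ - x)).toReal) ≤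
      1 - (∑' x : B, esq f (ξ - x)).toReal := by
  have hfe : ∀ x, esq f x = esq F x * esq g x := by
    intro x
    rw [← esq_mul, show f = fun y => F y * g y from funext hfac]
  have hg1 : ∀ x, esq g x ≤ 1 := fun x => by
    rw [esq, ENNReal.ofReal_le_one]
    exact pow_le_one₀ (norm_nonneg _) (hg x)
  have hfF : ∀ x, esq f x ≤ esq F x := fun x => by
    rw [hfe]; exact mul_le_of_le_one_right zero_le (hg1 x)
  have hB1 : ∑' x : B, esq F (ξ - x) ≤ 1 :=
    hF.tsum_esq_le_one (fun x : B => (x : ℝ))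
      (fun x y hxy => horth x x.2 y y.2 fun h => hxy (Subtype.ext h)) ξ
  have hsplit : ∀ G : ℝ → ENNReal, ∑' x : B, G x = ∑' x : A, G x + ∑' x : (B \ A : Set ℝ), G x := by
    intro G
    have := ENNReal.summable.tsum_union_disjoint (f := G) (s := A) (t := B \ A)
      Set.disjoint_sdiff_right ENNReal.summable
    rw [← this, Set.union_sdiff_cancel hAB]
  rw [hsplit fun x => esq f (ξ - x)]
  rw [hsplit fun x => esq F (ξ - x)] at hB1
  set a := ∑' x : A, esq f (ξ - x) with ha
  set b := ∑' x : (B \ A : Set ℝ), esq F (ξ - x) with hb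
  set a' := ∑' x : (B \ A : Set ℝ), esq f (ξ - x) with ha'
  have h1 : a + b ≤ 1 := le_trans (by
    gcongr; exact ENNReal.tsum_le_tsum fun x => hfF _) hB1
  have h2 : a' ≤ ENNReal.ofReal e * b := by
    rw [hb, ← ENNReal.tsum_mul_left]
    refine ENNReal.tsum_le_tsum fun x => ?_
    rw [hfe, mul_comm]
    gcongr
    exact ENNReal.ofReal_le_ofReal (hsmall x x.2.1 x.2.2)
  have hat : a ≠ ⊤ := ne_top_of_le_ne_top ENNReal.one_ne_top (le_self_add.trans h1)
  have hbt : b ≠ ⊤ := ne_top_of_le_ne_top ENNReal.one_ne_top (le_add_self.trans h1)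
  have ha't : a' ≠ ⊤ := ne_top_of_le_ne_top (ENNReal.mul_ne_top ENNReal.ofReal_ne_top hbt) h2
  rw [ENNReal.toReal_add hat ha't]
  have h1r : a.toReal + b.toReal ≤ 1 := by
    rw [← ENNReal.toReal_add hat hbt, ← ENNReal.toReal_one]
    exact ENNReal.toReal_mono ENNReal.one_ne_top h1
  have h2r : a'.toReal ≤ e * b.toReal := by
    have := ENNReal.toReal_mono (ENNReal.mul_ne_top ENNReal.ofReal_ne_top hbt) h2
    rwa [ENNReal.toReal_mul, ENNReal.toReal_ofReal he0] at this
  -- The defect is `1 - a - a' ≥ 1 - a - e b ≥ (1 - e) (1 - a)`.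
  nlinarith

lemma iterate_add_div_ge (T n i : ℕ) :
    n + i * (n / T) ≤ (fun k : ℕ => k + k / T)^[i] n := by
  induction i with
  | zero => simp
  | succ i ih =>
    rw [Function.iterate_succ_apply']
    have h1 : n ≤ (fun k : ℕ => k + k / T)^[i] n := le_trans (Nat.le_add_right _ _) ih
    have h2 := Nat.div_le_div_right (c := T) h1
    rw [Nat.succ_mul]
    exact le_trans (by omega) (Nat.add_le_add ih h2)

/-- A sequence that decreases slowly along `n ↦ n + n / T` stays above half of its initial
value infinitely often. -/
lemma exists_half_le_of_slow_decrease {b : ℕ → ℝ} (hb0 : ∀ n, 0 ≤ b n) {c₀ : ℝ} (hc0 : 0 < c₀)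
    (hc1 : c₀ < 1) {T n₀ j₀ M : ℕ} (hT : 1 ≤ T) (hTn : T ≤ n₀) (hM : M = 2 * T * T)
    (hj₀ : M * c₀ ^ j₀ / (1 - c₀) ≤ 1 / 2)
    (hstep : ∀ j n, n₀ * (T + 1) ^ j ≤ n → (1 - c₀ ^ (j₀ + j)) * b n ≤ b (n + n / T)) (J : ℕ) :
    ∃ n, J ≤ n ∧ b n₀ / 2 ≤ b n := by
  set F : ℕ → ℕ := fun k => k + k / T with hF
  have hsteps : ∀ j n, n₀ * (T + 1) ^ j ≤ n → ∀ i, (1 - c₀ ^ (j₀ + j)) ^ i * b n ≤ b (F^[i] n) := by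
    intro j n hn i
    have he : 0 ≤ 1 - c₀ ^ (j₀ + j) := by
      linarith [pow_le_one₀ hc0.le hc1.le (n := j₀ + j)]
    induction i with
    | zero => simp
    | succ i ih =>
      rw [Function.iterate_succ_apply', pow_succ', mul_assoc]
      refine (mul_le_mul_of_nonneg_left ih he).trans (hstep j _ (hn.trans ?_))
      exact le_trans (Nat.le_add_right _ _) (iterate_add_div_ge T n i)
  -- One block consists of `M = 2 T²` steps. From any `n ≥ T` it multiplies `n` by at least `T + 1`,
  -- because `n ≤ 2 T (n / T)`.
  set seq : ℕ → ℕ := fun j => (F^[M])^[j] n₀ with hseq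
  have hseq_ge : ∀ j, n₀ * (T + 1) ^ j ≤ seq j := by
    intro j
    induction j with
    | zero => simp [hseq]
    | succ j ih =>
      have e1 : seq (j + 1) = F^[M] (seq j) := Function.iterate_succ_apply' _ _ _
      have e2 : (T + 1) * seq j ≤ F^[M] (seq j) := by
        refine le_trans ?_ (iterate_add_div_ge T (seq j) M)
        have e3 : T ≤ seq j := by
          refine le_trans ?_ ih
          exact hTn.trans (Nat.le_mul_of_pos_right _ (by positivity))
        have e4 : 1 ≤ seq j / T := (Nat.one_le_div_iff (by omega)).2 e3
        have e5 : seq j < T * (seq j / T) + T := by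
          have := Nat.div_add_mod (seq j) T
          have := Nat.mod_lt (seq j) (by omega : 0 < T)
          omega
        have e6 : seq j ≤ 2 * T * (seq j / T) := by nlinarith
        rw [hM]
        nlinarith [Nat.mul_le_mul_left T e6]
      rw [e1, pow_succ]
      refine le_trans ?_ e2
      nlinarith
  -- Bernoulli bounds the relative loss in block `j` by `M c₀ ^ (j₀ + j)`; these losses form a
  -- geometric series of sum at most 1/2.
  have hlower : ∀ J, (1 - ∑ j ∈ Finset.range J, M * c₀ ^ (j₀ + j)) * b n₀ ≤ b (seq J) := by
    intro J
    induction J with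
    | zero => simp [hseq]
    | succ J ih =>
      have e1 : seq (J + 1) = F^[M] (seq J) := Function.iterate_succ_apply' _ _ _
      have e2 := hsteps J (seq J) (hseq_ge J) M
      have hle1 : c₀ ^ (j₀ + J) ≤ 1 := pow_le_one₀ hc0.le hc1.le
      have e3 : 1 - M * c₀ ^ (j₀ + J) ≤ (1 - c₀ ^ (j₀ + J)) ^ M := by
        have := one_add_mul_le_pow (a := -c₀ ^ (j₀ + J)) (by linarith) M
        calc 1 - M * c₀ ^ (j₀ + J) = 1 + M * -c₀ ^ (j₀ + J) := by ring
          _ ≤ _ := this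
      rw [e1, Finset.sum_range_succ]
      refine le_trans ?_ e2
      refine le_trans ?_ (mul_le_mul_of_nonneg_right e3 (hb0 _))
      set s := ∑ j ∈ Finset.range J, (M : ℝ) * c₀ ^ (j₀ + j) with hs
      have hs0 : 0 ≤ s := Finset.sum_nonneg fun j _ => by positivity
      have ht0 : 0 ≤ (M : ℝ) * c₀ ^ (j₀ + J) := by positivity
      have ht1 : (M : ℝ) * c₀ ^ (j₀ + J) ≤ 1 := by
        have e4 : (M : ℝ) * c₀ ^ j₀ ≤ 1 / 2 * (1 - c₀) := (div_le_iff₀ (by linarith)).1 hj₀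
        have e5 : c₀ ^ (j₀ + J) ≤ c₀ ^ j₀ := pow_le_pow_of_le_one hc0.le hc1.le (by omega)
        have : (M : ℝ) * c₀ ^ (j₀ + J) ≤ M * c₀ ^ j₀ := by gcongr
        linarith
      have e6 := mul_le_mul_of_nonneg_left ih (by linarith : 0 ≤ 1 - (M : ℝ) * c₀ ^ (j₀ + J))
      refine le_trans ?_ e6
      have := hb0 n₀
      nlinarith [mul_nonneg (mul_nonneg hs0 ht0) this]
  have hhalf : ∀ J, b n₀ / 2 ≤ b (seq J) := by
    intro J
    have hsum : ∑ j ∈ Finset.range J, (M : ℝ) * c₀ ^ (j₀ + j) ≤ 1 / 2 := by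
      have e1 : ∑ j ∈ Finset.range J, (M : ℝ) * c₀ ^ (j₀ + j) =
          M * c₀ ^ j₀ * ∑ j ∈ Finset.range J, c₀ ^ j := by
        rw [Finset.mul_sum]
        exact Finset.sum_congr rfl fun j _ => by rw [pow_add]; ring
      have e2 : ∑ j ∈ Finset.range J, c₀ ^ j ≤ (1 - c₀)⁻¹ := by
        rw [← tsum_geometric_of_lt_one hc0.le hc1]
        exact (summable_geometric_of_lt_one hc0.le hc1).sum_le_tsum _ fun j _ => by positivity
      rw [e1]
      refine le_trans ?_ hj₀
      rw [div_eq_mul_inv]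
      gcongr
    have := hlower J
    nlinarith [hb0 n₀]
  refine ⟨seq J, le_trans ?_ (hseq_ge J), hhalf J⟩
  have e2 : J < (T + 1) ^ J := Nat.lt_pow_self (by omega)
  have e3 : 1 ≤ n₀ := hT.trans hTn
  nlinarith

set_option maxHeartbeats 1000000 in
/-- A spectral two-factor product with rational inverse ratio `p / q` in lowest terms has
`q = 1`. -/
lemma IsSpec.denominator_eq_one {N L m : ℕ} {p q : ℕ} {Λ : Set ℝ} (hpq : Nat.Coprime p q)
    (hp : 2 ≤ p) (hq : 1 ≤ q) (hqp : q < p) (hN : 2 ≤ N) (hL : 2 ≤ L) (hm : 0 < m)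
    (h : IsSpec Λ (twoIp (q / p : ℝ) N 1 L m)) : q = 1 := by
  by_contra hq1
  have hq2 : 2 ≤ q := by omega
  have hp0 : (0 : ℝ) < p := by exact_mod_cast (by omega : 0 < p)
  have hp2 : (2 : ℝ) ≤ p := by exact_mod_cast hp
  have hq0 : (2 : ℝ) ≤ q := by exact_mod_cast hq2
  have hm0 : (m : ℝ) ≠ 0 := by exact_mod_cast hm.ne'
  have h0 : (0 : ℝ) < q / p := by positivity
  have h1 : (q / p : ℝ) < 1 := by rw [div_lt_one hp0]; exact_mod_cast hqp
  set f := twoIp (q / p : ℝ) N 1 L m with hf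
  have hfp : PDFun f := pdFun_twoIp h0 h1 (by omega) (by omega) one_ne_zero hm0
  obtain ⟨x₀, hx₀⟩ := h.nonempty
  obtain ⟨c, hc, hlev⟩ := exists_level_bound hpq hp hq hqp (by omega) (by omega) hm h.orth hx₀
  -- constants
  set T := p with hT
  have hpT : p ≤ q ^ T := (Nat.lt_pow_self (by omega : 1 < q)).le
  obtain ⟨c₀, W, hc0, hc1, hdec⟩ := exists_decay (N := N) (L := L) hpq hp hq2 hqp hN (by omega)
    (m : ℝ) (T := T) (by omega) hpT
  -- The exponent `V` absorbs the constant `c`, since `c * q ^ V ≥ 1`.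
  obtain ⟨V, hV⟩ := pow_unbounded_of_one_lt c⁻¹ (by linarith : (1 : ℝ) < q)
  set M : ℕ := 2 * T * T with hM
  obtain ⟨j₀, hj₀⟩ : ∃ j₀ : ℕ, M * c₀ ^ j₀ / (1 - c₀) ≤ 1 / 2 := by
    have h2 : Tendsto (fun j : ℕ => M * c₀ ^ j / (1 - c₀)) atTop (𝓝 (M * 0 / (1 - c₀))) :=
      ((tendsto_pow_atTop_nhds_zero_of_lt_one hc0.le hc1).const_mul _).div_const _
    rw [mul_zero, zero_div] at h2
    exact (h2.eventually (eventually_le_nhds (by norm_num : (0 : ℝ) < 1 / 2))).exists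
  -- Chosen so that `n ≥ n₀ (T + 1)^j` implies `n / T ≥ V + W (T + 1)^(j₀ + j)`, the threshold for
  -- decay by `c₀ ^ (j₀ + j)`.
  set n₀ : ℕ := T * ((V + W + 1) * (T + 1) ^ j₀) with hn₀
  have hTn : T ≤ n₀ := Nat.le_mul_of_pos_right _ (by positivity)
  set near : ℕ → Set ℝ := fun n => {x ∈ Λ | |x - x₀| < c * p ^ (n + 1)} with hnear
  have hnear_mono : ∀ {n n'}, n ≤ n' → near n ⊆ near n' := by
    intro n n' hnn x hx
    refine ⟨hx.1, hx.2.trans_le ?_⟩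
    gcongr
    linarith
  have hx₀near : ∀ n, x₀ ∈ near n := fun n => ⟨hx₀, by simp; positivity⟩
  have hnear_orth : ∀ n, ∀ x ∈ near n, ∀ y ∈ near n, x ≠ y →
      finIp (q / p : ℝ) N L m n (x - y) = 0 :=
    fun n x hx y hy hxy => hlev n x hx.1 y hy.1 hxy hx.2 hy.2
  have hFp : ∀ n, PDFun (finIp (q / p : ℝ) N L m n) :=
    fun n => pdFun_finIp h0 (by omega) (by omega) hm0 n
  have hfac : ∀ n x, f x = finIp (q / p : ℝ) N L m n x * f ((q / p : ℝ) ^ n * x) :=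
    fun n x => twoIp_eq_finIp_mul h0 h1 (by omega) (by omega) m n x
  -- a generic point close to `x₀`
  obtain ⟨S, hS, hcomp⟩ := h.complete
  -- The excluded points are those where Parseval may fail, or where `finIp` at level `n₀` vanishes
  -- or the remaining tail could be unimodular; the last two make the initial defect strictly
  -- positive.
  have hbad : (S ∪ (fun z => x₀ + z) '' ({z | finIp (q / p : ℝ) N L m n₀ z = 0} ∪
      Set.range fun a : ℤ => (a : ℝ) / ((q / p : ℝ) ^ (n₀ + 1)))).Countable :=
    hS.union (((hFp n₀).zeros.union (Set.countable_range _)).image _)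
  obtain ⟨ξ, hξball, hξ⟩ := (hbad.dense_compl ℝ).inter_open_nonempty (Metric.ball x₀ c)
    Metric.isOpen_ball ⟨x₀, Metric.mem_ball_self hc⟩
  rw [Metric.mem_ball, Real.dist_eq] at hξball
  set b : ℕ → ℝ := fun n => 1 - (∑' x : near n, esq f (ξ - x)).toReal with hb
  -- one step
  have hfar : ∀ n x, x ∈ Λ → x ∉ near n →
      c * q ^ (n / T) ≤ |(q / p : ℝ) ^ (n + n / T) * (ξ - x)| := by
    intro n x hx hxn
    have hx1 : c * p ^ (n + 1) ≤ |x - x₀| := by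
      by_contra! hlt
      exact hxn ⟨hx, hlt⟩
    have hx2 : c * p ^ n ≤ |ξ - x| := by
      have htri : |x - x₀| ≤ |ξ - x| + |ξ - x₀| := by
        rw [show x - x₀ = (ξ - x₀) - (ξ - x) by ring, add_comm]
        exact abs_sub _ _
      have hpn : (1 : ℝ) ≤ p ^ n := one_le_pow₀ (by linarith)
      have : c * p ^ (n + 1) ≥ c * p ^ n + c := by
        rw [pow_succ]; nlinarith [mul_le_mul_of_nonneg_left hpn hc.le]
      linarith
    rw [abs_mul, abs_of_pos (pow_pos h0 _)]
    -- Scaling by `n / T` further levels is affordable because `p ≤ q ^ T` gives `p ^ (n / T) ≤ q ^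
    -- n`.
    have hpow : (q : ℝ) ^ (n / T) * p ^ (n + n / T) ≤ q ^ (n + n / T) * p ^ n := by
      have e1 : (p : ℝ) ^ (n / T) ≤ q ^ n := by
        calc (p : ℝ) ^ (n / T) ≤ ((q : ℝ) ^ T) ^ (n / T) := by
              gcongr; exact_mod_cast hpT
          _ = (q : ℝ) ^ (T * (n / T)) := by rw [pow_mul]
          _ ≤ q ^ n := pow_le_pow_right₀ (by linarith) (Nat.mul_div_le n T)
      rw [pow_add, pow_add]
      have e2 : (0 : ℝ) ≤ q ^ (n / T) * p ^ n := by positivity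
      nlinarith [mul_le_mul_of_nonneg_left e1 e2]
    calc c * (q : ℝ) ^ (n / T) ≤ (q / p : ℝ) ^ (n + n / T) * (c * p ^ n) := by
          rw [div_pow, div_mul_eq_mul_div, le_div_iff₀ (by positivity)]
          nlinarith [mul_le_mul_of_nonneg_left hpow hc.le]
      _ ≤ _ := by gcongr
  -- Frequencies entering between `near n` and `near (n + n / T)` are far from `ξ`, so the tail
  -- beyond level `n + n / T` damps them by `c₀ ^ (j₀ + j)`.
  have hstep : ∀ j n, n₀ * (T + 1) ^ j ≤ n →
      (1 - c₀ ^ (j₀ + j)) * b n ≤ b (n + n / T) := by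
    intro j n hn
    refine parseval_defect_step (F := finIp (q / p : ℝ) N L m (n + n / T))
      (g := fun x => f ((q / p : ℝ) ^ (n + n / T) * x)) (hFp _) (hnear_mono (Nat.le_add_right _ _))
      (hnear_orth _) (by positivity) (hfac _) (fun x => hfp.norm_le_one _) fun x hx hxn => ?_
    have hnT : V + W * (T + 1) ^ (j₀ + j) ≤ n / T := by
      rw [Nat.le_div_iff_mul_le (by omega)]
      refine le_trans ?_ hn
      rw [hn₀, pow_add]
      have e1 : 1 ≤ (T + 1) ^ j₀ * (T + 1) ^ j := Nat.mul_pos (by positivity) (by positivity)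
      calc (V + W * ((T + 1) ^ j₀ * (T + 1) ^ j)) * T
          ≤ (V * ((T + 1) ^ j₀ * (T + 1) ^ j) + W * ((T + 1) ^ j₀ * (T + 1) ^ j) +
            (T + 1) ^ j₀ * (T + 1) ^ j) * T := by
            refine Nat.mul_le_mul_right T ?_
            exact (Nat.add_le_add_right (Nat.le_mul_of_pos_right _ e1) _).trans
              (Nat.le_add_right _ _)
        _ = T * ((V + W + 1) * (T + 1) ^ j₀) * (T + 1) ^ j := by ring
    have hnorm : ‖f ((q / p : ℝ) ^ (n + n / T) * (ξ - x))‖ ≤ c₀ ^ (j₀ + j) := by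
      refine hdec _ _ (le_trans ?_ (hfar n x hx.1 hxn))
      have e1 : 1 ≤ c * (q : ℝ) ^ V := by
        rw [← mul_inv_cancel₀ hc.ne']; gcongr
      calc (q : ℝ) ^ (W * (T + 1) ^ (j₀ + j))
          ≤ (c * q ^ V) * q ^ (W * (T + 1) ^ (j₀ + j)) := le_mul_of_one_le_left (by positivity) e1
        _ = c * q ^ (V + W * (T + 1) ^ (j₀ + j)) := by rw [pow_add]; ring
        _ ≤ c * q ^ (n / T) := by
            gcongr
            linarith
    have hle1 : c₀ ^ (j₀ + j) ≤ 1 := pow_le_one₀ hc0.le hc1.le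
    calc ‖f ((q / p : ℝ) ^ (n + n / T) * (ξ - x))‖ ^ 2 ≤ (c₀ ^ (j₀ + j)) ^ 2 := by gcongr
      _ ≤ c₀ ^ (j₀ + j) := pow_le_of_le_one (by positivity) hle1 two_ne_zero
  have hb0 : ∀ n, 0 ≤ b n := by
    intro n
    have : ∑' x : near n, esq f (ξ - x) ≤ 1 := by
      refine hfp.tsum_esq_le_one (fun x : near n => (x : ℝ)) (fun x y hxy => ?_) ξ
      exact h.orth x x.2.1 y y.2.1 fun h => hxy (Subtype.ext h)
    have := ENNReal.toReal_mono ENNReal.one_ne_top this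
    rw [ENNReal.toReal_one] at this
    have e : b n = 1 - (∑' x : near n, esq f (ξ - x)).toReal := rfl
    linarith
  -- the defect is positive at the start
  have hpos : 0 < b n₀ := by
    have hlt : ∑' x : near n₀, esq f (ξ - x) < 1 := by
      have hB1 : ∑' x : near n₀, esq (finIp (q / p : ℝ) N L m n₀) (ξ - x) ≤ 1 :=
        (hFp n₀).tsum_esq_le_one (fun x : near n₀ => (x : ℝ))
          (fun x y hxy => hnear_orth n₀ x x.2 y y.2 fun h => hxy (Subtype.ext h)) ξ
      have hfe : ∀ x, esq f x = esq (finIp (q / p : ℝ) N L m n₀) x *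
          esq (fun y => f ((q / p : ℝ) ^ n₀ * y)) x := by
        intro x
        rw [← esq_mul, ← show f = fun y => _ from funext (hfac n₀)]
      have hle : ∀ x, esq f x ≤ esq (finIp (q / p : ℝ) N L m n₀) x := by
        intro x
        rw [hfe]
        refine mul_le_of_le_one_right zero_le ?_
        rw [esq, ENNReal.ofReal_le_one]
        exact pow_le_one₀ (norm_nonneg _) (hfp.norm_le_one _)
      refine lt_of_lt_of_le (ENNReal.tsum_lt_tsum (ne_top_of_le_ne_top ENNReal.one_ne_top
        ((ENNReal.tsum_le_tsum fun x => hle _).trans hB1)) (fun x => hle _)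
        (i := ⟨x₀, hx₀near n₀⟩) ?_) hB1
      rw [hfe]
      have hne : finIp (q / p : ℝ) N L m n₀ (ξ - x₀) ≠ 0 := fun hz =>
        hξ (Or.inr ⟨ξ - x₀, Or.inl hz, by ring⟩)
      refine ENNReal.mul_lt_of_lt_div' ?_
      rw [ENNReal.div_self (esq_ne_zero hne) (esq_ne_top _ _), esq, ENNReal.ofReal_lt_one]
      refine pow_lt_one₀ (norm_nonneg _) (lt_of_le_of_ne (hfp.norm_le_one _) fun h1' => ?_)
        two_ne_zero
      have e1 : ‖f ((q / p : ℝ) ^ n₀ * (ξ - x₀))‖ ≤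
          ‖mask N ((q / p : ℝ) ^ (0 + 1) * ((q / p : ℝ) ^ n₀ * (ξ - x₀)))‖ := by
        rw [hfac 1, norm_mul]
        exact (mul_le_of_le_one_right (norm_nonneg _) (hfp.norm_le_one _)).trans
          (norm_finIp_le 0 1 one_pos _ _)
      rw [h1'] at e1
      obtain ⟨a, ha⟩ := exists_int_of_norm_mask_eq_one hN
        (le_antisymm (norm_mask_le_one _ _) e1)
      refine hξ (Or.inr ⟨ξ - x₀, Or.inr ⟨a, ?_⟩, by ring⟩)
      simp only
      rw [← ha, ← mul_assoc, ← pow_add, add_comm n₀]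
      exact mul_div_cancel_left₀ _ (pow_pos h0 _).ne'
    have := (ENNReal.toReal_lt_toReal hlt.ne_top ENNReal.one_ne_top).2 hlt
    rw [ENNReal.toReal_one] at this
    have e : b n₀ = 1 - (∑' x : near n₀, esq f (ξ - x)).toReal := rfl
    linarith
  -- but it tends to zero
  have hone := hcomp ξ fun hS => hξ (Or.inl hS)
  rw [ENNReal.tsum_eq_iSup_sum] at hone
  have hlt : ENNReal.ofReal (1 - b n₀ / 2) < ⨆ s : Finset Λ, ∑ x ∈ s, esq f (ξ - x) := by
    rw [hone, ENNReal.ofReal_lt_one]; linarith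
  obtain ⟨s, hs⟩ := lt_iSup_iff.1 hlt
  obtain ⟨n', hJ, hge⟩ : ∃ n', (∀ x ∈ s, (x : ℝ) ∈ near n') ∧ b n₀ / 2 ≤ b n' := by
    obtain ⟨R, hR⟩ : ∃ R : ℝ, ∀ x ∈ s, |(x : ℝ) - x₀| ≤ R := by
      obtain ⟨R, hR⟩ := (s.image fun x : Λ => |(x : ℝ) - x₀|).bddAbove
      exact ⟨R, fun x hx => hR (Finset.mem_coe.2 (Finset.mem_image_of_mem _ hx))⟩
    obtain ⟨J, hJ⟩ := pow_unbounded_of_one_lt (R / c) (by linarith : (1 : ℝ) < p)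
    obtain ⟨n, e1, hn⟩ := exists_half_le_of_slow_decrease hb0 hc0 hc1 (by omega) hTn hM hj₀ hstep J
    refine ⟨n, fun x hx => ⟨x.2, (hR x hx).trans_lt ?_⟩, hn⟩
    calc R = c * (R / c) := by field_simp
      _ < c * p ^ J := by gcongr
      _ ≤ c * p ^ (n + 1) :=
          mul_le_mul_of_nonneg_left (pow_le_pow_right₀ (by linarith) (by omega)) hc.le
  have hfin : ∑ x ∈ s, esq f (ξ - x) ≤ ∑' x : near n', esq f (ξ - x) := by
    classical
    let e : s → near n' := fun x => ⟨x.1, hJ x.1 x.2⟩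
    have he : Function.Injective e := fun x y hxy => by
      have := congrArg (fun z : near n' => (z : ℝ)) hxy
      exact Subtype.ext (Subtype.ext this)
    rw [← Finset.sum_coe_sort s fun x : Λ => esq f (ξ - x), ← tsum_fintype (L := .unconditional _)]
    exact ENNReal.tsum_comp_le_tsum_of_injective he fun z => esq f (ξ - z)
  have hle1 : ∑' x : near n', esq f (ξ - x) ≠ ⊤ := by
    refine ne_top_of_le_ne_top ENNReal.one_ne_top (hfp.tsum_esq_le_one
      (fun x : near n' => (x : ℝ)) (fun x y hxy => ?_) ξ)
    exact h.orth x x.2.1 y y.2.1 fun h => hxy (Subtype.ext h)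
  have hcontr := ((ENNReal.ofReal_lt_iff_lt_toReal (by
    have : b n₀ ≤ 1 := by
      have e : b n₀ = 1 - (∑' x : near n₀, esq f (ξ - x)).toReal := rfl
      linarith [ENNReal.toReal_nonneg (a := ∑' x : near n₀, esq f (ξ - x))]
    linarith) hle1).1 (hs.trans_le hfin))
  have e : b n' = 1 - (∑' x : near n', esq f (ξ - x)).toReal := rfl
  linarith

/-! ### Integer spectra for refinement equations -/

/-- If the squared translates of `F` along a finite family add up to one, then the family is
injective. -/
lemma injOn_of_sum_norm_sq_eq_one {ι : Type*} {F : ℝ → ℂ} (h0 : F 0 = 1) {I : Finset ι}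
    {l : ι → ℝ} (h : ∀ ξ, ∑ i ∈ I, ‖F (ξ - l i)‖ ^ 2 = 1) : Set.InjOn l I := by
  classical
  intro i hi j hj hij
  by_contra hne
  have h1 := h (l i)
  have h2 : ∑ k ∈ ({i, j} : Finset ι), ‖F (l i - l k)‖ ^ 2 ≤ ∑ k ∈ I, ‖F (l i - l k)‖ ^ 2 :=
    Finset.sum_le_sum_of_subset_of_nonneg
      (Finset.insert_subset hi (Finset.singleton_subset_iff.2 hj)) fun _ _ _ => by positivity
  rw [h1, Finset.sum_pair hne, ← hij, sub_self, h0] at h2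
  norm_num at h2

/-- The data for building an integer spectrum of the solution `ν` of a refinement equation
`ν ξ = M (ξ / p) ν (ξ / p)` with a one-periodic mask `M`. -/
structure RefinementData (p : ℕ) (M ν : ℝ → ℂ) (S : Finset ℤ) : Prop where
  two_le : 2 ≤ p
  continuous : Continuous ν
  periodic : ∀ x (k : ℤ), M (x + k) = M x
  norm_mask_le : ∀ x, ‖M x‖ ≤ 1
  norm_le : ∀ x, ‖ν x‖ ≤ 1
  map_zero : ν 0 = 1
  refine : ∀ ξ, ν ξ = M (ξ / p) * ν (ξ / p)
  zero_mem : 0 ∈ S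
  sum_eq : ∀ ξ, ∑ s ∈ S, ‖M ((ξ - s) / p)‖ ^ 2 = 1

/-- The product of the first `n` factors `M (ξ / p ^ k)`. -/
noncomputable def partialMask (p : ℕ) (M : ℝ → ℂ) (n : ℕ) (ξ : ℝ) : ℂ :=
  ∏ k ∈ Finset.range n, M (ξ / p ^ (k + 1))

namespace RefinementData

variable {p : ℕ} {M ν : ℝ → ℂ} {S : Finset ℤ}

lemma mask_zero (h : RefinementData p M ν S) : M 0 = 1 := by
  have := h.refine 0
  rwa [zero_div, h.map_zero, mul_one, eq_comm] at this

lemma natCast_pos (h : RefinementData p M ν S) : (0 : ℝ) < p := by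
  exact_mod_cast (by have := h.two_le; omega : 0 < p)

lemma partialMask_succ (n : ℕ) (ξ : ℝ) :
    partialMask p M (n + 1) ξ = partialMask p M n ξ * M (ξ / p ^ (n + 1)) :=
  Finset.prod_range_succ _ _

lemma eq_partialMask_mul (h : RefinementData p M ν S) (n : ℕ) (ξ : ℝ) :
    ν ξ = partialMask p M n ξ * ν (ξ / p ^ n) := by
  induction n with
  | zero => simp [partialMask]
  | succ n ih =>
    rw [partialMask_succ, mul_assoc, ih, h.refine (ξ / p ^ n), div_div, ← pow_succ]

lemma partialMask_add (h : RefinementData p M ν S) (n : ℕ) (ξ : ℝ) (k : ℤ) :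
    partialMask p M n (ξ + p ^ n * k) = partialMask p M n ξ := by
  refine Finset.prod_congr rfl fun j hj => ?_
  have hp := h.natCast_pos
  obtain ⟨r, rfl⟩ := Nat.exists_eq_add_of_lt (Finset.mem_range.1 hj)
  have : (ξ + p ^ (j + r + 1) * k) / (p : ℝ) ^ (j + 1) =
      ξ / p ^ (j + 1) + ((p ^ r * k : ℤ) : ℝ) := by
    push_cast
    field_simp
    ring
  rw [this, h.periodic]

lemma partialMask_zero (h : RefinementData p M ν S) (n : ℕ) : partialMask p M n 0 = 1 := by
  simp [partialMask, h.mask_zero]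

/-- `A` is a spectrum of the `n`-th partial product. -/
def IsLevelSpec (p : ℕ) (M : ℝ → ℂ) (n : ℕ) (A : Finset ℤ) : Prop :=
  ∀ ξ : ℝ, ∑ a ∈ A, ‖partialMask p M n (ξ - a)‖ ^ 2 = 1

lemma isLevelSpec_zero : IsLevelSpec p M 0 {0} := by
  intro ξ
  simp [partialMask]

lemma isLevelSpec_image {ι : Type*} (h : RefinementData p M ν S) {n : ℕ}
    {I : Finset ι} {l : ι → ℤ}
    (hI : ∀ ξ : ℝ, ∑ i ∈ I, ‖partialMask p M n (ξ - l i)‖ ^ 2 = 1) :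
    IsLevelSpec p M n (I.image l) := by
  intro ξ
  have hinj : Set.InjOn l I := fun i hi j hj hij =>
    injOn_of_sum_norm_sq_eq_one (h.partialMask_zero n) (l := fun i => (l i : ℝ)) hI hi hj
      (by simp only [hij])
  rw [Finset.sum_image hinj, hI]

/-- Adding digits `p ^ n * s` does not change the first `n` factors, which are `p ^ n`-periodic, and
summing the new factor over `S` gives 1. The digit 0 keeps the old elements. -/
lemma IsLevelSpec.succ (h : RefinementData p M ν S) {n : ℕ} {A : Finset ℤ}
    (hA : IsLevelSpec p M n A) :
    ∃ B, A ⊆ B ∧ IsLevelSpec p M (n + 1) B := by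
  refine ⟨(A ×ˢ S).image fun x => x.1 + p ^ n * x.2, fun a ha => ?_,
    h.isLevelSpec_image fun ξ => ?_⟩
  · exact Finset.mem_image.2 ⟨(a, 0), Finset.mk_mem_product ha h.zero_mem, by simp⟩
  · rw [Finset.sum_product, ← hA ξ]
    refine Finset.sum_congr rfl fun a _ => ?_
    have hp := h.natCast_pos
    have h1 : ∀ s : ℤ, ‖partialMask p M (n + 1) (ξ - ((a + p ^ n * s : ℤ) : ℝ))‖ ^ 2 =
        ‖partialMask p M n (ξ - a)‖ ^ 2 * ‖M (((ξ - a) / p ^ n - s) / p)‖ ^ 2 := by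
      intro s
      rw [partialMask_succ, norm_mul, mul_pow]
      congr 3
      · rw [← h.partialMask_add n (ξ - a) (-s)]
        congr 1
        push_cast
        ring
      · congr 1
        push_cast
        field_simp
        ring
    rw [Finset.sum_congr rfl fun s _ => h1 s, ← Finset.mul_sum, h.sum_eq, mul_one]

lemma IsLevelSpec.add (h : RefinementData p M ν S) {n : ℕ} {A : Finset ℤ}
    (hA : IsLevelSpec p M n A) (r : ℕ) :
    ∃ B, A ⊆ B ∧ IsLevelSpec p M (n + r) B := by
  induction r with
  | zero => exact ⟨A, subset_rfl, hA⟩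
  | succ r ih =>
    obtain ⟨B, hAB, hB⟩ := ih
    obtain ⟨C, hBC, hC⟩ := hB.succ h
    exact ⟨C, hAB.trans hBC, hC⟩

/-- This freedom of representatives modulo `p ^ n` is used to keep the limiting transform away from
zero. -/
lemma IsLevelSpec.shift (h : RefinementData p M ν S) {n : ℕ} {A : Finset ℤ}
    (hA : IsLevelSpec p M n A) (k : ℤ → ℤ) :
    IsLevelSpec p M n (A.image fun a => a + p ^ n * k a) := by
  refine h.isLevelSpec_image fun ξ => ?_
  rw [← hA ξ]
  refine Finset.sum_congr rfl fun a _ => ?_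
  rw [← h.partialMask_add n (ξ - a) (-k a)]
  congr 3
  push_cast
  ring

/-- Some integer translate of every point is not a zero of `ν`. -/
lemma exists_int_ne_zero (h : RefinementData p M ν S)
    {K : ℕ} (hK : 0 < K) (hzero : ∀ x, ν x = 0 → ∃ a : ℤ, K * x = a)
    (hone : ∀ x, ‖M x‖ = 1 → ∃ a : ℤ, x = a) (x : ℝ) : ∃ k : ℤ, ν (x + k) ≠ 0 := by
  classical
  by_contra! hx
  have hp := h.natCast_pos
  have hK0 : (0 : ℝ) < K := by exact_mod_cast hK
  -- The points of `[0, 1)` all of whose integer translates are zeros of `ν`; zeros lie in `(1 / K)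
  -- ℤ`, so there are finitely many.
  set Z : Finset ℝ := ((Finset.range K).image fun a : ℕ => (a : ℝ) / K).filter
    fun x => ∀ k : ℤ, ν (x + k) = 0 with hZ
  have hmemZ : ∀ x, (∀ k : ℤ, ν (x + k) = 0) → Int.fract x ∈ Z := by
    intro x hx
    have hx' : ∀ k : ℤ, ν (Int.fract x + k) = 0 := by
      intro k
      have := hx (k - ⌊x⌋)
      rwa [Int.cast_sub, ← add_sub_assoc, add_sub_right_comm, Int.self_sub_floor] at this
    refine Finset.mem_filter.2 ⟨Finset.mem_image.2 ?_, hx'⟩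
    obtain ⟨a, ha⟩ := hzero _ (by simpa using hx' 0)
    have ha0 : 0 ≤ a := by
      have : (0 : ℝ) ≤ a := by rw [← ha]; exact mul_nonneg hK0.le (Int.fract_nonneg x)
      exact_mod_cast this
    have ha1 : a < K := by
      have : (a : ℝ) < K := by
        rw [← ha]; exact mul_lt_of_lt_one_right hK0 (Int.fract_lt_one x)
      exact_mod_cast this
    lift a to ℕ using ha0
    refine ⟨a, Finset.mem_range.2 (by exact_mod_cast ha1), ?_⟩
    rw [div_eq_iff hK0.ne', mul_comm]
    exact_mod_cast ha.symm
  have hZmem : ∀ z ∈ Z, (∀ k : ℤ, ν (z + k) = 0) ∧ 0 ≤ z ∧ z < 1 := by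
    intro z hz
    obtain ⟨h1, h2⟩ := Finset.mem_filter.1 hz
    obtain ⟨a, ha, rfl⟩ := Finset.mem_image.1 h1
    refine ⟨h2, by positivity, ?_⟩
    rw [div_lt_one hK0]
    exact_mod_cast Finset.mem_range.1 ha
  have hMfract : ∀ y, M (Int.fract y) = M y := by
    intro y
    rw [← h.periodic (Int.fract y) ⌊y⌋, Int.fract_add_floor]
  set g : ℝ × ℤ → ℝ := fun w => Int.fract ((w.1 - w.2) / p) with hg
  set P := (Z ×ˢ S).filter fun w => M (g w) ≠ 0 with hP
  -- By the refinement equation, a branch `(z - s) / p` with nonzero mask inherits the property of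
  -- `z`.
  have hmaps : ∀ w ∈ P, g w ∈ Z := by
    intro w hw
    obtain ⟨h1, h2⟩ := Finset.mem_filter.1 hw
    refine hmemZ _ fun k => ?_
    have h3 := (hZmem w.1 (Finset.mem_product.1 h1).1).1 (-w.2 + p * k)
    rw [h.refine] at h3
    have h4 : (w.1 + ((-w.2 + p * k : ℤ) : ℝ)) / p = (w.1 - w.2) / p + k := by
      push_cast
      field_simp
      ring
    rw [h4, h.periodic] at h3
    refine (mul_eq_zero.1 h3).resolve_left ?_
    rwa [← hMfract]
  -- Two elements of `S` congruent modulo `p` would both contribute 1 to the identity at `ξ = s`.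
  have hSinj : Set.InjOn (fun s : ℤ => (s : ZMod p)) S := by
    intro s hs t ht hst
    have hdvd : (p : ℤ) ∣ t - s := (ZMod.intCast_eq_intCast_iff_dvd_sub s t p).1 hst
    by_contra hne
    obtain ⟨c, hc⟩ := hdvd
    have h1 := h.sum_eq s
    have h2 : ∑ k ∈ ({s, t} : Finset ℤ), ‖M ((s - k) / p)‖ ^ 2 ≤
        ∑ k ∈ S, ‖M ((s - k) / p)‖ ^ 2 :=
      Finset.sum_le_sum_of_subset_of_nonneg
        (Finset.insert_subset hs (Finset.singleton_subset_iff.2 ht)) fun _ _ _ => by positivity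
    have h3 : ((s : ℝ) - t) / p = 0 + ((-c : ℤ) : ℝ) := by
      have : (t : ℝ) - s = p * c := by exact_mod_cast hc
      rw [div_eq_iff hp.ne']
      push_cast
      linarith
    rw [h1, Finset.sum_pair hne, sub_self, zero_div, h3, h.periodic, h.mask_zero] at h2
    norm_num at h2
  have hinj : Set.InjOn g P := by
    intro w hw v hv hwv
    have hw1 := Finset.mem_product.1 (Finset.mem_filter.1 hw).1
    have hv1 := Finset.mem_product.1 (Finset.mem_filter.1 hv).1
    obtain ⟨c, hc⟩ := Int.fract_eq_fract.1 hwv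
    have h1 : w.1 - v.1 = ((w.2 - v.2 + p * c : ℤ) : ℝ) := by
      push_cast
      field_simp at hc
      linarith
    have h2 := (hZmem _ hw1.1).2
    have h3 := (hZmem _ hv1.1).2
    have h4 : w.2 - v.2 + p * c = 0 := by
      have e1 : ((w.2 - v.2 + p * c : ℤ) : ℝ) < ((1 : ℤ) : ℝ) := by
        rw [← h1]; push_cast; linarith
      have e2 : ((-1 : ℤ) : ℝ) < ((w.2 - v.2 + p * c : ℤ) : ℝ) := by
        rw [← h1]; push_cast; linarith
      have e3 := Int.cast_lt.1 e1
      have e4 := Int.cast_lt.1 e2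
      omega
    refine Prod.ext ?_ (hSinj hw1.2 hv1.2 ?_)
    · rw [h4] at h1
      push_cast at h1
      linarith
    · exact (ZMod.intCast_eq_intCast_iff_dvd_sub _ _ p).2 ⟨c, by linarith⟩
  -- Branching is injective on the pairs with nonzero mask, so the total mass `Z.card` fits into a
  -- sum over `Z` of terms at most 1. All terms are then 1, which forces the points of `Z` to be
  -- integers and contradicts `ν 0 = 1`.
  have hcount : (Z.card : ℝ) ≤ ∑ z ∈ Z, ‖M z‖ ^ 2 := by
    calc (Z.card : ℝ) = ∑ z ∈ Z, ∑ s ∈ S, ‖M ((z - s) / p)‖ ^ 2 := by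
          simp [h.sum_eq]
      _ = ∑ w ∈ Z ×ˢ S, ‖M (g w)‖ ^ 2 := by
          rw [Finset.sum_product]
          simp only [hg, hMfract]
      _ = ∑ w ∈ P, ‖M (g w)‖ ^ 2 := by
          rw [hP, Finset.sum_filter]
          refine Finset.sum_congr rfl fun w _ => ?_
          split_ifs with hw
          · rfl
          · rw [not_not.1 hw]; simp
      _ = ∑ z ∈ P.image g, ‖M z‖ ^ 2 :=
          (Finset.sum_image (f := fun z => ‖M z‖ ^ 2) hinj).symm
      _ ≤ ∑ z ∈ Z, ‖M z‖ ^ 2 :=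
          Finset.sum_le_sum_of_subset_of_nonneg (Finset.image_subset_iff.2 hmaps)
            fun _ _ _ => by positivity
  have hx0 : Int.fract x ∈ Z := hmemZ x hx
  have hle : ∀ z ∈ Z, ‖M z‖ ^ 2 ≤ 1 := fun z _ => pow_le_one₀ (norm_nonneg _) (h.norm_mask_le z)
  have heq : ‖M (Int.fract x)‖ ^ 2 = 1 := by
    refine (Finset.sum_eq_sum_iff_of_le hle).1 (le_antisymm (Finset.sum_le_sum hle) ?_) _ hx0
    simpa using hcount
  obtain ⟨a, ha⟩ := hone _ ((pow_eq_one_iff_of_nonneg (norm_nonneg _) two_ne_zero).1 heq)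
  have := (hZmem _ hx0).1 (-a)
  rw [ha] at this
  simp [h.map_zero] at this

/-- A uniform version of `exists_int_ne_zero`. -/
lemma exists_uniform_bound (h : RefinementData p M ν S)
    (hz : ∀ x, ∃ k : ℤ, ν (x + k) ≠ 0) : ∃ ε > 0, ∃ δ > 0,
      (∀ x : ℝ, ∃ k : ℤ, ∀ y, |y| ≤ δ → ε ≤ ‖ν (y - (x + k))‖) ∧
      (∀ x y : ℝ, |x| ≤ δ → |y| ≤ δ → ε ≤ ‖ν (y - x)‖) := by
  have hloc : ∀ x, ν x ≠ 0 → ∃ ε > 0, ∃ δ > 0, ∀ y, |y - x| ≤ δ → ε ≤ ‖ν y‖ := by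
    intro x hx
    have hpos : 0 < ‖ν x‖ := norm_pos_iff.2 hx
    have h1 : ∀ᶠ y in 𝓝 x, ‖ν x‖ / 2 < ‖ν y‖ :=
      (h.continuous.norm.tendsto x).eventually (lt_mem_nhds (by linarith))
    obtain ⟨δ, hδ, hball⟩ := Metric.eventually_nhds_iff.1 h1
    refine ⟨‖ν x‖ / 2, by linarith, δ / 2, by linarith, fun y hy => (hball ?_).le⟩
    rw [Real.dist_eq]
    linarith
  have hcomp : ∃ ε > 0, ∃ δ > 0, ∀ x ∈ Set.Icc (0 : ℝ) 1, ∃ k : ℤ, ∀ y, |y| ≤ δ →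
      ε ≤ ‖ν (x + k + y)‖ := by
    refine isCompact_Icc.induction_on (p := fun s : Set ℝ => ∃ ε > 0, ∃ δ > 0, ∀ x ∈ s, ∃ k : ℤ,
      ∀ y, |y| ≤ δ → ε ≤ ‖ν (x + k + y)‖) ⟨1, one_pos, 1, one_pos, by simp⟩ ?_ ?_ ?_
    · rintro s t hst ⟨ε, hε, δ, hδ, H⟩
      exact ⟨ε, hε, δ, hδ, fun x hx => H x (hst hx)⟩
    · rintro s t ⟨ε, hε, δ, hδ, H⟩ ⟨ε', hε', δ', hδ', H'⟩
      refine ⟨min ε ε', lt_min hε hε', min δ δ', lt_min hδ hδ', ?_⟩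
      rintro x (hx | hx)
      · obtain ⟨k, hk⟩ := H x hx
        exact ⟨k, fun y hy => (min_le_left _ _).trans (hk y (hy.trans (min_le_left _ _)))⟩
      · obtain ⟨k, hk⟩ := H' x hx
        exact ⟨k, fun y hy => (min_le_right _ _).trans (hk y (hy.trans (min_le_right _ _)))⟩
    · intro x _
      obtain ⟨k, hk⟩ := hz x
      obtain ⟨ε, hε, δ, hδ, H⟩ := hloc _ hk
      refine ⟨Metric.ball x (δ / 2), mem_nhdsWithin_of_mem_nhds (Metric.ball_mem_nhds _
        (by linarith)), ε, hε, δ / 2, by linarith, fun z hz => ⟨k, fun y hy => H _ ?_⟩⟩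
      rw [Metric.mem_ball, Real.dist_eq] at hz
      calc |z + k + y - (x + k)| = |(z - x) + y| := by ring_nf
        _ ≤ |z - x| + |y| := abs_add_le _ _
        _ ≤ δ := by linarith
  obtain ⟨ε, hε, δ, hδ, H⟩ := hcomp
  obtain ⟨ε', hε', δ', hδ', H'⟩ := hloc 0 (by simp [h.map_zero])
  refine ⟨min ε ε', lt_min hε hε', min δ (δ' / 2), lt_min hδ (by linarith), fun x => ?_,
    fun x y hx hy => (min_le_right _ _).trans (H' _ ?_)⟩
  · obtain ⟨k, hk⟩ := H (Int.fract (-x)) ⟨Int.fract_nonneg _, (Int.fract_lt_one _).le⟩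
    refine ⟨⌊-x⌋ - k, fun y hy => (min_le_left _ _).trans ?_⟩
    have := hk y (hy.trans (min_le_left _ _))
    rwa [show Int.fract (-x) + k + y = y - (x + ((⌊-x⌋ - k : ℤ) : ℝ)) by
      rw [Int.fract]; push_cast; ring] at this
  · have hx' := hx.trans (min_le_right _ _)
    have hy' := hy.trans (min_le_right _ _)
    rw [sub_zero]
    calc |y - x| ≤ |y| + |x| := abs_sub _ _
      _ ≤ δ' := by linarith

/-- The solution of the refinement equation has a spectrum consisting of integers. -/
lemma exists_int_spectrum (h : RefinementData p M ν S)
    (hz : ∀ x, ∃ k : ℤ, ν (x + k) ≠ 0) :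
    ∃ Λ : Set ℤ, ∀ ξ : ℝ, ∑' a : Λ, esq ν (ξ - (a : ℤ)) = 1 := by
  classical
  have hp := h.natCast_pos
  have hp1 : (1 : ℝ) < p := by exact_mod_cast h.two_le
  obtain ⟨ε, hε, δ, hδ, hshift, hsmall⟩ := h.exists_uniform_bound hz
  -- The lower bound on `ν` at the scaled frequencies prevents mass from escaping to infinity in the
  -- limit.
  let good : ℕ × Finset ℤ → Prop := fun w => IsLevelSpec p M w.1 w.2 ∧
    ∀ a ∈ w.2, ∀ y, |y| ≤ δ → ε ≤ ‖ν (y - a / p ^ w.1)‖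
  have hext : ∀ w, good w → ∃ w', good w' ∧ w.1 < w'.1 ∧ w.2 ⊆ w'.2 := by
    rintro ⟨n, A⟩ ⟨hA, hAg⟩
    obtain ⟨R, hR⟩ : ∃ R : ℝ, ∀ a ∈ A, |(a : ℝ)| ≤ R := by
      obtain ⟨R, hR⟩ := (A.image fun a : ℤ => |(a : ℝ)|).bddAbove
      exact ⟨R, fun a ha => hR (Finset.mem_coe.2 (Finset.mem_image_of_mem _ ha))⟩
    obtain ⟨r, hr⟩ := pow_unbounded_of_one_lt (R / δ) hp1
    obtain ⟨B, hAB, hB⟩ := hA.add h (r + 1)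
    choose k hk using hshift
    -- Old elements stay: after `r + 1` further levels they scale into the `δ`-neighbourhood of 0.
    -- Only new elements are shifted off the zeros.
    let k' : ℤ → ℤ := fun a => if a ∈ A then 0 else k (a / p ^ (n + (r + 1)))
    refine ⟨⟨n + (r + 1), B.image fun a => a + p ^ (n + (r + 1)) * k' a⟩,
      ⟨hB.shift h k', ?_⟩, by simp only; omega, fun a ha => ?_⟩
    · intro b hb y hy
      obtain ⟨a, ha, rfl⟩ := Finset.mem_image.1 hb
      by_cases haA : a ∈ A
      · simp only [k', if_pos haA, mul_zero, add_zero]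
        refine hsmall _ _ ?_ hy
        rw [abs_div, abs_of_pos (pow_pos hp _), div_le_iff₀ (pow_pos hp _)]
        refine (hR a haA).trans ?_
        rw [div_lt_iff₀ hδ] at hr
        refine hr.le.trans ?_
        rw [mul_comm]
        exact mul_le_mul_of_nonneg_left (pow_le_pow_right₀ hp1.le (by omega)) hδ.le
      · simp only [k', if_neg haA]
        have := hk ((a : ℝ) / p ^ (n + (r + 1))) y hy
        rwa [show (((a + p ^ (n + (r + 1)) * k (a / p ^ (n + (r + 1))) : ℤ) : ℝ)) /
          p ^ (n + (r + 1)) = a / p ^ (n + (r + 1)) + k (a / p ^ (n + (r + 1))) by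
            push_cast; field_simp]
    · exact Finset.mem_image.2 ⟨a, hAB ha, by simp [k', ha]⟩
  choose! next hnext using hext
  let w₀ : ℕ × Finset ℤ := (0, {0})
  have hw₀ : good w₀ := by
    refine ⟨isLevelSpec_zero, fun a ha y hy => ?_⟩
    rw [Finset.mem_singleton.1 ha]
    exact hsmall _ _ (by simpa using hδ.le) hy
  let w : ℕ → ℕ × Finset ℤ := fun i => next^[i] w₀
  have hws : ∀ i, w (i + 1) = next (w i) := fun i => Function.iterate_succ_apply' _ _ _
  have hgood : ∀ i, good (w i) := by
    intro i
    induction i with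
    | zero => exact hw₀
    | succ i ih => rw [hws]; exact (hnext _ ih).1
  have hlt : StrictMono fun i => (w i).1 := strictMono_nat_of_lt_succ fun i => by
    rw [hws]; exact (hnext _ (hgood i)).2.1
  have hmono : Monotone fun i => (w i).2 := monotone_nat_of_le_succ fun i => by
    rw [hws]; exact (hnext _ (hgood i)).2.2
  refine ⟨{a | ∃ i, a ∈ (w i).2}, fun ξ => ?_⟩
  set Λ : Set ℤ := {a | ∃ i, a ∈ (w i).2} with hΛ
  set F : Λ → ℝ := fun a => ‖ν (ξ - (a : ℤ))‖ ^ 2 with hF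
  -- `G i` is the level-`i` Parseval sum, of total 1; it bounds `F` on its support and tends to `F`
  -- pointwise.
  set G : ℕ → Λ → ℝ := fun i a =>
    if (a : ℤ) ∈ (w i).2 then ‖partialMask p M (w i).1 (ξ - (a : ℤ))‖ ^ 2 else 0 with hG
  have hGsum : ∀ i, HasSum (G i) 1 := by
    intro i
    have h1 : HasSum (fun a : ℤ => if a ∈ (w i).2 then
        ‖partialMask p M (w i).1 (ξ - a)‖ ^ 2 else 0) 1 := by
      rw [← (hgood i).1 ξ]
      have := hasSum_sum_of_ne_finset_zero (f := fun a : ℤ => if a ∈ (w i).2 then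
        ‖partialMask p M (w i).1 (ξ - a)‖ ^ 2 else 0) (s := (w i).2)
        (fun a ha => if_neg ha) (L := .unconditional _)
      rwa [Finset.sum_congr rfl fun a ha => if_pos ha] at this
    refine (hasSum_subtype_iff_of_support_subset (f := fun a : ℤ => if a ∈ (w i).2 then
        ‖partialMask p M (w i).1 (ξ - a)‖ ^ 2 else 0) ?_).2 h1
    intro a ha
    by_contra hna
    exact ha (if_neg fun hmem => hna ⟨i, hmem⟩)
  have hFG : ∀ i (a : Λ), (a : ℤ) ∈ (w i).2 → F a ≤ G i a := by
    intro i a ha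
    simp only [hG, if_pos ha, hF]
    rw [h.eq_partialMask_mul (w i).1, norm_mul, mul_pow]
    exact mul_le_of_le_one_right (by positivity) (pow_le_one₀ (norm_nonneg _) (h.norm_le _))
  have hG0 : ∀ i a, 0 ≤ G i a := by
    intro i a
    simp only [hG]
    split_ifs <;> positivity
  have hFsum : Summable F := by
    refine summable_of_sum_le (c := 1) (fun a => by positivity) fun u => ?_
    obtain ⟨i, hi⟩ : ∃ i, ∀ a ∈ u, (a : ℤ) ∈ (w i).2 := by
      choose i hi using fun a : Λ => a.2
      refine ⟨u.sup i, fun a ha => hmono (Finset.le_sup ha) (hi a)⟩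
    calc ∑ a ∈ u, F a ≤ ∑ a ∈ u, G i a := Finset.sum_le_sum fun a ha => hFG i a (hi a ha)
      _ ≤ ∑' a, G i a := (hGsum i).summable.sum_le_tsum _ fun a _ => hG0 i a
      _ = 1 := (hGsum i).tsum_eq
  have hscale : ∀ x : ℝ, Tendsto (fun i => x / (p : ℝ) ^ (w i).1) atTop (𝓝 0) := by
    intro x
    have h1 : Tendsto (fun n : ℕ => x / (p : ℝ) ^ n) atTop (𝓝 0) :=
      tendsto_const_nhds.div_atTop (tendsto_pow_atTop_atTop_of_one_lt hp1)
    exact h1.comp hlt.tendsto_atTop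
  have hptw : ∀ a, Tendsto (fun i => G i a) atTop (𝓝 (F a)) := by
    intro a
    obtain ⟨j, hj⟩ := a.2
    have h1 : Tendsto (fun i => ‖ν ((ξ - (a : ℤ)) / p ^ (w i).1)‖ ^ 2) atTop (𝓝 1) := by
      have := ((h.continuous.norm.pow 2).tendsto 0).comp (hscale (ξ - (a : ℤ)))
      simpa [h.map_zero, Function.comp_def] using this
    have h2 : Tendsto (fun i => F a / ‖ν ((ξ - (a : ℤ)) / p ^ (w i).1)‖ ^ 2) atTop
        (𝓝 (F a / 1)) := tendsto_const_nhds.div h1 one_ne_zero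
    rw [div_one] at h2
    refine h2.congr' ?_
    filter_upwards [eventually_ge_atTop j, h1.eventually_ne one_ne_zero] with i hi hne
    rw [div_eq_iff hne]
    simp only [hG, if_pos (hmono hi hj), hF]
    rw [← mul_pow, ← norm_mul, ← h.eq_partialMask_mul]
  -- Since `ν` is the partial product times `ν` at the scaled point, the lower bound `ε` gives the
  -- dominating function `ε⁻² F`.
  have hdom : ∀ᶠ i in atTop, ∀ a, ‖G i a‖ ≤ (ε ^ 2)⁻¹ * F a := by
    have h1 : ∀ᶠ i in atTop, |ξ / (p : ℝ) ^ (w i).1| ≤ δ := by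
      have := (hscale ξ).abs
      rw [abs_zero] at this
      exact this.eventually (eventually_le_nhds hδ)
    filter_upwards [h1] with i hi a
    rw [Real.norm_of_nonneg (hG0 i a)]
    by_cases ha : (a : ℤ) ∈ (w i).2
    · simp only [hG, if_pos ha, hF]
      have h2 := (hgood i).2 a ha _ hi
      rw [← sub_div] at h2
      rw [h.eq_partialMask_mul (w i).1 (ξ - (a : ℤ)), norm_mul, mul_pow,
        inv_mul_eq_div, le_div_iff₀ (by positivity)]
      gcongr
    · simp only [hG, if_neg ha]
      positivity
  have hlim := tendsto_tsum_of_dominated_convergence (hFsum.mul_left (ε ^ 2)⁻¹) hptw hdom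
  have hone : ∑' a, F a = 1 := by
    refine tendsto_nhds_unique hlim ?_
    simp only [(hGsum _).tsum_eq]
    exact tendsto_const_nhds
  have : ∑' a : Λ, esq ν (ξ - (a : ℤ)) = ENNReal.ofReal (∑' a, F a) :=
    (ENNReal.ofReal_tsum_of_nonneg (fun a => by positivity) hFsum).symm
  rw [this, hone, ENNReal.ofReal_one]

end RefinementData

/-! ### Sufficiency of the arithmetic conditions -/

lemma exists_int_spectrum_twoIp {p N L a q p₁ p₂ : ℕ} (hp : 2 ≤ p) (hN : 2 ≤ N) (hL : 2 ≤ L)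
    (ha : 0 < a) (hq : 0 < q) (hNp : p = N * p₂) (hLp : p = L * p₁) (hNa : N ∣ a)
    (haq : Nat.Coprime a q) (haL : Nat.Coprime (a / Nat.gcd a p₁) L) :
    ∃ Λ : Set ℤ, ∀ ξ : ℝ, ∑' x : Λ, esq (twoIp (p : ℝ)⁻¹ N q L a) (ξ - (x : ℤ)) = 1 := by
  have h0 := inv_natCast_pos hp
  have h1 := inv_natCast_lt_one hp
  have hp0 : (p : ℝ) ≠ 0 := by exact_mod_cast (by omega : p ≠ 0)
  have ha0 : (a : ℝ) ≠ 0 := by exact_mod_cast ha.ne'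
  have hq0 : (q : ℝ) ≠ 0 := by exact_mod_cast hq.ne'
  have hN0 : (N : ℝ) ≠ 0 := by exact_mod_cast (by omega : N ≠ 0)
  have hL0 : (L : ℝ) ≠ 0 := by exact_mod_cast (by omega : L ≠ 0)
  have hpd : PDFun (twoIp (p : ℝ)⁻¹ N q L a) := pdFun_twoIp h0 h1 (by omega) (by omega) hq0 ha0
  set M : ℝ → ℂ := fun x => mask N (q * x) * mask L (a * x) with hM
  obtain ⟨G, hG⟩ : ∃ G, G = Nat.gcd a p₁ := ⟨_, rfl⟩
  obtain ⟨b, hb⟩ : G ∣ a := hG ▸ Nat.gcd_dvd_left _ _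
  obtain ⟨t, ht⟩ : G ∣ p₁ := hG ▸ Nat.gcd_dvd_right _ _
  have hGpos : 0 < G := Nat.pos_of_ne_zero fun h => by simp [h] at hb; omega
  rw [← hG, hb, Nat.mul_div_cancel_left _ hGpos] at haL
  obtain ⟨e, he⟩ := hNa
  have hNq : Nat.Coprime q N := (haq.coprime_dvd_left ⟨e, he⟩).symm
  have hMle : ∀ x, ‖M x‖ ≤ 1 := fun x => by
    rw [hM, norm_mul]
    exact mul_le_one₀ (norm_mask_le_one _ _) (norm_nonneg _) (norm_mask_le_one _ _)
  -- With `G = gcd (a, p₁)`, `a = G b` and `p₁ = G t`, one has `a t / p = b / L`, `p₂ / p = 1 / N`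
  -- and `N ∣ a`. The second mask therefore sees only the first digit, with unit `b`, and for a
  -- fixed first digit the first mask runs through all shifts `q j / N`.
  let s : ℕ × ℕ → ℤ := fun w => t * w.1 + p₂ * w.2
  have hsum : ∀ ξ : ℝ, ∑ w ∈ Finset.range L ×ˢ Finset.range N, ‖M ((ξ - s w) / p)‖ ^ 2 = 1 := by
    intro ξ
    rw [Finset.sum_product]
    have key : ∀ i j : ℕ, ‖M ((ξ - s (i, j)) / p)‖ ^ 2 =
        ‖mask L (a * ξ / p - (b : ℤ) * i / L)‖ ^ 2 *
          ‖mask N ((q * (ξ - t * i) / p) - (q : ℤ) * j / N)‖ ^ 2 := by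
      intro i j
      have hp₂ : (p₂ : ℝ) / p = 1 / N := by
        rw [div_eq_div_iff hp0 hN0, one_mul, hNp]; push_cast; ring
      have htp : (a : ℝ) * t / p = b / L := by
        rw [div_eq_div_iff hp0 hL0, hLp, hb, ht]; push_cast; ring
      have e1 : (q : ℝ) * ((ξ - s (i, j)) / p) = (q * (ξ - t * i) / p) - (q : ℤ) * j / N := by
        simp only [s]
        push_cast
        linear_combination -(q : ℝ) * j * hp₂
      have e2 : (a : ℝ) * ((ξ - s (i, j)) / p) =
          a * ξ / p - (b : ℤ) * i / L + ((-(e * j) : ℤ) : ℝ) := by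
        simp only [s]
        have h3 : (a : ℝ) / N = e := by rw [div_eq_iff hN0, he]; push_cast; ring
        push_cast
        linear_combination -(i : ℝ) * htp - (a : ℝ) * j * hp₂ - (j : ℝ) * h3
      rw [hM]
      simp only
      rw [e1, e2, mask_add_int, norm_mul, mul_pow, mul_comm]
    simp only [key, ← Finset.mul_sum]
    rw [← sum_norm_mask_sq (by omega : 1 ≤ L) (Nat.isCoprime_iff_coprime.2 haL) (a * ξ / p)]
    refine Finset.sum_congr rfl fun i _ => ?_
    rw [sum_norm_mask_sq (by omega : 1 ≤ N) (Nat.isCoprime_iff_coprime.2 hNq), mul_one]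
  have hM0 : M 0 = 1 := by
    simp only [hM, mul_zero]
    rw [mask_zero_right (by omega), mask_zero_right (by omega), mul_one]
  have hinj : Set.InjOn s (Finset.range L ×ˢ Finset.range N : Finset (ℕ × ℕ)) := by
    intro w hw v hv hwv
    refine injOn_of_sum_norm_sq_eq_one (F := fun x => M (x / p)) (by simpa using hM0)
      (l := fun w => (s w : ℝ)) hsum hw hv ?_
    simp only [hwv]
  have hdata : RefinementData p M (twoIp (p : ℝ)⁻¹ N q L a)
      ((Finset.range L ×ˢ Finset.range N).image s) :=
    { two_le := hp
      continuous := hpd.cont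
      periodic := fun x k => by
        simp only [hM]
        rw [mul_add, mul_add, show (q : ℝ) * k = ((q * k : ℤ) : ℝ) by push_cast; ring,
          show (a : ℝ) * k = ((a * k : ℤ) : ℝ) by push_cast; ring, mask_add_int, mask_add_int]
      norm_mask_le := hMle
      norm_le := hpd.norm_le_one
      map_zero := hpd.map_zero
      refine := fun ξ => by
        simp only [hM, twoIp]
        rw [ip_const_step hp (by omega) q, ip_const_step hp (by omega) a,
          show (q : ℝ) / p * ξ = q * (ξ / p) by ring, show (a : ℝ) / p * ξ = a * (ξ / p) by ring]
        ring
      zero_mem := Finset.mem_image.2 ⟨(0, 0), by simp; omega, by simp [s]⟩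
      sum_eq := fun ξ => by rw [Finset.sum_image hinj]; exact hsum ξ }
  refine hdata.exists_int_spectrum (hdata.exists_int_ne_zero (K := q * N * (a * L))
    (by positivity) (fun x hx => ?_) fun x hx => ?_)
  · rcases mul_eq_zero.1 hx with h | h
    · obtain ⟨k, c, -, hc⟩ := exists_of_ip_eq_zero hp (by omega) hq0 h
      refine ⟨a * L * p * (p ^ k * c), ?_⟩
      rw [hc]
      push_cast
      field_simp
    · obtain ⟨k, c, -, hc⟩ := exists_of_ip_eq_zero hp (by omega) ha0 h
      refine ⟨q * N * p * (p ^ k * c), ?_⟩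
      rw [hc]
      push_cast
      field_simp
  · simp only [hM] at hx
    rw [norm_mul] at hx
    have h2 := norm_mask_le_one N (q * x)
    have h3 := norm_mask_le_one L (a * x)
    have h4 : ‖mask N (q * x)‖ = 1 := le_antisymm h2 (by
      rw [← hx]; exact mul_le_of_le_one_right (norm_nonneg _) h3)
    have h5 : ‖mask L (a * x)‖ = 1 := by rwa [h4, one_mul] at hx
    obtain ⟨u, hu⟩ := exists_int_of_norm_mask_eq_one hN h4
    obtain ⟨v, hv⟩ := exists_int_of_norm_mask_eq_one hL h5
    -- Both `q x` and `a x` are integers, so a Bézout relation makes `x` an integer.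
    obtain ⟨y, z, hyz⟩ := Nat.isCoprime_iff_coprime.2 haq
    refine ⟨y * v + z * u, ?_⟩
    have hyz' : (y : ℝ) * a + z * q = 1 := by exact_mod_cast hyz
    push_cast
    rw [← hu, ← hv]
    linear_combination (-x) * hyz'

/-- Multiplying by one more mask refines the spectrum. -/
lemma tsum_esq_mask_mul {ι : Type*} {f : ℝ → ℂ} {l : ι → ℝ} {c : ℝ} {L : ℕ} (hL : 1 ≤ L)
    (hc : c ≠ 0) (hl : ∀ i, ∃ a : ℤ, c * l i = a) (h : ∀ ξ, ∑' i, esq f (ξ - l i) = 1) (ξ : ℝ) :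
    ∑' w : Fin L × ι, esq (fun x => mask L (c * x) * f x) (ξ - (l w.2 + w.1 / (c * L))) = 1 := by
  have hL0 : (L : ℝ) ≠ 0 := by exact_mod_cast (by omega : L ≠ 0)
  rw [ENNReal.tsum_prod (f := fun (i : Fin L) (j : ι) =>
    esq (fun x => mask L (c * x) * f x) (ξ - (l j + i / (c * L))))]
  have key : ∀ (i : Fin L) (j : ι),
      esq (fun x => mask L (c * x) * f x) (ξ - (l j + i / (c * L))) =
        ENNReal.ofReal (‖mask L (c * ξ - (1 : ℤ) * (i : ℕ) / L)‖ ^ 2) *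
          esq f ((ξ - i / (c * L)) - l j) := by
    intro i j
    rw [esq_mul, sub_sub, add_comm (l j), esq]
    congr 3
    obtain ⟨a, ha⟩ := hl j
    rw [← mask_add_int L (c * ξ - (1 : ℤ) * (i : ℕ) / L) (-a)]
    congr 2
    push_cast
    rw [← ha]
    field_simp
    ring
  simp only [key, ENNReal.tsum_mul_left, h, mul_one]
  rw [tsum_fintype, ← ENNReal.ofReal_sum_of_nonneg fun _ _ => by positivity,
    Fin.sum_univ_eq_sum_range fun i => ‖mask L (c * ξ - (1 : ℤ) * (i : ℕ) / L)‖ ^ 2,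
    sum_norm_mask_sq hL isCoprime_one_left, ENNReal.ofReal_one]

/-- Multiplying the second scale by `p` adds one mask. The integrality of `a p^e * l i` lets that
mask depend only on the new digit, and it survives the step because `L ∣ p`. -/
lemma exists_spectrum_twoIp_pow {p N L a q : ℕ} (hp : 2 ≤ p) (hL : 2 ≤ L)
    (ha : 0 < a) (hLp : L ∣ p)
    (h : ∃ Λ : Set ℤ, ∀ ξ : ℝ, ∑' x : Λ, esq (twoIp (p : ℝ)⁻¹ N q L a) (ξ - (x : ℤ)) = 1)
    (e : ℕ) : ∃ (ι : Type) (_ : Countable ι) (l : ι → ℝ),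
      (∀ i, ∃ b : ℤ, (a * p ^ e : ℝ) * l i = b) ∧
      ∀ ξ, ∑' i, esq (twoIp (p : ℝ)⁻¹ N q L (a * p ^ e)) (ξ - l i) = 1 := by
  have hp0 : (p : ℝ) ≠ 0 := by exact_mod_cast (by omega : p ≠ 0)
  have ha0 : (a : ℝ) ≠ 0 := by exact_mod_cast ha.ne'
  have hL0 : (L : ℝ) ≠ 0 := by exact_mod_cast (by omega : L ≠ 0)
  induction e with
  | zero =>
    obtain ⟨Λ, hΛ⟩ := h
    refine ⟨Λ, inferInstance, fun x => ((x : ℤ) : ℝ), fun x => ⟨a * x, by push_cast; ring⟩,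
      by simpa using hΛ⟩
  | succ e ih =>
    obtain ⟨ι, hι, l, hl, hsum⟩ := ih
    refine ⟨Fin L × ι, inferInstance, fun w => l w.2 + w.1 / (a * p ^ e * L), fun w => ?_,
      fun ξ => ?_⟩
    · obtain ⟨b, hb⟩ := hl w.2
      obtain ⟨k, hk⟩ := hLp
      refine ⟨p * b + k * w.1, ?_⟩
      push_cast
      rw [← hb]
      have hk' : (p : ℝ) = L * k := by exact_mod_cast hk
      rw [pow_succ]
      field_simp
      rw [hk']
      ring
    · rw [← tsum_esq_mask_mul (by omega : 1 ≤ L) (mul_ne_zero ha0 (pow_ne_zero e hp0)) hl hsum ξ]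
      congr 2
      funext w
      congr 1
      funext x
      rw [twoIp, twoIp, ip_const_step hp (by omega) (a * p ^ (e + 1)),
        show (a * p ^ (e + 1) / p : ℝ) = a * p ^ e by rw [pow_succ]; field_simp]
      ring

/-- The arithmetic conditions produce a spectrum. -/
lemma exists_spectrum_of_isGreatest {p N L m d : ℕ} (hp : 2 ≤ p) (hN : 2 ≤ N) (hL : 2 ≤ L)
    (hm : 0 < m) (hNp : N ∣ p) (hLp : L ∣ p)
    (hd : IsGreatest {i : ℕ | Nat.gcd (m * L / Nat.gcd (m * L) (p ^ i)) L ≠ 1} d)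
    (hNm : N ∣ m / Nat.gcd m (p ^ d)) : ∃ (ι : Type) (_ : Countable ι) (l : ι → ℝ),
      ∀ ξ, ∑' i, esq (twoIp (p : ℝ)⁻¹ N 1 L m) (ξ - l i) = 1 := by
  obtain ⟨p₂, hp₂⟩ := hNp
  obtain ⟨p₁, hp₁⟩ := hLp
  have hgpos : 0 < Nat.gcd m (p ^ d) := Nat.gcd_pos_of_pos_left _ hm
  obtain ⟨a, q, haq, hma, hpq⟩ := Nat.exists_coprime m (p ^ d)
  set g := Nat.gcd m (p ^ d) with hg
  have ha : 0 < a := Nat.pos_of_ne_zero fun h => by simp [h] at hma; omega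
  have hq : 0 < q := Nat.pos_of_ne_zero fun h => by
    rw [h, zero_mul] at hpq
    exact absurd hpq (pow_pos (by omega) d).ne'
  have hNa : N ∣ a := by
    rwa [hma, Nat.mul_div_cancel _ hgpos] at hNm
  -- At exponent `d + 1` the quotient in the definition of `d` is exactly `a / gcd (a, p₁)`; a
  -- common factor with `L` would contradict maximality.
  have haL : Nat.Coprime (a / Nat.gcd a p₁) L := by
    by_contra hne
    have hmem : d + 1 ∈ {i : ℕ | Nat.gcd (m * L / Nat.gcd (m * L) (p ^ i)) L ≠ 1} := by
      have e1 : Nat.gcd (m * L) (p ^ (d + 1)) = g * L * Nat.gcd a p₁ := by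
        have e2 : m * L = (g * L) * a := by rw [hma]; ring
        have e3 : p ^ (d + 1) = (g * L) * (q * p₁) := by
          rw [pow_succ, hpq]; nth_rewrite 1 [hp₁]; ring
        rw [e2, e3, Nat.gcd_mul_left, haq.symm.gcd_mul_left_cancel_right]
      have e4 : m * L / (g * L * Nat.gcd a p₁) = a / Nat.gcd a p₁ := by
        have e2 : m * L = (g * L) * a := by rw [hma]; ring
        rw [e2, Nat.mul_div_mul_left _ _ (by positivity)]
      rw [Set.mem_ofPred_eq, e1, e4]
      exact hne
    have := hd.2 hmem
    omega
  obtain ⟨ι, hι, l, -, hsum⟩ := exists_spectrum_twoIp_pow (N := N) (q := q) hp hL ha ⟨p₁, hp₁⟩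
    (exists_int_spectrum_twoIp hp hN hL ha hq hp₂ hp₁ hNa haq haL) d
  have hq0 : (q : ℝ) ≠ 0 := by exact_mod_cast hq.ne'
  -- Since `m q = a p ^ d`, the scales `1, m` are the scales `q, a p ^ d` divided by `q`, and
  -- frequencies are multiplied by `q`.
  refine ⟨ι, hι, fun i => q * l i, fun ξ => ?_⟩
  rw [← hsum (ξ / q)]
  refine tsum_congr fun i => ?_
  have hmq : (m : ℝ) * q = a * p ^ d := by
    have : m * q = a * p ^ d := by rw [hpq]; nth_rewrite 1 [hma]; ring
    exact_mod_cast this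
  rw [esq, esq, twoIp, twoIp, show (1 : ℝ) * (ξ - q * l i) = q * (ξ / q - l i) by field_simp,
    show (m : ℝ) * (ξ - q * l i) = a * p ^ d * (ξ / q - l i) by rw [← hmq]; field_simp]

/-! ### The Fourier transform of the self-similar measure -/

lemma continuous_ee : Continuous ee := by
  unfold ee
  fun_prop

/-- The Fourier transform `ξ ↦ ∫ e^{2πiξx} dμ(x)`. -/
noncomputable def fourier (μ : Measure ℝ) (ξ : ℝ) : ℂ := ∫ x, ee (ξ * x) ∂μ

lemma fourier_eq_charFun (μ : Measure ℝ) (ξ : ℝ) : fourier μ ξ = charFun μ (2 * Real.pi * ξ) := by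
  rw [fourier, charFun_apply_real]
  congr 1
  funext x
  rw [ee]
  congr 1
  push_cast
  ring

lemma integrable_ee (μ : Measure ℝ) [IsFiniteMeasure μ] (c : ℝ → ℝ) (hc : Continuous c) :
    Integrable (fun x => ee (c x)) μ :=
  Integrable.of_bound (C := 1) (continuous_ee.comp hc).aestronglyMeasurable
    (ae_of_all _ fun _ => (norm_ee _).le)

section selfsimilar

variable {ρ : ℝ} {N m L : ℕ} {μ : Measure ℝ}

lemma sum_digitSet (hD : IsDirectSum N m L) (F : ℝ → ℂ) :
    ∑ d ∈ digitSet N m L, F d =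
      ∑ a ∈ Finset.range N, ∑ b ∈ Finset.range L, F (a + m * b) := by
  rw [digitSet, Finset.sum_image, Finset.sum_product]
  rintro ⟨a, b⟩ hab ⟨a', b'⟩ hab' h
  simp only [Finset.coe_product, Finset.coe_range, Set.mem_prod, Set.mem_Iio] at hab hab'
  obtain ⟨h1, h2⟩ := hD a hab.1 b hab.2 a' hab'.1 b' hab'.2 (by
    simp only at h
    exact_mod_cast h)
  rw [h1, h2]

lemma card_digitSet (hD : IsDirectSum N m L) : ((digitSet N m L).card : ℂ) = N * L := by
  have := sum_digitSet hD fun _ => 1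
  simpa using this

lemma sum_ee_digitSet (hD : IsDirectSum N m L) (x : ℝ) :
    ((digitSet N m L).card : ℂ)⁻¹ * ∑ d ∈ digitSet N m L, ee (d * x) =
      mask N x * mask L (m * x) := by
  rw [card_digitSet hD, sum_digitSet hD fun d => ee (d * x), mask, mask, mul_inv]
  have : ∀ a ∈ Finset.range N, ∑ b ∈ Finset.range L, ee ((a + m * b) * x) =
      ee (a * x) * ∑ b ∈ Finset.range L, ee (b * (m * x)) := by
    intro a _
    rw [Finset.mul_sum]
    refine Finset.sum_congr rfl fun b _ => ?_
    rw [← ee_add]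
    congr 1
    ring
  rw [Finset.sum_congr rfl this, ← Finset.sum_mul]
  ring

lemma fourier_step (hD : IsDirectSum N m L)
    (hμ : IsSelfSimilarMeasure ρ (digitSet N m L) μ) (ξ : ℝ) :
    fourier μ ξ = mask N (ρ * ξ) * mask L (m * (ρ * ξ)) * fourier μ (ρ * ξ) := by
  have := hμ.isProbabilityMeasure
  rw [← sum_ee_digitSet hD]
  conv_lhs => rw [fourier, hμ.eq_sum_map, integral_smul_measure,
    integral_finsetSum_measure (fun d _ => by
      have := Measure.isProbabilityMeasure_map (μ := μ)
        (f := fun x : ℝ => ρ * (x + d)) (by fun_prop)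
      exact integrable_ee _ _ (by fun_prop))]
  rw [mul_assoc, Finset.sum_mul]
  simp only [ENNReal.toReal_inv, ENNReal.toReal_natCast, Complex.real_smul,
    Complex.ofReal_inv, Complex.ofReal_natCast]
  congr 1
  refine Finset.sum_congr rfl fun d _ => ?_
  rw [integral_map (f := fun x => ee (ξ * x)) (by fun_prop)
    (continuous_ee.comp (by fun_prop)).aestronglyMeasurable, fourier, ← integral_const_mul]
  congr 1
  funext x
  rw [← ee_add]
  congr 1
  ring

/-- The Fourier transform of the self-similar measure is the infinite product of its masks. -/
lemma fourier_eq_twoIp (h0 : 0 < ρ) (h1 : ρ < 1) (hN : 1 ≤ N) (hL : 1 ≤ L) (hm : 0 < m)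
    (hD : IsDirectSum N m L) (hμ : IsSelfSimilarMeasure ρ (digitSet N m L) μ) :
    fourier μ = twoIp ρ N 1 L m := by
  have := hμ.isProbabilityMeasure
  have hpd : PDFun (twoIp ρ N 1 L m) :=
    pdFun_twoIp h0 h1 hN hL one_ne_zero (by exact_mod_cast hm.ne')
  have hcont : Continuous (fourier μ) := by
    have h2 : fourier μ = fun ξ => charFun μ (2 * Real.pi * ξ) := funext (fourier_eq_charFun μ)
    rw [h2]
    exact continuous_charFun.comp (by fun_prop)
  have hzero : fourier μ 0 = 1 := by simp [fourier]
  have hstep : ∀ ξ, ‖fourier μ ξ - twoIp ρ N 1 L m ξ‖ ≤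
      ‖fourier μ (ρ * ξ) - twoIp ρ N 1 L m (ρ * ξ)‖ := by
    intro ξ
    have h2 := twoIp_eq_finIp_mul h0 h1 hN hL m 1 ξ
    have h3 : finIp ρ N L m 1 ξ = mask N (ρ * ξ) * mask L (m * (ρ * ξ)) := by
      simp [finIp, mul_left_comm, mul_comm, mul_assoc]
    rw [h3, pow_one] at h2
    rw [fourier_step hD hμ ξ, h2, ← mul_sub, norm_mul]
    refine mul_le_of_le_one_left (norm_nonneg _) ?_
    rw [norm_mul]
    exact mul_le_one₀ (norm_mask_le_one _ _) (norm_nonneg _) (norm_mask_le_one _ _)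
  have hiter : ∀ (n : ℕ) ξ, ‖fourier μ ξ - twoIp ρ N 1 L m ξ‖ ≤
      ‖fourier μ (ρ ^ n * ξ) - twoIp ρ N 1 L m (ρ ^ n * ξ)‖ := by
    intro n
    induction n with
    | zero => intro ξ; simp
    | succ n ih =>
      intro ξ
      refine (ih ξ).trans ((hstep _).trans_eq ?_)
      rw [pow_succ', mul_assoc]
  funext ξ
  have hlim : Tendsto (fun n : ℕ => ‖fourier μ (ρ ^ n * ξ) - twoIp ρ N 1 L m (ρ ^ n * ξ)‖)
      atTop (𝓝 0) := by
    have h3 : Tendsto (fun n : ℕ => ρ ^ n * ξ) atTop (𝓝 0) := by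
      simpa using (tendsto_pow_atTop_nhds_zero_of_lt_one h0.le h1).mul_const ξ
    have h4 := ((hcont.sub hpd.cont).norm.tendsto 0).comp h3
    simpa [Function.comp_def, hzero, hpd.map_zero] using h4
  have := ge_of_tendsto' hlim fun n => hiter n ξ
  exact sub_eq_zero.1 (norm_le_zero_iff.1 this)

end selfsimilar

/-! ### Spectral measures and Parseval's identity -/

section L2

variable {μ : Measure ℝ} [IsProbabilityMeasure μ]

lemma memLp_ee (μ : Measure ℝ) [IsProbabilityMeasure μ] (ξ : ℝ) :
    MemLp (fun x => ee (ξ * x)) 2 μ :=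
  MemLp.of_bound (continuous_ee.comp (by fun_prop)).aestronglyMeasurable 1
    (ae_of_all _ fun _ => (norm_ee _).le)

/-- The exponential `x ↦ e^{2πiξx}` as an element of `L²(μ)`. -/
noncomputable def expLp (μ : Measure ℝ) [IsProbabilityMeasure μ] (ξ : ℝ) : Lp ℂ 2 μ :=
  (memLp_ee μ ξ).toLp

lemma coeFn_expLp (ξ : ℝ) : expLp μ ξ =ᵐ[μ] fun x => ee (ξ * x) := (memLp_ee μ ξ).coeFn_toLp

lemma inner_expLp (ξ η : ℝ) : inner ℂ (expLp μ ξ) (expLp μ η) = fourier μ (η - ξ) := by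
  rw [L2.inner_def, fourier]
  refine integral_congr_ae ?_
  filter_upwards [coeFn_expLp (μ := μ) ξ, coeFn_expLp (μ := μ) η] with x hx hy
  rw [hx, hy, RCLike.inner_apply, sub_mul, ee_sub]

lemma fourier_zero : fourier μ 0 = 1 := by simp [fourier]

lemma norm_expLp (ξ : ℝ) : ‖expLp μ ξ‖ = 1 := by
  have h2 : ‖expLp μ ξ‖ ^ 2 = 1 := by
    rw [norm_sq_eq_re_inner (𝕜 := ℂ), inner_expLp, sub_self, fourier_zero]
    simp
  exact (pow_eq_one_iff_of_nonneg (norm_nonneg _) two_ne_zero).1 h2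

lemma ee_eq_exp (l x : ℝ) :
    ee (l * x) = Complex.exp (2 * Real.pi * Complex.I * (l : ℂ) * (x : ℂ)) := by
  rw [ee]
  congr 1
  push_cast
  ring

lemma IsSpectral.exists_isSpec (h : IsSpectral μ) : ∃ Λ, IsSpec Λ (fourier μ) := by
  obtain ⟨Λ, hΛ, b, hb⟩ := h
  have hb' : ∀ l : Λ, b l = expLp μ l := by
    intro l
    refine Lp.ext ((hb l).trans ?_)
    filter_upwards [coeFn_expLp (μ := μ) (l : ℝ)] with x hx
    rw [hx, ee_eq_exp]
  refine ⟨Λ, hΛ, fun x hx y hy hxy => ?_, ∅, Set.countable_empty, fun ξ _ => ?_⟩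
  · have : inner ℂ (b ⟨y, hy⟩) (b ⟨x, hx⟩) = 0 := b.orthonormal.2 (i := ⟨y, hy⟩) (j := ⟨x, hx⟩)
      fun h => hxy (congrArg Subtype.val h).symm
    rwa [hb', hb', inner_expLp] at this
  · have h1 := b.hasSum_inner_mul_inner (expLp μ ξ) (expLp μ ξ)
    have h2 : HasSum (fun l : Λ => ‖fourier μ (ξ - l)‖ ^ 2) 1 := by
      have e1 : ∀ l : Λ, inner ℂ (expLp μ ξ) (b l) * inner ℂ (b l) (expLp μ ξ) =
          ((‖fourier μ (ξ - l)‖ ^ 2 : ℝ) : ℂ) := by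
        intro l
        rw [hb', ← inner_conj_symm (expLp μ ξ), inner_expLp, mul_comm, Complex.mul_conj,
          Complex.normSq_eq_norm_sq]
      simp only [e1] at h1
      rw [inner_expLp, sub_self, fourier_zero, ← Complex.ofReal_one] at h1
      exact Complex.hasSum_ofReal.1 h1
    have h3 := ENNReal.ofReal_tsum_of_nonneg (fun l : Λ => by positivity) h2.summable
    rw [h2.tsum_eq, ENNReal.ofReal_one] at h3
    exact h3.symm

/-- The positive and negative parts of `g` are densities of two finite measures with the same
characteristic function. -/
lemma ae_eq_zero_of_integral_mul_ee_eq_zero_real {g : ℝ → ℝ} (hg : Integrable g μ)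
    (h : ∀ ξ : ℝ, ∫ x, (g x : ℂ) * ee (ξ * x) ∂μ = 0) : g =ᵐ[μ] 0 := by
  have hf1 := isFiniteMeasure_withDensity_ofReal hg.2
  have hf2 := isFiniteMeasure_withDensity_ofReal (f := fun x => -g x) hg.neg.2
  have hm1 : AEMeasurable (fun x => ENNReal.ofReal (g x)) μ := hg.1.aemeasurable.ennreal_ofReal
  have hm2 : AEMeasurable (fun x => ENNReal.ofReal (-g x)) μ :=
    hg.neg.1.aemeasurable.ennreal_ofReal
  have hint : ∀ {u : ℝ → ℝ}, Integrable u μ → ∀ ξ : ℝ,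
      Integrable (fun x => (ENNReal.ofReal (u x)).toReal • ee (ξ * x)) μ := by
    intro u hu ξ
    simp only [ENNReal.toReal_ofReal', Complex.real_smul]
    exact hu.pos_part.ofReal.mul_bdd (c := 1)
      (continuous_ee.comp (by fun_prop)).aestronglyMeasurable
      (ae_of_all _ fun _ => (norm_ee _).le)
  have heq : (μ.withDensity fun x => ENNReal.ofReal (g x)) =
      μ.withDensity fun x => ENNReal.ofReal (-g x) := by
    apply Measure.ext_of_charFun
    funext t
    have ht : t = 2 * Real.pi * (t / (2 * Real.pi)) := by
      field_simp
    rw [ht, ← fourier_eq_charFun, ← fourier_eq_charFun, fourier, fourier,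
      integral_withDensity_eq_integral_toReal_smul₀ hm1 (by simp),
      integral_withDensity_eq_integral_toReal_smul₀ hm2 (by simp), ← sub_eq_zero,
      ← integral_sub, ← h (t / (2 * Real.pi))]
    · congr 1
      funext x
      rw [← sub_smul, Complex.real_smul]
      congr 2
      rcases le_total 0 (g x) with h0 | h0
      · rw [ENNReal.toReal_ofReal h0, ENNReal.ofReal_of_nonpos (by linarith)]; simp
      · rw [ENNReal.toReal_ofReal (by linarith : 0 ≤ -g x), ENNReal.ofReal_of_nonpos h0]; simp
    · exact hint hg _
    · exact hint hg.neg _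
  rw [withDensity_eq_iff_of_sigmaFinite hm1 hm2] at heq
  filter_upwards [heq] with x hx
  change g x = 0
  rcases le_total 0 (g x) with h0 | h0
  · rw [ENNReal.ofReal_of_nonpos (by linarith : -g x ≤ 0), ENNReal.ofReal_eq_zero] at hx
    exact le_antisymm hx h0
  · rw [ENNReal.ofReal_of_nonpos h0, eq_comm, ENNReal.ofReal_eq_zero] at hx
    exact le_antisymm h0 (by linarith)

/-- The hypothesis at `-ξ` transfers to the conjugate of `f`, hence to its real and imaginary parts.
-/
lemma ae_eq_zero_of_integral_mul_ee_eq_zero {f : ℝ → ℂ} (hf : Integrable f μ)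
    (h : ∀ ξ : ℝ, ∫ x, f x * ee (ξ * x) ∂μ = 0) : f =ᵐ[μ] 0 := by
  have hint : ∀ {g : ℝ → ℂ}, Integrable g μ → ∀ ξ : ℝ,
      Integrable (fun x => g x * ee (ξ * x)) μ := fun hg ξ =>
    hg.mul_bdd (c := 1) (continuous_ee.comp (by fun_prop)).aestronglyMeasurable
      (ae_of_all _ fun _ => (norm_ee _).le)
  have hconj : Integrable (fun x => conj (f x)) μ := by
    simpa using (LinearIsometryEquiv.integrable_comp_iff Complex.conjLIE).2 hf
  have h' : ∀ ξ : ℝ, ∫ x, conj (f x) * ee (ξ * x) ∂μ = 0 := by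
    intro ξ
    have h1 := congrArg conj (h (-ξ))
    rw [← integral_conj, map_zero] at h1
    rw [← h1]
    congr 1
    funext x
    rw [map_mul, ← ee_neg, neg_mul, neg_neg]
  have hre : (fun x => (f x).re) =ᵐ[μ] 0 := by
    refine ae_eq_zero_of_integral_mul_ee_eq_zero_real hf.re fun ξ => ?_
    have h1 : ∀ x, ((f x).re : ℂ) * ee (ξ * x) =
        (1 / 2 : ℂ) * (f x * ee (ξ * x) + conj (f x) * ee (ξ * x)) := fun x => by
      rw [Complex.re_eq_add_conj]; ring
    simp only [h1]
    rw [integral_const_mul, integral_add (hint hf ξ) (hint hconj ξ), h, h']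
    simp
  have him : (fun x => (f x).im) =ᵐ[μ] 0 := by
    refine ae_eq_zero_of_integral_mul_ee_eq_zero_real hf.im fun ξ => ?_
    have h1 : ∀ x, ((f x).im : ℂ) * ee (ξ * x) =
        (1 / (2 * Complex.I) : ℂ) * (f x * ee (ξ * x) - conj (f x) * ee (ξ * x)) := fun x => by
      rw [Complex.im_eq_sub_conj]; field_simp
    simp only [h1]
    rw [integral_const_mul, integral_sub (hint hf ξ) (hint hconj ξ), h, h']
    simp
  filter_upwards [hre, him] with x h1 h2
  exact Complex.ext h1 h2

/-- A vector orthogonal to an orthonormal family is orthogonal to every vector for which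
Parseval's identity holds. -/
lemma inner_eq_zero_of_parseval {E : Type*} [NormedAddCommGroup E] [InnerProductSpace ℂ E]
    {ι : Type*} {v : ι → E} (hv : Orthonormal ℂ v) {f x : E} (hf : ∀ i, inner ℂ (v i) f = 0)
    (hx : HasSum (fun i => ‖inner ℂ (v i) x‖ ^ 2) (‖x‖ ^ 2)) : inner ℂ f x = 0 := by
  by_cases hf0 : f = 0
  · rw [hf0, inner_zero_left]
  have hn : ‖f‖ ≠ 0 := norm_ne_zero_iff.2 hf0
  let e : E := ((‖f‖⁻¹ : ℝ) : ℂ) • f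
  have he : ‖e‖ = 1 := by
    rw [norm_smul, Complex.norm_real, norm_inv, norm_norm, inv_mul_cancel₀ hn]
  have hve : ∀ i, inner ℂ (v i) e = 0 := fun i => by rw [inner_smul_right, hf, mul_zero]
  let v' : Option ι → E := fun o => o.elim e v
  have hv' : Orthonormal ℂ v' := by
    refine ⟨?_, ?_⟩
    · rintro (_ | i)
      · exact he
      · exact hv.1 i
    · rintro (_ | i) (_ | j) hij
      · exact absurd rfl hij
      · exact inner_eq_zero_symm.1 (hve j)
      · exact hve i
      · exact hv.2 fun h => hij (by rw [h])
  -- Adjoining the unit vector `e` keeps the family orthonormal, so Bessel leaves no room for a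
  -- component of `x` along `f`.
  have hle : ‖x‖ ^ 2 ≤ ‖x‖ ^ 2 - ‖inner ℂ e x‖ ^ 2 := by
    refine hasSum_le_of_sum_le hx fun s => ?_
    have := hv'.sum_inner_products_le (s := Finset.insertNone s) (x := x)
    rw [Finset.sum_insertNone] at this
    exact le_sub_iff_add_le'.2 this
  have h0 : inner ℂ e x = 0 := by
    rw [← norm_eq_zero, ← sq_eq_zero_iff]
    nlinarith [sq_nonneg ‖inner ℂ e x‖]
  rw [inner_smul_left, mul_eq_zero] at h0
  refine h0.resolve_left ?_
  rw [Complex.conj_ofReal]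
  exact_mod_cast inv_ne_zero hn

/-- Orthogonality comes for free: at `ξ = l i` the `i`-th term is already 1. For completeness, a
vector orthogonal to the family is orthogonal to every exponential by Parseval, hence zero by
uniqueness of Fourier transforms. -/
lemma isSpectral_of_tsum_eq_one {ι : Type*} [Countable ι] {l : ι → ℝ}
    (h : ∀ ξ, ∑' i, esq (fourier μ) (ξ - l i) = 1) : IsSpectral μ := by
  have hsum : ∀ ξ, HasSum (fun i => ‖fourier μ (ξ - l i)‖ ^ 2) 1 := by
    intro ξ
    have h1 := ENNReal.hasSum_toReal (f := fun i => esq (fourier μ) (ξ - l i))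
      (by rw [h]; exact ENNReal.one_ne_top)
    rw [← ENNReal.tsum_toReal_eq fun i => esq_ne_top _ _, h, ENNReal.toReal_one] at h1
    simpa [esq, ENNReal.toReal_ofReal] using h1
  have horth : ∀ i j, i ≠ j → fourier μ (l i - l j) = 0 := by
    classical
    intro i j hij
    have h1 := (hsum (l i)).summable.sum_le_tsum {i, j} fun _ _ => by positivity
    rw [(hsum (l i)).tsum_eq, Finset.sum_pair hij, sub_self, fourier_zero, norm_one] at h1
    have h2 : ‖fourier μ (l i - l j)‖ ^ 2 = 0 := le_antisymm (by linarith) (by positivity)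
    simpa using h2
  have hinj : Function.Injective l := by
    intro i j hij
    by_contra hne
    have := horth i j hne
    rw [hij, sub_self, fourier_zero] at this
    exact one_ne_zero this
  let e := Equiv.ofInjective l hinj
  have hon : Orthonormal ℂ fun x : Set.range l => expLp μ x := by
    refine ⟨fun x => norm_expLp _, fun x y hxy => ?_⟩
    obtain ⟨i, rfl⟩ := e.surjective x
    obtain ⟨j, rfl⟩ := e.surjective y
    change inner ℂ (expLp μ (l i)) (expLp μ (l j)) = 0
    rw [inner_expLp]
    exact horth j i fun h => hxy (by rw [h])
  have hbot : (Submodule.span ℂ (Set.range fun x : Set.range l => expLp μ x))ᗮ = ⊥ := by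
    rw [eq_bot_iff]
    intro f hf
    rw [Submodule.mem_orthogonal] at hf
    have hf' : ∀ x : Set.range l, inner ℂ (expLp μ x) f = 0 := fun x =>
      hf _ (Submodule.subset_span ⟨x, rfl⟩)
    have hall : ∀ ξ, inner ℂ f (expLp μ ξ) = 0 := by
      intro ξ
      refine inner_eq_zero_of_parseval hon hf' ?_
      rw [norm_expLp, one_pow, ← e.hasSum_iff]
      simpa [Function.comp_def, inner_expLp, e] using hsum ξ
    have hint : Integrable (fun x => conj (f x)) μ := by
      have h1 : Integrable (f : ℝ → ℂ) μ := (Lp.memLp f).integrable (by norm_num)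
      simpa using (LinearIsometryEquiv.integrable_comp_iff Complex.conjLIE).2 h1
    have hz := ae_eq_zero_of_integral_mul_ee_eq_zero hint fun ξ => by
      rw [← hall ξ, L2.inner_def]
      refine integral_congr_ae ?_
      filter_upwards [coeFn_expLp (μ := μ) ξ] with x hx
      rw [hx, RCLike.inner_apply, mul_comm]
    rw [Submodule.mem_bot]
    refine Lp.ext ?_
    filter_upwards [hz, Lp.coeFn_zero ℂ 2 μ] with x hx h0
    rw [h0]
    simpa using hx
  refine ⟨Set.range l, Set.countable_range l, HilbertBasis.mkOfOrthogonalEqBot hon hbot,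
    fun x => ?_⟩
  rw [HilbertBasis.coe_mkOfOrthogonalEqBot]
  filter_upwards [coeFn_expLp (μ := μ) (x : ℝ)] with y hy
  rw [hy, ee_eq_exp]

end L2

/-! ### Conclusion -/

/-- For a spectral two-factor product, the inverse contraction ratio is an integer. -/
lemma IsSpec.exists_nat_eq_inv {ρ : ℝ} (h0 : 0 < ρ) (h1 : ρ < 1) {N m L : ℕ} (hN : 2 ≤ N)
    (hm : 0 < m) (hL : 2 ≤ L) {Λ : Set ℝ} (h : IsSpec Λ (twoIp ρ N 1 L m)) :
    ∃ p : ℕ, 2 ≤ p ∧ ρ⁻¹ = p := by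
  obtain ⟨a, ha⟩ := h.exists_rat h0 h1 hN hm hL
  have hinv : 1 < ρ⁻¹ := (one_lt_inv₀ h0).2 h1
  have ha1 : (1 : ℚ) < a := by rw [ha] at hinv; exact_mod_cast hinv
  have hnum : 0 < a.num := Rat.num_pos.2 (by linarith)
  obtain ⟨p, hp⟩ := Int.eq_ofNat_of_zero_le hnum.le
  have hden : 0 < a.den := a.den_pos
  have hcop : Nat.Coprime p a.den := by
    have := a.reduced
    rwa [hp, Int.natAbs_natCast] at this
  have hap : (a : ℝ) = p / a.den := by
    have h2 := Rat.num_div_den a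
    rw [hp] at h2
    have h3 : ((((p : ℤ) : ℚ) / (a.den : ℚ) : ℚ) : ℝ) = a := by rw [h2]
    rw [← h3]
    push_cast
    rfl
  have hden0 : (0 : ℝ) < a.den := by exact_mod_cast hden
  have hlt : a.den < p := by
    rw [ha, hap, one_lt_div hden0] at hinv
    exact_mod_cast hinv
  have hρ : ρ = (a.den : ℝ) / p := by rw [← inv_inv ρ, ha, hap, inv_div]
  rw [hρ] at h
  have hone := h.denominator_eq_one hcop (by omega) hden hlt hN hL hm
  refine ⟨p, by omega, ?_⟩
  rw [ha, hap, hone, Nat.cast_one, div_one]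

theorem isSpectral_iff {ρ : ℝ} (h0 : 0 < ρ) (h1 : ρ < 1) {N m L : ℕ} (hN : 2 ≤ N)
    (hm : 0 < m) (hL : 2 ≤ L) (hD : IsDirectSum N m L) {μ : Measure ℝ}
    (hμ : IsSelfSimilarMeasure ρ (digitSet N m L) μ) :
    IsSpectral μ ↔ ∃ p : ℕ, ρ⁻¹ = (p : ℝ) ∧ N ∣ p ∧ L ∣ p ∧
      ∃ d : ℕ, IsGreatest {i : ℕ | Nat.gcd (m * L / Nat.gcd (m * L) (p ^ i)) L ≠ 1} d ∧
        N ∣ m / Nat.gcd m (p ^ d) := by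
  have := hμ.isProbabilityMeasure
  have hfour := fourier_eq_twoIp h0 h1 (by omega) (by omega) hm hD hμ
  constructor
  · intro h
    obtain ⟨Λ, hΛ⟩ := h.exists_isSpec
    rw [hfour] at hΛ
    obtain ⟨p, hp, hρ⟩ := hΛ.exists_nat_eq_inv h0 h1 hN hm hL
    rw [← inv_inv ρ, hρ] at hΛ
    exact ⟨p, hρ, IsSpec.arithmetic hp hN hm hL hΛ⟩
  · rintro ⟨p, hρ, hNp, hLp, d, hd, hNm⟩
    have hp : 2 ≤ p := by
      have h2 : 1 < ρ⁻¹ := (one_lt_inv₀ h0).2 h1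
      rw [hρ] at h2
      exact_mod_cast h2
    obtain ⟨ι, hι, l, hl⟩ := exists_spectrum_of_isGreatest hp hN hL hm hNp hLp hd hNm
    rw [← hρ, inv_inv, ← hfour] at hl
    exact isSpectral_of_tsum_eq_one hl

end ProductFormSpectral

theorem theorem1p2 (ρ : ℝ) (hρ0 : 0 < ρ) (hρ1 : ρ < 1)
    (N m L : ℕ) (hN : 2 ≤ N) (hm : 0 < m) (hL : 2 ≤ L)
    (hD : ProductFormSpectral.IsDirectSum N m L)
    (μ : MeasureTheory.Measure ℝ)
    (hμ : ProductFormSpectral.IsSelfSimilarMeasure ρ (ProductFormSpectral.digitSet N m L) μ) :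
    ProductFormSpectral.IsSpectral μ ↔
      ∃ p : ℕ, ρ⁻¹ = (p : ℝ) ∧ N ∣ p ∧ L ∣ p ∧
        ∃ d : ℕ, IsGreatest {i : ℕ | Nat.gcd (m * L / Nat.gcd (m * L) (p ^ i)) L ≠ 1} d ∧
          N ∣ m / Nat.gcd m (p ^ d) := by
  exact ProductFormSpectral.isSpectral_iff hρ0 hρ1 hN hm hL hD hμ
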